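/- **Setting.** Let $\mathcal X$ (prompts) and $\mathcal A$ (responses) be measurable spaces, $d_0$ a probability distribution on $\mathcal X$, and $\pi_0,\pi_{\mathrm{ref}}$ two policies (Markov kernels from $\mathcal X$ to $\mathcal A$). Let $\phi:\mathcal X\times\mathcal A\to\mathbb R^d$ ($d\ge 1$) be measurable with $\|\phi\|\le 1$, let $B>0$, $\Theta(B)=\{\theta\in\mathbb R^d:\|\theta\|\le B\}$, $\gamma=1/(2+e^{-B}+e^{B})$, $r_\theta(x,a)=\langle\theta,\phi(x,a)\rangle$, and suppose the true reward is $r^*=r_{\theta^*}$ with $\theta^*\in\Theta(B)$ and takes values in $[0,1]$. Given a query $(x,a^1,a^2)$, the label $y\in\{0,1\}$ follows the Bradley–Terry model $\mathbb P(y=1)=\sigma(r^*(x,a^1)-r^*(x,a^2))$, $\sigma(z)=1/(1+e^{-z})$. For $\eta>0$ and a reward $r$, put $$J_r(\pi)=\mathbb E_{x\sim d_0}\big[\mathbb E_{a\sim\pi(\cdot|x)}[r(x,a)]-\eta D_{\mathrm{KL}}(\pi(\cdot|x)\|\pi_0(\cdot|x))\big],\qquad J=J_{r^*},$$ let $\Pi=\{\pi(\cdot|x)\propto\pi_0(\cdot|x)\exp(r_\theta(x,\cdot)/\eta):\theta\in\Theta(B)\}$,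 and let $\pi^*$ be a maximizer of $J$ over $\Pi$. *Offline data.* $\mathcal D_{\mathrm{off}}=\{(x_i,a_i^1,a_i^2,y_i)\}_{i=1}^{n}$, $n\ge0$: the queries $(x_i,a_i^1,a_i^2)$ are arbitrary random variables, and given all of them the labels are independent and follow the Bradley–Terry model. For $\lambda>0$ let $\Sigma_{\mathrm{off}}=\lambda I+\sum_{i}(\phi(x_i,a_i^1)-\phi(x_i,a_i^2))(\phi(x_i,a_i^1)-\phi(x_i,a_i^2))^\top$, and write $\|z\|_{\Sigma}=\sqrt{z^\top\Sigma z}$, $\phi(x,\pi)=\mathbb E_{a\sim\pi(\cdot|x)}\phi(x,a)$. *Partial coverage.* For a number $T$ of online samples there are $\alpha=\alpha(T,\mathcal D_{\mathrm{off}})\in(0,1)$ and $C_{\mathrm{cov}}>0$ (both may depend on $\mathcal D_{\mathrm{off}}$) such that, almost surely, $$T^{1-\alpha}\,\big\|\mathbb E_{x\sim d_0}[\phi(x,\pi^*)-\phi(x,\pi_{\mathrm{ref}})]\big\|_{\Sigma_{\mathrm{off}}^{-1}}\le C_{\mathrm{cov}}.$$ *Algorithm (sequential hybrid setting, $m=1$).*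 In each round $t=1,\dots,T$, let $\theta^t$ be a maximizer over $\Theta(B)$ of the Bradley–Terry log-likelihood of $\mathcal D_{\mathrm{off}}$ together with the online comparisons of rounds $1,\dots,t-1$. The main agent plays a maximizer $\pi_t^1$ of $J_{r_{\theta^t}}$ over $\Pi$, and the enhancer plays $\pi_t^2=\pi_{\mathrm{ref}}$. Conditionally on the past, $x_t\sim d_0$, then independently $a_t^1\sim\pi_t^1(\cdot|x_t)$ and $a_t^2\sim\pi_{\mathrm{ref}}(\cdot|x_t)$; finally $y_t$ is drawn from the Bradley–Terry model. **Theorem.** There is an absolute constant $C>0$ such that, in every such setting, for all $T\ge1$ and $\delta\in(0,1)$, with $$\lambda=\frac{d\log(T/\delta)}{\gamma^2B^2},\qquad \beta=C\sqrt{\frac{d\log(T/\delta)}{\gamma^2}},$$ with probability at least $1-2\delta$, $$\sum_{t=1}^T\big[J(\pi^*)-J(\pi_t^1)\big]\le \beta\,T^{\alpha(T,\mathcal D_{\mathrm{off}})}\,C_{\mathrm{cov}}+\beta\sqrt{6Td\log\Big(1+\frac{T}{d\lambda}\Big)}-\eta\sum_{t=1}^T\mathbb E_{x\sim d_0}\big[D_{\mathrm{KL}}(\pi_t^1(\cdot|x)\|\pi^*(\cdot|x))\big].$$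 -/

import Mathlib

open MeasureTheory ProbabilityTheory

namespace RLHF

/-- One comparison `(x, a¹, a², y)`: a prompt, two responses and the preference signal;
`y = true` means that the first response is preferred. -/
abbrev Comparison (X A : Type*) := X × A × A × Bool

/-- The unlabelled part `(x, a¹, a²)` of a comparison. -/
def Comparison.query {X A : Type*} (c : Comparison X A) : X × A × A := (c.1, c.2.1, c.2.2.1)

/-- The preference signal `y` of a comparison. -/
def Comparison.label {X A : Type*} (c : Comparison X A) : Bool := c.2.2.2

/-- The linear reward `r_θ(x, a) = ⟨θ, φ(x, a)⟩`. -/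
noncomputable def linReward {X A : Type*} {d : ℕ} (φ : X → A → EuclideanSpace ℝ (Fin d))
    (θ : EuclideanSpace ℝ (Fin d)) (x : X) (a : A) : ℝ :=
  inner ℝ θ (φ x a)

/-- The Bradley-Terry probability of the label `y` for the query `(x, a¹, a²)` under the
reward `r`: the first response is preferred with probability `σ(r(x, a¹) - r(x, a²))`, the second
one with probability `σ(r(x, a²) - r(x, a¹))`, where `σ(z) = 1 / (1 + exp(-z))`. -/
noncomputable def btProb {X A : Type*} (r : X → A → ℝ) (q : X × A × A) (y : Bool) : ℝ :=
  if y then Real.sigmoid (r q.1 q.2.1 - r q.1 q.2.2)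
  else Real.sigmoid (r q.1 q.2.2 - r q.1 q.2.1)

/-- The Bradley-Terry log-likelihood `ℓ_D(θ)` of a finite dataset `D`. -/
noncomputable def logLik {X A ι : Type*} [Fintype ι] {d : ℕ}
    (φ : X → A → EuclideanSpace ℝ (Fin d)) (D : ι → Comparison X A)
    (θ : EuclideanSpace ℝ (Fin d)) : ℝ :=
  ∑ i, Real.log (btProb (linReward φ θ) (D i).query (D i).label)

/-- `θ` is a maximum likelihood estimator over `Θ(B) = {θ : ‖θ‖ ≤ B}` for the dataset `D`. -/
def IsMLE {X A ι : Type*} [Fintype ι] {d : ℕ}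
    (φ : X → A → EuclideanSpace ℝ (Fin d)) (B : ℝ) (D : ι → Comparison X A)
    (θ : EuclideanSpace ℝ (Fin d)) : Prop :=
  ‖θ‖ ≤ B ∧ ∀ θ' : EuclideanSpace ℝ (Fin d), ‖θ'‖ ≤ B → logLik φ D θ' ≤ logLik φ D θ

/-- The regularized covariance matrix
`Σ_D = lam • I + ∑ (φ(x, a¹) - φ(x, a²)) (φ(x, a¹) - φ(x, a²))ᵀ` of a finite dataset `D`. -/
noncomputable def covMatrix {X A ι : Type*} [Fintype ι] {d : ℕ}
    (φ : X → A → EuclideanSpace ℝ (Fin d)) (lam : ℝ) (D : ι → Comparison X A) :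
    Matrix (Fin d) (Fin d) ℝ :=
  lam • (1 : Matrix (Fin d) (Fin d) ℝ) +
    ∑ i, Matrix.vecMulVec
      (φ (D i).query.1 (D i).query.2.1 - φ (D i).query.1 (D i).query.2.2).ofLp
      (φ (D i).query.1 (D i).query.2.1 - φ (D i).query.1 (D i).query.2.2).ofLp

/-- The induced norm `‖z‖_S = √(zᵀ S z)`. -/
noncomputable def matNorm {d : ℕ} (S : Matrix (Fin d) (Fin d) ℝ)
    (z : EuclideanSpace ℝ (Fin d)) : ℝ :=
  Real.sqrt (z.ofLp ⬝ᵥ S.mulVec z.ofLp)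

section Policies

variable {X A : Type*} [MeasurableSpace X] [MeasurableSpace A]

/-- The Gibbs policy `π(· | x) ∝ π₀(· | x) exp(r(x, ·) / η)`. -/
noncomputable def gibbsPolicy (π₀ : Kernel X A) [IsMarkovKernel π₀] (η : ℝ) (r : X → A → ℝ) :
    Kernel X A :=
  π₀.withDensity fun x a =>
    ENNReal.ofReal (Real.exp (r x a / η) / ∫ a', Real.exp (r x a' / η) ∂(π₀ x))

/-- For a measurable reward, the Gibbs policy is the exponential tilting of the initial policy. -/
theorem gibbsPolicy_apply (π₀ : Kernel X A) [IsMarkovKernel π₀] (η : ℝ) {r : X → A → ℝ}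
    (hr : Measurable (Function.uncurry r)) (x : X) :
    gibbsPolicy π₀ η r x = (π₀ x).tilted (fun a => r x a / η) := by
  have h1 : Measurable (Function.uncurry fun (x : X) (a : A) => Real.exp (r x a / η)) :=
    Real.measurable_exp.comp (hr.div_const η)
  have h2 : Measurable fun x : X => ∫ a', Real.exp (r x a' / η) ∂(π₀ x) :=
    (h1.stronglyMeasurable.integral_kernel_prod_right (κ := π₀)).measurable
  have h3 : Measurable (Function.uncurry fun (x : X) (a : A) =>
      ENNReal.ofReal (Real.exp (r x a / η) / ∫ a', Real.exp (r x a' / η) ∂(π₀ x))) :=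
    (h1.div (h2.comp measurable_fst)).ennreal_ofReal
  rw [gibbsPolicy, Kernel.withDensity_apply _ h3]
  rfl

/-- The policy class `Π` of all Gibbs policies of linear rewards with parameter in `Θ(B)`. -/
def policyClass {d : ℕ} (π₀ : Kernel X A) [IsMarkovKernel π₀] (η B : ℝ)
    (φ : X → A → EuclideanSpace ℝ (Fin d)) : Set (Kernel X A) :=
  {π | ∃ θ : EuclideanSpace ℝ (Fin d), ‖θ‖ ≤ B ∧ π = gibbsPolicy π₀ η (linReward φ θ)}

/-- The KL divergence `D_KL(μ ‖ ν)` as a real number. -/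
noncomputable def klReal (μ ν : Measure A) : ℝ := (InformationTheory.klDiv μ ν).toReal

/-- The KL-regularized value
`E_{x ∼ d₀} [E_{a ∼ π(· | x)} r(x, a) - η D_KL(π(· | x) ‖ π₀(· | x))]` of a policy `π` for the
reward `r`. -/
noncomputable def value (d₀ : Measure X) (π₀ : Kernel X A) (η : ℝ) (r : X → A → ℝ)
    (π : Kernel X A) : ℝ :=
  ∫ x, ((∫ a, r x a ∂(π x)) - η * klReal (π x) (π₀ x)) ∂d₀

/-- `π` maximizes the KL-regularized value for the reward `r` over the policy class `Π`. -/
def IsOptimal {d : ℕ} (d₀ : Measure X) (π₀ : Kernel X A) [IsMarkovKernel π₀] (η B : ℝ)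
    (φ : X → A → EuclideanSpace ℝ (Fin d)) (r : X → A → ℝ) (π : Kernel X A) : Prop :=
  π ∈ policyClass π₀ η B φ ∧
    ∀ π' ∈ policyClass π₀ η B φ, value d₀ π₀ η r π' ≤ value d₀ π₀ η r π

/-- The expected feature `φ(x, π) = E_{a ∼ π(· | x)} φ(x, a)`. -/
noncomputable def feature {d : ℕ} (φ : X → A → EuclideanSpace ℝ (Fin d)) (π : Kernel X A)
    (x : X) : EuclideanSpace ℝ (Fin d) :=
  ∫ a, φ x a ∂(π x)

/-- Partial coverage by the offline data `D` with ratio coefficient `α ∈ (0, 1)` and coverage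
constant `Ccov > 0`, for `T` online samples:
`T ^ (1 - α) ‖E_{x ∼ d₀} [φ(x, π*) - φ(x, π_ref)]‖_{Σ_D⁻¹} ≤ Ccov`. -/
def PartialCoverage {ι : Type*} [Fintype ι] {d : ℕ} (d₀ : Measure X)
    (φ : X → A → EuclideanSpace ℝ (Fin d)) (πstar πref : Kernel X A) (lam : ℝ) (T : ℕ)
    (D : ι → Comparison X A) (α Ccov : ℝ) : Prop :=
  0 < α ∧ α < 1 ∧ 0 < Ccov ∧
    (T : ℝ) ^ (1 - α) *
      matNorm (covMatrix φ lam D)⁻¹ (∫ x, (feature φ πstar x - feature φ πref x) ∂d₀) ≤ Ccov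

/-- The offline data set together with the online comparisons of the rounds `s < t`. -/
def history {n : ℕ} (Doff : Fin n → Comparison X A) (Don : ℕ → Comparison X A) (t : ℕ) :
    Fin n ⊕ Fin t → Comparison X A :=
  Sum.elim Doff fun s => Don s

/-- The offline data: the queries `(xᵢ, aᵢ¹, aᵢ²)` are arbitrary random variables and, given all the
queries, the labels are independent and follow the Bradley-Terry model with reward `r`. -/
structure IsOfflineData {Ω : Type*} [mΩ : MeasurableSpace Ω] (P : Measure Ω)
    (r : X → A → ℝ) {n : ℕ} (Doff : Ω → Fin n → Comparison X A) : Prop where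
  measurable : Measurable Doff
  labels : ∀ b : Fin n → Bool,
    P⟦{ω | ∀ i, (Doff ω i).label = b i} |
        MeasurableSpace.comap (fun ω i => (Doff ω i).query) inferInstance⟧
      =ᵐ[P] fun ω => ∏ i, btProb r (Doff ω i).query (b i)

/-- A run of the sequential (one comparison per round) hybrid algorithm over the rounds
`t = 0, …, T - 1` with the enhancer playing the fixed policy `πref`.
`ℱ t` is the information available before round `t`. In round `t`

* `θhat t` is a maximum likelihood estimator from the offline data and the online
  comparisons of the previous rounds;
* the policy `πmain t` of the main agent maximizes over `Π` the KL-regularized value for the reward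
  with parameter `θhat t`;
* given `ℱ t`, a prompt `x ∼ d₀` and then, independently given `x`, responses
  `a¹ ∼ πmain t (· | x)` and `a² ∼ πref (· | x)` are drawn;
* given `ℱ t` and the query, the label follows the Bradley-Terry model with reward `r`. -/
structure IsHybridRun {Ω : Type*} [mΩ : MeasurableSpace Ω] (P : Measure Ω)
    {d : ℕ} (φ : X → A → EuclideanSpace ℝ (Fin d)) (B η : ℝ) (d₀ : Measure X)
    (π₀ : Kernel X A) [IsMarkovKernel π₀] (πref : Kernel X A) (r : X → A → ℝ)
    {n : ℕ} (Doff : Ω → Fin n → Comparison X A) (T : ℕ) (ℱ : Filtration ℕ mΩ)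
    (Don : ℕ → Ω → Comparison X A) (θhat : ℕ → Ω → EuclideanSpace ℝ (Fin d))
    (πmain : ℕ → Ω → Kernel X A) : Prop where
  measurable_offline : Measurable[ℱ 0] Doff
  measurable_online : ∀ t < T, Measurable[ℱ (t + 1)] (Don t)
  measurable_mle : ∀ t < T, Measurable[ℱ t] (θhat t)
  mle : ∀ t < T, ∀ ω, IsMLE φ B (history (Doff ω) (fun s => Don s ω) t) (θhat t ω)
  main_agent : ∀ t < T, ∀ ω, IsOptimal d₀ π₀ η B φ (linReward φ (θhat t ω)) (πmain t ω)
  query_law : ∀ t < T, ∀ S : Set (X × A × A), MeasurableSet S →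
    P⟦(fun ω => (Don t ω).query) ⁻¹' S | ℱ t⟧
      =ᵐ[P] fun ω => (d₀ ⊗ₘ (πmain t ω ×ₖ πref)).real S
  label_law : ∀ t < T,
    P⟦{ω | (Don t ω).label = true} |
        ℱ t ⊔ MeasurableSpace.comap (fun ω => (Don t ω).query) inferInstance⟧
      =ᵐ[P] fun ω => btProb r (Don t ω).query true

end Policies

end RLHF

/-! Regret reduces to estimation error. Among Gibbs policies the value for the reward `r_θ'` equals
a constant minus `η` times the expected divergence to the Gibbs policy of `θ'`
(`value_gibbsPolicy`). Hence each optimal policy is almost everywhere the Gibbs policy of its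
parameter, and the regret of round `t` is exactly `η` times the expected divergence of its policy
from `π*`. Adding the divergence term of the claim doubles this. A divergence plus its reverse is
`⟨θ - θ*, φ(π) - φ(π*)⟩ / η`, so dropping the reverse one leaves `2 ⟨θ^t - θ*, E[φ(π_t) - φ(π*)]⟩`
(`regret_add_kl_le`).

Inserting `π_ref` splits this direction in two. The part `φ(π*) - φ(π_ref)` is bounded by
Cauchy-Schwarz in `Σ_off` and by coverage. The part `φ(π_t) - φ(π_ref)` is the mean feature
difference of the query of round `t`. It is bounded by the confidence width and the expected squared
norm of that difference in the inverse covariance. A Markov bound for an exponential supermartingale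
replaces expected norms by realised ones (`measure_compensator_gt_le`), which the elliptical
potential lemma sums.

The confidence width comes from the logistic loss. Its curvature turns optimality of the likelihood
into a quadratic error bounded by a linear function of the centred labels (`IsMLE.sum_sq_le`), and a
self-normalized inequality controls the latter. The potential `exp(½ ‖S‖²_{A⁻¹}) / √(det A)`
decreases on average when a label is revealed (`sum_labelWeight_mul_mixturePotential_le`).

The width must not depend on the number of offline samples. The potential therefore starts from `A =
Σ_off`, known once the offline queries are, instead of `λ I`. The offline labels then add the
offline Gram matrix a second time. The final matrix is at most twice the true covariance, while its
determinant relative to `Σ_off` is bounded through `d` and `T` alone.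

When `T ≤ dλ` no estimation is needed: boundedness of rewards already gives the claim
(`trivial_regret_le`). -/

/-! ### Quadratic forms, inverses and determinants of positive matrices. -/

open Matrix in
/-- Sherman-Morrison for the quadratic form of the inverse. -/
theorem Matrix.PosDef.inv_add_vecMulVec_quad {ι : Type*} [Fintype ι] [DecidableEq ι]
    {A : Matrix ι ι ℝ} (hA : A.PosDef) (z u : ι → ℝ) :
    u ⬝ᵥ (A + vecMulVec z z)⁻¹ *ᵥ u
      = u ⬝ᵥ A⁻¹ *ᵥ u - (z ⬝ᵥ A⁻¹ *ᵥ u) ^ 2 / (1 + z ⬝ᵥ A⁻¹ *ᵥ z) := by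
  have hw : 0 ≤ z ⬝ᵥ A⁻¹ *ᵥ z := by
    simpa using hA.inv.posSemidef.dotProduct_mulVec_nonneg z
  have hzz : (vecMulVec z z).PosSemidef := by simpa using posSemidef_vecMulVec_self_star z
  have hA' : (A + vecMulVec z z).PosDef := hA.add_posSemidef hzz
  have hu : IsUnit (A + vecMulVec z z).det := (isUnit_iff_isUnit_det _).1 hA'.isUnit
  have hu0 : IsUnit A.det := (isUnit_iff_isUnit_det _).1 hA.isUnit
  set c := (z ⬝ᵥ A⁻¹ *ᵥ u) / (1 + z ⬝ᵥ A⁻¹ *ᵥ z) with hc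
  have hmv : ∀ v : ι → ℝ, A *ᵥ (A⁻¹ *ᵥ v) = v := fun v => by
    rw [mulVec_mulVec, mul_nonsing_inv _ hu0, one_mulVec]
  have key : (A + vecMulVec z z) *ᵥ (A⁻¹ *ᵥ u - c • A⁻¹ *ᵥ z) = u := by
    rw [add_mulVec, mulVec_sub, mulVec_smul, hmv, hmv, vecMulVec_mulVec, dotProduct_sub,
      dotProduct_smul]
    have : z ⬝ᵥ A⁻¹ *ᵥ u - c • (z ⬝ᵥ A⁻¹ *ᵥ z) = c := by
      rw [hc, smul_eq_mul]; field_simp; ring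
    rw [this]
    ext i; simp [mul_comm]
  have h2 : (A + vecMulVec z z)⁻¹ *ᵥ u = A⁻¹ *ᵥ u - c • A⁻¹ *ᵥ z := by
    conv_lhs => rw [← key]
    rw [mulVec_mulVec, nonsing_inv_mul _ hu, one_mulVec]
  have hsymm : u ⬝ᵥ A⁻¹ *ᵥ z = z ⬝ᵥ A⁻¹ *ᵥ u := by
    rw [dotProduct_mulVec, ← mulVec_transpose, dotProduct_comm]
    have := hA.inv.isHermitian.eq
    rw [conjTranspose_eq_transpose_of_trivial] at this
    rw [this]
  rw [h2, dotProduct_sub, dotProduct_smul, hsymm, hc, smul_eq_mul]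
  ring

-- Rank-one determinant update: it makes the log-determinant telescope in the elliptical potential
-- and supplies the normalization of the mixture potential.
open Matrix in
theorem Matrix.det_add_vecMulVec_self {ι : Type*} [Fintype ι] [DecidableEq ι]
    {A : Matrix ι ι ℝ} (hA : IsUnit A.det) (z : ι → ℝ) :
    (A + vecMulVec z z).det = A.det * (1 + z ⬝ᵥ A⁻¹ *ᵥ z) := by
  rw [vecMulVec_eq Unit, det_add_replicateCol_mul_replicateRow hA]
  congr 1
  rw [det_unique]
  simp [Matrix.mul_apply, dotProduct, mulVec, Finset.sum_mul, Finset.mul_sum]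
  rw [Finset.sum_comm]
  refine Finset.sum_congr rfl fun i _ => Finset.sum_congr rfl fun j _ => by ring

-- The quadratic `t ↦ (u + t v)ᵀ A (u + t v)` is nonnegative, so its discriminant is nonpositive.
open Matrix in
theorem Matrix.PosSemidef.sq_dotProduct_mulVec_le {ι : Type*} [Fintype ι] [DecidableEq ι]
    {A : Matrix ι ι ℝ} (hA : A.PosSemidef) (u v : ι → ℝ) :
    (u ⬝ᵥ A *ᵥ v) ^ 2 ≤ (u ⬝ᵥ A *ᵥ u) * (v ⬝ᵥ A *ᵥ v) := by
  have hsymm : v ⬝ᵥ A *ᵥ u = u ⬝ᵥ A *ᵥ v := by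
    rw [dotProduct_mulVec, ← mulVec_transpose, dotProduct_comm]
    have := hA.isHermitian.eq
    rw [conjTranspose_eq_transpose_of_trivial] at this
    rw [this]
  have h : ∀ t : ℝ, 0 ≤ (v ⬝ᵥ A *ᵥ v) * (t * t) + (2 * (u ⬝ᵥ A *ᵥ v)) * t + u ⬝ᵥ A *ᵥ u := by
    intro t
    have := hA.dotProduct_mulVec_nonneg (u + t • v)
    simp only [star_trivial, mulVec_add, mulVec_smul, add_dotProduct, dotProduct_add,
      smul_dotProduct, dotProduct_smul, smul_eq_mul, hsymm] at this
    linarith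
  have := discrim_le_zero h
  unfold discrim at this
  nlinarith

open Matrix in
theorem Matrix.PosDef.sq_dotProduct_le {ι : Type*} [Fintype ι] [DecidableEq ι]
    {A : Matrix ι ι ℝ} (hA : A.PosDef) (u v : ι → ℝ) :
    (u ⬝ᵥ v) ^ 2 ≤ (u ⬝ᵥ A *ᵥ u) * (v ⬝ᵥ A⁻¹ *ᵥ v) := by
  have hu0 : IsUnit A.det := (isUnit_iff_isUnit_det _).1 hA.isUnit
  have h := hA.posSemidef.sq_dotProduct_mulVec_le u (A⁻¹ *ᵥ v)
  have hmv : A *ᵥ (A⁻¹ *ᵥ v) = v := by rw [mulVec_mulVec, mul_nonsing_inv _ hu0, one_mulVec]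
  rwa [hmv, dotProduct_comm (A⁻¹ *ᵥ v) v] at h

-- Inversion reverses the order `λ I ≤ A`. The hypothesis is tested at `A⁻¹ z`, then combined with
-- Cauchy-Schwarz for `z` and `A⁻¹ z`.
open Matrix in
theorem Matrix.PosDef.dotProduct_inv_mulVec_le {ι : Type*} [Fintype ι] [DecidableEq ι]
    {A : Matrix ι ι ℝ} (hA : A.PosDef) {lam : ℝ} (hlam : 0 < lam)
    (h : ∀ u : ι → ℝ, lam * (u ⬝ᵥ u) ≤ u ⬝ᵥ A *ᵥ u) (z : ι → ℝ) :
    z ⬝ᵥ A⁻¹ *ᵥ z ≤ (z ⬝ᵥ z) / lam := by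
  have hu0 : IsUnit A.det := (isUnit_iff_isUnit_det _).1 hA.isUnit
  have hmv : A *ᵥ (A⁻¹ *ᵥ z) = z := by rw [mulVec_mulVec, mul_nonsing_inv _ hu0, one_mulVec]
  have h1 := h (A⁻¹ *ᵥ z)
  rw [hmv, dotProduct_comm _ z] at h1
  have h2 := (PosSemidef.one (n := ι) (R := ℝ)).sq_dotProduct_mulVec_le z (A⁻¹ *ᵥ z)
  rw [one_mulVec, one_mulVec] at h2
  have hw : 0 ≤ z ⬝ᵥ A⁻¹ *ᵥ z := by
    simpa using hA.inv.posSemidef.dotProduct_mulVec_nonneg z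
  have hz : 0 ≤ z ⬝ᵥ z := by simpa using (PosSemidef.one (n := ι) (R := ℝ)).dotProduct_mulVec_nonneg z
  rw [le_div_iff₀ hlam]
  rcases hw.eq_or_lt with h0 | h0
  · rw [← h0]; simpa using hz
  · have : (z ⬝ᵥ A⁻¹ *ᵥ z) * ((z ⬝ᵥ A⁻¹ *ᵥ z) * lam) ≤ (z ⬝ᵥ A⁻¹ *ᵥ z) * (z ⬝ᵥ z) := by
      nlinarith [mul_le_mul_of_nonneg_left h1 hz]
    exact le_of_mul_le_mul_left this h0

-- The arithmetic-geometric mean inequality for the eigenvalues.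
open Matrix in
theorem Matrix.PosSemidef.det_le_trace_div_pow {ι : Type*} [Fintype ι] [DecidableEq ι] [Nonempty ι]
    {A : Matrix ι ι ℝ} (hA : A.PosSemidef) :
    A.det ≤ (A.trace / Fintype.card ι) ^ Fintype.card ι := by
  have hd : (0 : ℝ) < Fintype.card ι := by exact_mod_cast Fintype.card_pos
  have hg := Real.geom_mean_le_arith_mean_weighted Finset.univ (fun _ : ι => (1 : ℝ) / Fintype.card ι)
    hA.1.eigenvalues (fun i _ => by positivity) (by simp) (fun i _ => hA.eigenvalues_nonneg i)
  have h1 : A.det = ∏ i, hA.1.eigenvalues i := by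
    simpa using hA.1.det_eq_prod_eigenvalues
  have h2 : A.trace = ∑ i, hA.1.eigenvalues i := by
    simpa using hA.1.trace_eq_sum_eigenvalues
  rw [← Finset.mul_sum, ← h2, Real.finsetProd_rpow _ _ (fun i _ => hA.eigenvalues_nonneg i), ← h1]
    at hg
  have hdet := hA.det_nonneg
  calc A.det = (A.det ^ ((1 : ℝ) / Fintype.card ι)) ^ Fintype.card ι := by
        rw [one_div, Real.rpow_inv_natCast_pow hdet Fintype.card_ne_zero]
    _ ≤ _ := by
        gcongr
        refine hg.trans (le_of_eq (by ring))

open Matrix MatrixOrder in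
theorem Matrix.PosDef.det_le_mul_trace_pow {ι : Type*} [Fintype ι] [DecidableEq ι] [Nonempty ι]
    {A₀ A : Matrix ι ι ℝ} (hA₀ : A₀.PosDef) (hA : A.PosSemidef) :
    A.det ≤ A₀.det * ((A₀⁻¹ * A).trace / Fintype.card ι) ^ Fintype.card ι := by
  obtain ⟨R, hR⟩ : ∃ R : Matrix ι ι ℝ, A₀⁻¹ = Rᴴ * R := by
    exact CStarAlgebra.nonneg_iff_eq_star_mul_self.mp hA₀.inv.posSemidef.nonneg
  have hM := (hA.mul_mul_conjTranspose_same R).det_le_trace_div_pow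
  have htr : (R * A * Rᴴ).trace = (A₀⁻¹ * A).trace := by
    rw [trace_mul_comm, ← Matrix.mul_assoc, ← hR]
  have hdet : (R * A * Rᴴ).det = A₀.det⁻¹ * A.det := by
    have : A₀⁻¹.det = A₀.det⁻¹ := by rw [det_nonsing_inv, Ring.inverse_eq_inv']
    rw [← this, hR, det_mul, det_mul, det_mul]; ring
  rw [htr, hdet, inv_mul_le_iff₀ hA₀.det_pos] at hM
  exact hM

/-! ### The self-normalized supermartingale for Bradley-Terry labels. -/

namespace RLHF

open Matrix

/-- The Gaussian mixture potential `exp(½ ‖S‖²_{A⁻¹}) / √(det A)`. -/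
noncomputable def mixturePotential {ι : Type*} [Fintype ι] [DecidableEq ι]
    (A : Matrix ι ι ℝ) (S : ι → ℝ) : ℝ :=
  Real.exp ((S ⬝ᵥ A⁻¹ *ᵥ S) / 2) / Real.sqrt A.det

/-- The probability of the label `y` when the label `true` has probability `p`. -/
def labelWeight (p : ℝ) (y : Bool) : ℝ := if y then p else 1 - p

/-- The centred label. -/
def labelNoise (p : ℝ) (y : Bool) : ℝ := (if y then 1 else 0) - p

/-- This is `1 - x ≤ exp (-x)` at `x = w / (1 + w)`, inverted. -/
theorem exp_div_one_add_le {w : ℝ} (hw : 0 ≤ w) : Real.exp (w / (1 + w)) ≤ 1 + w := by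
  have h := Real.add_one_le_exp (-(w / (1 + w)))
  rw [Real.exp_neg] at h
  have h1 : -(w / (1 + w)) + 1 = (1 + w)⁻¹ := by field_simp; ring
  rw [h1] at h
  exact (inv_le_inv₀ (by positivity) (Real.exp_pos _)).1 h

theorem posSemidef_vecMulVec_self {ι : Type*} [Fintype ι] (z : ι → ℝ) :
    (vecMulVec z z).PosSemidef := by
  simpa using posSemidef_vecMulVec_self_star z

/-- A closed-form substitute for integrating exponential supermartingales against a Gaussian. By
Sherman-Morrison, and since `ε² ≤ 1`, the new exponent exceeds the old one by at most `ε t - t² / 2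
+ w / (2 (1 + w))`, with `t = m / (1 + w)`. The determinant gains the factor `1 + w`, whose root
absorbs the last term. What remains is the sub-Gaussian increment of `ε` at slope `t`. -/
theorem mixturePotential_add_le {ι : Type*} [Fintype ι] [DecidableEq ι]
    {A : Matrix ι ι ℝ} (hA : A.PosDef) (S z : ι → ℝ) {ε : ℝ} (hε : |ε| ≤ 1) :
    mixturePotential (A + vecMulVec z z) (S + ε • z) ≤
      mixturePotential A S * Real.exp (-((z ⬝ᵥ A⁻¹ *ᵥ S) / (1 + z ⬝ᵥ A⁻¹ *ᵥ z)) ^ 2 / 2) *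
        Real.exp (ε * ((z ⬝ᵥ A⁻¹ *ᵥ S) / (1 + z ⬝ᵥ A⁻¹ *ᵥ z))) := by
  have hsymm : S ⬝ᵥ A⁻¹ *ᵥ z = z ⬝ᵥ A⁻¹ *ᵥ S := by
    rw [dotProduct_mulVec, ← mulVec_transpose, dotProduct_comm]
    have := hA.inv.isHermitian.eq
    rw [conjTranspose_eq_transpose_of_trivial] at this
    rw [this]
  have hw : 0 ≤ z ⬝ᵥ A⁻¹ *ᵥ z := by
    simpa using hA.inv.posSemidef.dotProduct_mulVec_nonneg z
  unfold mixturePotential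
  rw [hA.inv_add_vecMulVec_quad, det_add_vecMulVec_self ((isUnit_iff_isUnit_det _).1 hA.isUnit)]
  simp only [mulVec_add, mulVec_smul, add_dotProduct, dotProduct_add, smul_dotProduct,
    dotProduct_smul, smul_eq_mul, hsymm]
  set w := z ⬝ᵥ A⁻¹ *ᵥ z
  set m := z ⬝ᵥ A⁻¹ *ᵥ S
  set Z := S ⬝ᵥ A⁻¹ *ᵥ S
  have hdet := hA.det_pos
  rw [Real.sqrt_mul hdet.le, div_le_iff₀ (by positivity)]
  have hs : Real.exp (w / (1 + w) / 2) ≤ Real.sqrt (1 + w) := by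
    rw [Real.exp_half]
    exact Real.sqrt_le_sqrt (exp_div_one_add_le hw)
  have hε2 : ε ^ 2 ≤ 1 := by rwa [sq_le_one_iff_abs_le_one]
  have hmain : (Z + ε * m + ε * (m + ε * w) - (m + ε * w) ^ 2 / (1 + w)) / 2
      ≤ Z / 2 + -(m / (1 + w)) ^ 2 / 2 + ε * (m / (1 + w)) + w / (1 + w) / 2 := by
    -- The slack is an explicit nonnegative quantity, with `|ε| ≤ 1` used only in the second
    -- summand.
    have h1 : Z / 2 + -(m / (1 + w)) ^ 2 / 2 + ε * (m / (1 + w)) + w / (1 + w) / 2 -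
        (Z + ε * m + ε * (m + ε * w) - (m + ε * w) ^ 2 / (1 + w)) / 2 =
        (w * (m / (1 + w)) ^ 2 + (1 - ε ^ 2) * (w / (1 + w))) / 2 := by
      field_simp; ring
    have h2 : 0 ≤ (w * (m / (1 + w)) ^ 2 + (1 - ε ^ 2) * (w / (1 + w))) / 2 := by
      have : 0 ≤ 1 - ε ^ 2 := by linarith
      positivity
    linarith
  calc Real.exp ((Z + ε * m + ε * (m + ε * w) - (m + ε * w) ^ 2 / (1 + w)) / 2)
      ≤ Real.exp (Z / 2 + -(m / (1 + w)) ^ 2 / 2 + ε * (m / (1 + w)) + w / (1 + w) / 2) :=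
        Real.exp_le_exp.2 hmain
    _ = Real.exp (Z / 2) * Real.exp (-(m / (1 + w)) ^ 2 / 2) * Real.exp (ε * (m / (1 + w))) *
          Real.exp (w / (1 + w) / 2) := by rw [Real.exp_add, Real.exp_add, Real.exp_add]
    _ ≤ Real.exp (Z / 2) * Real.exp (-(m / (1 + w)) ^ 2 / 2) * Real.exp (ε * (m / (1 + w))) *
          Real.sqrt (1 + w) := by gcongr
    _ = _ := by
      have : Real.sqrt A.det ≠ 0 := (Real.sqrt_pos.2 hdet).ne'
      field_simp

theorem labelNoise_abs_le {p : ℝ} (h0 : 0 ≤ p) (h1 : p ≤ 1) (y : Bool) : |labelNoise p y| ≤ 1 := by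
  cases y <;> simp [labelNoise, abs_le] <;> constructor <;> linarith

theorem labelWeight_nonneg {p : ℝ} (h0 : 0 ≤ p) (h1 : p ≤ 1) (y : Bool) : 0 ≤ labelWeight p y := by
  cases y <;> simp [labelWeight, h0, h1]

/-- The chord bound `exp (ε t) ≤ cosh t + ε sinh t` holds for `|ε| ≤ 1`. The noise is centred, so
its linear term averages out and `cosh t ≤ exp (t² / 2)` remains. -/
theorem sum_labelWeight_mul_exp_le {p : ℝ} (h0 : 0 ≤ p) (h1 : p ≤ 1) (t : ℝ) :
    ∑ y : Bool, labelWeight p y * Real.exp (labelNoise p y * t) ≤ Real.exp (t ^ 2 / 2) := by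
  calc ∑ y : Bool, labelWeight p y * Real.exp (labelNoise p y * t)
      ≤ ∑ y : Bool, labelWeight p y * (Real.cosh t + labelNoise p y * Real.sinh t) :=
        Finset.sum_le_sum fun y _ => mul_le_mul_of_nonneg_left
          (Real.exp_mul_le_cosh_add_mul_sinh (labelNoise_abs_le h0 h1 y) t)
          (labelWeight_nonneg h0 h1 y)
    _ = Real.cosh t := by simp [labelWeight, labelNoise]; ring
    _ ≤ _ := Real.cosh_le_exp_half_sq t

theorem mixturePotential_nonneg {ι : Type*} [Fintype ι] [DecidableEq ι]
    (A : Matrix ι ι ℝ) (S : ι → ℝ) : 0 ≤ mixturePotential A S := by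
  unfold mixturePotential; positivity

/-- The mixture potential is a supermartingale along a single label. -/
theorem sum_labelWeight_mul_mixturePotential_le {ι : Type*} [Fintype ι] [DecidableEq ι]
    {A : Matrix ι ι ℝ} (hA : A.PosDef) (S z : ι → ℝ) {p : ℝ} (h0 : 0 ≤ p) (h1 : p ≤ 1) :
    ∑ y : Bool, labelWeight p y *
      mixturePotential (A + vecMulVec z z) (S + labelNoise p y • z) ≤ mixturePotential A S := by
  set t := (z ⬝ᵥ A⁻¹ *ᵥ S) / (1 + z ⬝ᵥ A⁻¹ *ᵥ z) with ht
  calc _ ≤ ∑ y : Bool, labelWeight p y * (mixturePotential A S * Real.exp (-t ^ 2 / 2) *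
        Real.exp (labelNoise p y * t)) :=
        Finset.sum_le_sum fun y _ => mul_le_mul_of_nonneg_left
          (mixturePotential_add_le hA S z (labelNoise_abs_le h0 h1 y)) (labelWeight_nonneg h0 h1 y)
    _ = mixturePotential A S * Real.exp (-t ^ 2 / 2) *
        ∑ y : Bool, labelWeight p y * Real.exp (labelNoise p y * t) := by
        rw [Finset.mul_sum]; exact Finset.sum_congr rfl fun y _ => by ring
    _ ≤ mixturePotential A S * Real.exp (-t ^ 2 / 2) * Real.exp (t ^ 2 / 2) :=
        mul_le_mul_of_nonneg_left (sum_labelWeight_mul_exp_le h0 h1 t)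
          (mul_nonneg (mixturePotential_nonneg _ _) (Real.exp_pos _).le)
    _ = mixturePotential A S := by
        rw [mul_assoc, ← Real.exp_add, neg_div, neg_add_cancel, Real.exp_zero, mul_one]

/-- The mixture potential is a supermartingale along finitely many independent labels. -/
theorem sum_prod_labelWeight_mul_mixturePotential_le {ι : Type*} [Fintype ι] [DecidableEq ι]
    {n : ℕ} (z : Fin n → ι → ℝ) (p : Fin n → ℝ) (h0 : ∀ i, 0 ≤ p i) (h1 : ∀ i, p i ≤ 1)
    {A : Matrix ι ι ℝ} (hA : A.PosDef) (S : ι → ℝ) :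
    ∑ b : Fin n → Bool, (∏ i, labelWeight (p i) (b i)) *
      mixturePotential (A + ∑ i, vecMulVec (z i) (z i)) (S + ∑ i, labelNoise (p i) (b i) • z i)
      ≤ mixturePotential A S := by
  induction n generalizing A S with
  | zero => simp
  | succ n ih =>
    have hA' : (A + vecMulVec (z 0) (z 0)).PosDef :=
      hA.add_posSemidef (posSemidef_vecMulVec_self _)
    rw [← (Fin.consEquiv fun _ => Bool).sum_comp, Fintype.sum_prod_type]
    refine le_trans (Finset.sum_le_sum fun y _ => ?_)
      (sum_labelWeight_mul_mixturePotential_le hA S (z 0) (h0 0) (h1 0))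
    have := ih (fun i => z i.succ) (fun i => p i.succ) (fun i => h0 _) (fun i => h1 _) hA'
      (S + labelNoise (p 0) y • z 0)
    refine le_trans (le_of_eq ?_)
      (mul_le_mul_of_nonneg_left this (labelWeight_nonneg (h0 0) (h1 0) y))
    rw [Finset.mul_sum]
    refine Finset.sum_congr rfl fun b _ => ?_
    simp only [Fin.consEquiv_apply, Fin.prod_univ_succ, Fin.sum_univ_succ, Fin.cons_zero,
      Fin.cons_succ, add_assoc, mul_assoc]

end RLHF

/-! ### Curvature of the logistic loss and the error of maximum likelihood. -/

namespace RLHF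

open Matrix

theorem sigmoid_mul_one_sub (s : ℝ) :
    Real.sigmoid s * (1 - Real.sigmoid s) = 1 / (2 + Real.exp (-s) + Real.exp s) := by
  have h := Real.exp_pos s
  have h2 := Real.exp_pos (-s)
  have h3 : Real.exp (-s) * Real.exp s = 1 := by rw [← Real.exp_add]; simp
  rw [Real.sigmoid_def]
  field_simp
  nlinarith

theorem one_add_exp_hasDerivAt (s : ℝ) :
    HasDerivAt (fun s => Real.log (1 + Real.exp s)) (Real.sigmoid s) s := by
  have h := ((Real.hasDerivAt_exp s).const_add 1).log (by positivity)
  convert h using 1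
  rw [Real.sigmoid_def, Real.exp_neg]
  have := Real.exp_pos s
  field_simp
  ring

theorem log_sigmoid (s : ℝ) : Real.log (Real.sigmoid s) = s - Real.log (1 + Real.exp s) := by
  have h := Real.exp_pos s
  have : Real.sigmoid s = Real.exp s / (1 + Real.exp s) := by
    rw [Real.sigmoid_def, Real.exp_neg]; field_simp; ring
  rw [this, Real.log_div h.ne' (by positivity), Real.log_exp]

theorem log_sigmoid_neg (s : ℝ) : Real.log (Real.sigmoid (-s)) = -Real.log (1 + Real.exp s) := by
  rw [Real.sigmoid_def, neg_neg, Real.log_inv]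

theorem exp_half_le_two : Real.exp (1 / 2) ≤ 2 := by
  have h := Real.exp_one_lt_d9
  have : Real.exp (1 / 2) ^ 2 = Real.exp 1 := by rw [← Real.exp_nat_mul]; norm_num
  nlinarith [Real.exp_pos (1 / 2)]

/-- The curvature of the logistic loss on a slightly enlarged interval. -/
theorem sigmoid_deriv_lower {B s : ℝ} (hs : |s| ≤ B + 1 / 2) :
    1 / (2 + Real.exp (-B) + Real.exp B) / 2 ≤ Real.sigmoid s * (1 - Real.sigmoid s) := by
  rw [sigmoid_mul_one_sub, div_div]
  apply one_div_le_one_div_of_le (by positivity)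
  have h1 : Real.cosh s ≤ Real.cosh (B + 1 / 2) := by
    rw [Real.cosh_le_cosh]; exact hs.trans (le_abs_self _)
  rw [Real.cosh_eq, Real.cosh_eq] at h1
  have h2 : Real.exp (B + 1 / 2) ≤ Real.exp B * 2 := by
    rw [Real.exp_add]; gcongr; exact exp_half_le_two
  have h3 : Real.exp (-(B + 1 / 2)) ≤ Real.exp (-B) := Real.exp_le_exp.2 (by linarith)
  nlinarith [Real.exp_pos (-B), Real.exp_pos B]

theorem sigmoid_sub_lower {κ R a b : ℝ}
    (hκ : ∀ s, |s| ≤ R → κ ≤ Real.sigmoid s * (1 - Real.sigmoid s))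
    (ha : |a| ≤ R) (hb : |b| ≤ R) (hab : a ≤ b) :
    κ * (b - a) ≤ Real.sigmoid b - Real.sigmoid a := by
  refine (convex_Icc a b).mul_sub_le_image_sub_of_le_deriv continuous_sigmoid.continuousOn
    differentiable_sigmoid.differentiableOn (fun s hs => ?_) a (by simp [hab]) b (by simp [hab]) hab
  rw [interior_Icc] at hs
  rw [Real.deriv_sigmoid]
  apply hκ
  rw [abs_le] at *
  exact ⟨by linarith [hs.1], by linarith [hs.2]⟩

/-- The sigmoid is the derivative of the softplus, so a lower bound on its slope makes the softplus
minus its quadratic minorant monotone on either side of `a`. -/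
theorem softplus_strongly_convex {κ R a b : ℝ}
    (hκ : ∀ s, |s| ≤ R → κ ≤ Real.sigmoid s * (1 - Real.sigmoid s))
    (ha : |a| ≤ R) (hb : |b| ≤ R) :
    Real.log (1 + Real.exp a) + Real.sigmoid a * (b - a) + κ / 2 * (b - a) ^ 2
      ≤ Real.log (1 + Real.exp b) := by
  set g : ℝ → ℝ := fun s => Real.log (1 + Real.exp s) - Real.sigmoid a * (s - a)
    - κ / 2 * (s - a) ^ 2 with hg
  have hd : ∀ s, HasDerivAt g (Real.sigmoid s - Real.sigmoid a - κ * (s - a)) s := by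
    intro s
    have h1 := (((one_add_exp_hasDerivAt s).sub
      (((hasDerivAt_id s).sub_const a).const_mul (Real.sigmoid a))).sub
      ((((hasDerivAt_id s).sub_const a).pow 2).const_mul (κ / 2)))
    refine HasDerivAt.congr_deriv (f := g) h1 ?_
    simp; ring
  have hc : Continuous g := continuous_iff_continuousAt.2 fun s => (hd s).continuousAt
  have hga : g a = Real.log (1 + Real.exp a) := by simp [hg]
  suffices g a ≤ g b by rw [hga] at this; simp only [hg] at this; linarith
  rcases le_total a b with hab | hab
  · have hm : MonotoneOn g (Set.Icc a b) :=
      monotoneOn_of_deriv_nonneg (convex_Icc a b) hc.continuousOn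
        (fun s _ => (hd s).differentiableAt.differentiableWithinAt) fun s hs => by
        rw [interior_Icc] at hs
        rw [(hd s).deriv]
        have hs' : |s| ≤ R := by
          rw [abs_le] at *
          exact ⟨by linarith [hs.1], by linarith [hs.2]⟩
        linarith [sigmoid_sub_lower hκ ha hs' hs.1.le]
    exact hm (by simp [hab]) (by simp [hab]) hab
  · have hm : AntitoneOn g (Set.Icc b a) :=
      antitoneOn_of_deriv_nonpos (convex_Icc b a) hc.continuousOn
        (fun s _ => (hd s).differentiableAt.differentiableWithinAt) fun s hs => by
        rw [interior_Icc] at hs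
        rw [(hd s).deriv]
        have hs' : |s| ≤ R := by
          rw [abs_le] at *
          exact ⟨by linarith [hs.1], by linarith [hs.2]⟩
        linarith [sigmoid_sub_lower hκ hs' ha hs.2.le]
    exact hm (by simp [hab]) (by simp [hab]) hab

/-- With `p = exp (s / 2)` and `q = exp (t / 2)`, this is `(1 + p q)² ≤ (1 + p²) (1 + q²)`. -/
theorem softplus_midpoint_le (s t : ℝ) :
    2 * Real.log (1 + Real.exp ((s + t) / 2)) ≤
      Real.log (1 + Real.exp s) + Real.log (1 + Real.exp t) := by
  rw [← Real.log_mul (by positivity) (by positivity), ← Real.log_rpow (by positivity)]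
  apply Real.log_le_log (by positivity)
  have h1 : Real.exp s = Real.exp (s / 2) ^ 2 := by rw [← Real.exp_nat_mul]; congr 1; push_cast; ring
  have h2 : Real.exp t = Real.exp (t / 2) ^ 2 := by rw [← Real.exp_nat_mul]; congr 1; push_cast; ring
  have h3 : Real.exp ((s + t) / 2) = Real.exp (s / 2) * Real.exp (t / 2) := by
    rw [← Real.exp_add]; congr 1; ring
  rw [h1, h2, h3, Real.rpow_two]
  nlinarith [sq_nonneg (Real.exp (s / 2) - Real.exp (t / 2))]

/-- Reward gaps reach `2 B`, but `γ` is the slope of the sigmoid at `B` only. The base point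
satisfies `|t| ≤ 1`, so the midpoint of `s` and `t` stays within `B + 1/2`, where the slope is still
at least `γ / 2`. Strong convexity from `t` to the midpoint, followed by midpoint convexity out to
`s`, gives the constant: `2 · (γ / 4) · (1 / 4) = γ / 8`. -/
theorem softplus_bregman_lower {B s t : ℝ} (hs : |s| ≤ 2 * B) (ht : |t| ≤ 2 * B) (ht1 : |t| ≤ 1) :
    Real.log (1 + Real.exp t) + Real.sigmoid t * (s - t) +
        1 / (2 + Real.exp (-B) + Real.exp B) / 8 * (s - t) ^ 2 ≤ Real.log (1 + Real.exp s) := by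
  have ha : |t| ≤ B + 1 / 2 := by linarith
  have hb : |(s + t) / 2| ≤ B + 1 / 2 := by
    rw [abs_le] at *; constructor <;> linarith
  have h1 := softplus_strongly_convex (fun s hs => sigmoid_deriv_lower hs) ha hb
  have h2 := softplus_midpoint_le s t
  nlinarith

/-- The difference `φ(x, a¹) - φ(x, a²)` of the features of a query. -/
noncomputable def diffFeature {X A : Type*} {d : ℕ} (φ : X → A → EuclideanSpace ℝ (Fin d))
    (q : X × A × A) : Fin d → ℝ :=
  (φ q.1 q.2.1 - φ q.1 q.2.2).ofLp

theorem linReward_sub_linReward {X A : Type*} {d : ℕ} (φ : X → A → EuclideanSpace ℝ (Fin d))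
    (θ : EuclideanSpace ℝ (Fin d)) (q : X × A × A) :
    linReward φ θ q.1 q.2.1 - linReward φ θ q.1 q.2.2 = θ.ofLp ⬝ᵥ diffFeature φ q := by
  rw [linReward, linReward, ← inner_sub_right, EuclideanSpace.inner_eq_star_dotProduct,
    star_trivial, dotProduct_comm]
  rfl

/-- The probability of the label `true` under the parameter `θ`. -/
noncomputable def prefProb {X A : Type*} {d : ℕ} (φ : X → A → EuclideanSpace ℝ (Fin d))
    (θ : EuclideanSpace ℝ (Fin d)) (q : X × A × A) : ℝ :=
  Real.sigmoid (θ.ofLp ⬝ᵥ diffFeature φ q)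

theorem btProb_linReward {X A : Type*} {d : ℕ} (φ : X → A → EuclideanSpace ℝ (Fin d))
    (θ : EuclideanSpace ℝ (Fin d)) (q : X × A × A) (y : Bool) :
    btProb (linReward φ θ) q y = labelWeight (prefProb φ θ q) y := by
  unfold btProb labelWeight prefProb
  rw [← linReward_sub_linReward]
  cases y
  · simp [← Real.sigmoid_neg]
  · simp

/-- The log-likelihood is linear in the label minus a softplus, so comparing two parameters leaves a
Bregman divergence plus a term linear in the centred label. -/
theorem log_labelWeight_sigmoid (s : ℝ) (y : Bool) :
    Real.log (labelWeight (Real.sigmoid s) y) =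
      (if y then 1 else 0) * s - Real.log (1 + Real.exp s) := by
  cases y
  · simp [labelWeight, ← Real.sigmoid_neg, log_sigmoid_neg]
  · simp [labelWeight, log_sigmoid]

theorem dotProduct_diffFeature_abs_le {X A : Type*} {d : ℕ}
    {φ : X → A → EuclideanSpace ℝ (Fin d)} (hφ : ∀ x a, ‖φ x a‖ ≤ 1)
    {B : ℝ} {θ : EuclideanSpace ℝ (Fin d)} (hθ : ‖θ‖ ≤ B) (q : X × A × A) :
    |θ.ofLp ⬝ᵥ diffFeature φ q| ≤ 2 * B := by
  have h : θ.ofLp ⬝ᵥ diffFeature φ q = inner ℝ θ (φ q.1 q.2.1 - φ q.1 q.2.2) := by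
    rw [EuclideanSpace.inner_eq_star_dotProduct, star_trivial, dotProduct_comm]; rfl
  rw [h]
  refine (abs_real_inner_le_norm _ _).trans ?_
  have h2 : ‖φ q.1 q.2.1 - φ q.1 q.2.2‖ ≤ 2 :=
    (norm_sub_le _ _).trans (by linarith [hφ q.1 q.2.1, hφ q.1 q.2.2])
  have : ‖θ‖ * ‖φ q.1 q.2.1 - φ q.1 q.2.2‖ ≤ B * 2 :=
    mul_le_mul hθ h2 (norm_nonneg _) ((norm_nonneg _).trans hθ)
  linarith

/-- The basic inequality of maximum likelihood estimation: the empirical squared error is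
dominated by a linear function of the noise. -/
theorem IsMLE.sum_sq_le {X A ι : Type*} [Fintype ι] {d : ℕ}
    {φ : X → A → EuclideanSpace ℝ (Fin d)} (hφ : ∀ x a, ‖φ x a‖ ≤ 1) {B : ℝ}
    {D : ι → Comparison X A} {θ θstar : EuclideanSpace ℝ (Fin d)}
    (h : IsMLE φ B D θ) (hstar : ‖θstar‖ ≤ B)
    (hr : ∀ x a, linReward φ θstar x a ∈ Set.Icc (0 : ℝ) 1) :
    1 / (2 + Real.exp (-B) + Real.exp B) / 8 *
        ∑ i, ((θ - θstar).ofLp ⬝ᵥ diffFeature φ (D i).query) ^ 2 ≤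
      (θ - θstar).ofLp ⬝ᵥ
        ∑ i, labelNoise (prefProb φ θstar (D i).query) (D i).label • diffFeature φ (D i).query := by
  have h1 := h.2 θstar hstar
  unfold logLik at h1
  rw [← sub_nonneg, ← Finset.sum_sub_distrib] at h1
  rw [dotProduct_sum, Finset.mul_sum, ← sub_nonneg, ← Finset.sum_sub_distrib]
  refine h1.trans (Finset.sum_le_sum fun i _ => ?_)
  rw [btProb_linReward, btProb_linReward]
  set q := (D i).query
  -- The true reward lies in `[0, 1]`, hence its gaps lie in `[-1, 1]`; this is why the base point
  -- of the Bregman bound is `θstar`.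
  have ht1 : |θstar.ofLp ⬝ᵥ diffFeature φ q| ≤ 1 := by
    rw [← linReward_sub_linReward, abs_le]
    have h2 := hr q.1 q.2.1
    have h3 := hr q.1 q.2.2
    exact ⟨by linarith [h2.1, h3.2], by linarith [h2.2, h3.1]⟩
  have hb := softplus_bregman_lower (dotProduct_diffFeature_abs_le hφ h.1 q)
    (dotProduct_diffFeature_abs_le hφ hstar q) ht1
  unfold prefProb
  rw [log_labelWeight_sigmoid, log_labelWeight_sigmoid, dotProduct_smul, WithLp.ofLp_sub,
    sub_dotProduct, smul_eq_mul, labelNoise]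
  linarith

/-- A quadratic inequality `N² ≤ a + b N` bounds `N²`. -/
theorem sq_le_of_sq_le_add_mul {N a b : ℝ} (h : N ^ 2 ≤ a + b * N) : N ^ 2 ≤ 2 * a + b ^ 2 := by
  nlinarith [sq_nonneg (N - b)]

/-- Deterministic error bound of the maximum likelihood estimator in the norm of the covariance
matrix, in terms of the self-normalized noise. -/
theorem IsMLE.sq_error_le {X A ι : Type*} [Fintype ι] {d : ℕ}
    {φ : X → A → EuclideanSpace ℝ (Fin d)} (hφ : ∀ x a, ‖φ x a‖ ≤ 1) {B γ lam Z : ℝ}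
    (hγ : γ = 1 / (2 + Real.exp (-B) + Real.exp B)) (hlam : 0 ≤ lam)
    {D : ι → Comparison X A} {θ θstar : EuclideanSpace ℝ (Fin d)}
    (h : IsMLE φ B D θ) (hstar : ‖θstar‖ ≤ B)
    (hr : ∀ x a, linReward φ θstar x a ∈ Set.Icc (0 : ℝ) 1)
    {V : Matrix (Fin d) (Fin d) ℝ} (hV : V.PosDef)
    (hVle : ∀ u : Fin d → ℝ, u ⬝ᵥ V *ᵥ u ≤
      2 * (lam * (u ⬝ᵥ u) + ∑ i, (u ⬝ᵥ diffFeature φ (D i).query) ^ 2))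
    (hZ : (∑ i, labelNoise (prefProb φ θstar (D i).query) (D i).label •
        diffFeature φ (D i).query) ⬝ᵥ V⁻¹ *ᵥ
      (∑ i, labelNoise (prefProb φ θstar (D i).query) (D i).label •
        diffFeature φ (D i).query) ≤ Z) :
    lam * ((θ - θstar).ofLp ⬝ᵥ (θ - θstar).ofLp) +
        ∑ i, ((θ - θstar).ofLp ⬝ᵥ diffFeature φ (D i).query) ^ 2 ≤
      8 * lam * B ^ 2 + 128 * Z / γ ^ 2 := by
  have hγ0 : 0 < γ := by rw [hγ]; positivity
  have hb := h.sum_sq_le hφ hstar hr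
  rw [← hγ] at hb
  set S := ∑ i, labelNoise (prefProb φ θstar (D i).query) (D i).label • diffFeature φ (D i).query
  set u := (θ - θstar).ofLp with hu
  set W := ∑ i, (u ⬝ᵥ diffFeature φ (D i).query) ^ 2 with hW
  have hW0 : 0 ≤ W := Finset.sum_nonneg fun i _ => sq_nonneg _
  have huu : u ⬝ᵥ u ≤ 4 * B ^ 2 := by
    have h1 : u ⬝ᵥ u = ‖θ - θstar‖ ^ 2 := by
      rw [← real_inner_self_eq_norm_sq, EuclideanSpace.inner_eq_star_dotProduct, star_trivial]
    have h2 : ‖θ - θstar‖ ≤ 2 * B := (norm_sub_le _ _).trans (by linarith [h.1])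
    rw [h1]
    nlinarith [norm_nonneg (θ - θstar)]
  have huu0 : 0 ≤ u ⬝ᵥ u := by
    simpa using dotProduct_star_self_nonneg u
  have hZ0 : 0 ≤ Z := le_trans (by simpa using hV.inv.posSemidef.dotProduct_mulVec_nonneg S) hZ
  set N := Real.sqrt (lam * (u ⬝ᵥ u) + W) with hN
  have hN2 : N ^ 2 = lam * (u ⬝ᵥ u) + W := Real.sq_sqrt (by positivity)
  have hcs : u ⬝ᵥ S ≤ N * Real.sqrt (2 * Z) := by
    apply le_trans (le_abs_self _)
    rw [← abs_of_nonneg (mul_nonneg (Real.sqrt_nonneg _) (Real.sqrt_nonneg _)), ← sq_le_sq,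
      mul_pow, hN2, Real.sq_sqrt (by positivity)]
    refine (hV.sq_dotProduct_le u S).trans ?_
    have h1 := hVle u
    have h0 : 0 ≤ u ⬝ᵥ V *ᵥ u := by simpa using hV.posSemidef.dotProduct_mulVec_nonneg u
    have h2 : 0 ≤ lam * (u ⬝ᵥ u) + W := by positivity
    calc _ ≤ (u ⬝ᵥ V *ᵥ u) * Z := mul_le_mul_of_nonneg_left hZ h0
      _ ≤ (2 * (lam * (u ⬝ᵥ u) + W)) * Z := mul_le_mul_of_nonneg_right h1 hZ0
      _ = _ := by ring
  -- The regularization part is bounded through the radius `B`, the data part through the noise.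
  -- Solving for `N` gives `2 · 4 λ B² + (8 / γ)² · 2 Z`.
  have hquad : N ^ 2 ≤ 4 * lam * B ^ 2 + (8 / γ * Real.sqrt (2 * Z)) * N := by
    rw [hN2]
    have h1 : W ≤ 8 / γ * (N * Real.sqrt (2 * Z)) := by
      rw [div_mul_eq_mul_div, le_div_iff₀ hγ0]
      linarith
    have h2 : lam * (u ⬝ᵥ u) ≤ lam * (4 * B ^ 2) := mul_le_mul_of_nonneg_left huu hlam
    linarith
  have hfin := sq_le_of_sq_le_add_mul hquad
  rw [hN2, mul_pow, Real.sq_sqrt (by positivity)] at hfin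
  refine hfin.trans (le_of_eq ?_)
  field_simp; ring

end RLHF

/-! ### Gibbs policies, their divergences and the regret decomposition. -/

namespace RLHF

theorem abs_linReward_le {X A : Type*} {d : ℕ} {φ : X → A → EuclideanSpace ℝ (Fin d)}
    (hφ : ∀ x a, ‖φ x a‖ ≤ 1) (θ : EuclideanSpace ℝ (Fin d)) (x : X) (a : A) : |linReward φ θ x a| ≤ ‖θ‖ :=
  (abs_real_inner_le_norm _ _).trans (mul_le_of_le_one_right (norm_nonneg _) (hφ x a))

section Gibbs

variable {X A : Type*} [MeasurableSpace X] [MeasurableSpace A] {d : ℕ}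

theorem measurable_linReward {φ : X → A → EuclideanSpace ℝ (Fin d)}
    (hφm : Measurable (Function.uncurry φ)) (θ : EuclideanSpace ℝ (Fin d)) :
    Measurable (Function.uncurry (linReward φ θ)) :=
  (measurable_const.inner hφm : Measurable fun p => inner ℝ θ (Function.uncurry φ p))

theorem integrable_linReward {φ : X → A → EuclideanSpace ℝ (Fin d)}
    (hφm : Measurable (Function.uncurry φ)) (hφ : ∀ x a, ‖φ x a‖ ≤ 1)
    (θ : EuclideanSpace ℝ (Fin d)) (x : X) (μ : Measure A) [IsFiniteMeasure μ] :
    Integrable (linReward φ θ x) μ :=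
  Integrable.of_bound ((measurable_linReward hφm θ).comp measurable_prodMk_left).aestronglyMeasurable
    ‖θ‖ (ae_of_all _ fun a => abs_linReward_le hφ θ x a)

theorem integrable_feature_map {φ : X → A → EuclideanSpace ℝ (Fin d)}
    (hφm : Measurable (Function.uncurry φ)) (hφ : ∀ x a, ‖φ x a‖ ≤ 1)
    (x : X) (μ : Measure A) [IsFiniteMeasure μ] : Integrable (φ x) μ :=
  Integrable.of_bound (hφm.comp measurable_prodMk_left).aestronglyMeasurable 1
    (ae_of_all _ fun a => hφ x a)

theorem integral_linReward {φ : X → A → EuclideanSpace ℝ (Fin d)}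
    (hφm : Measurable (Function.uncurry φ)) (hφ : ∀ x a, ‖φ x a‖ ≤ 1)
    (θ : EuclideanSpace ℝ (Fin d)) (π : Kernel X A) [IsMarkovKernel π] (x : X) :
    ∫ a, linReward φ θ x a ∂(π x) = inner ℝ θ (feature φ π x) :=
  integral_inner (integrable_feature_map hφm hφ x (π x)) θ

theorem integrable_exp_linReward {φ : X → A → EuclideanSpace ℝ (Fin d)}
    (hφm : Measurable (Function.uncurry φ)) (hφ : ∀ x a, ‖φ x a‖ ≤ 1) {η : ℝ} (hη : 0 < η)
    (θ : EuclideanSpace ℝ (Fin d)) (x : X) (μ : Measure A) [IsFiniteMeasure μ] :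
    Integrable (fun a => Real.exp (linReward φ θ x a / η)) μ := by
  refine Integrable.of_bound (C := Real.exp (‖θ‖ / η)) ?_ (ae_of_all _ fun a => ?_)
  · exact (Real.measurable_exp.comp (((measurable_linReward hφm θ).comp
      measurable_prodMk_left).div_const η)).aestronglyMeasurable
  · rw [Real.norm_eq_abs, Real.abs_exp]
    gcongr
    exact (le_abs_self _).trans (abs_linReward_le hφ θ x a)

theorem value_congr {d₀ : Measure X} {η : ℝ} {r : X → A → ℝ} {κ π π' : Kernel X A}
    (h : ∀ᵐ x ∂d₀, π x = π' x) : value d₀ κ η r π = value d₀ κ η r π' :=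
  integral_congr_ae (h.mono fun x hx => by simp only [hx])

variable (π₀ : Kernel X A) [IsMarkovKernel π₀]

theorem isMarkovKernel_gibbsPolicy {φ : X → A → EuclideanSpace ℝ (Fin d)}
    (hφm : Measurable (Function.uncurry φ)) (hφ : ∀ x a, ‖φ x a‖ ≤ 1) {η : ℝ} (hη : 0 < η)
    (θ : EuclideanSpace ℝ (Fin d)) : IsMarkovKernel (gibbsPolicy π₀ η (linReward φ θ)) :=
  ⟨fun x => by
    rw [gibbsPolicy_apply π₀ η (measurable_linReward hφm θ)]
    exact isProbabilityMeasure_tilted (integrable_exp_linReward hφm hφ hη θ x _)⟩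

/-- The log-partition function of the Gibbs policy. -/
noncomputable def logPartition (η : ℝ) (φ : X → A → EuclideanSpace ℝ (Fin d))
    (θ : EuclideanSpace ℝ (Fin d)) (x : X) : ℝ :=
  Real.log (∫ a, Real.exp (linReward φ θ x a / η) ∂(π₀ x))

theorem measurable_logPartition {φ : X → A → EuclideanSpace ℝ (Fin d)}
    (hφm : Measurable (Function.uncurry φ)) (η : ℝ) (θ : EuclideanSpace ℝ (Fin d)) :
    Measurable (logPartition π₀ η φ θ) := by
  have h1 : Measurable (Function.uncurry fun (x : X) (a : A) =>
      Real.exp (linReward φ θ x a / η)) :=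
    Real.measurable_exp.comp ((measurable_linReward hφm θ).div_const η)
  exact (h1.stronglyMeasurable.integral_kernel_prod_right (κ := π₀)).measurable.log

theorem abs_logPartition_le {φ : X → A → EuclideanSpace ℝ (Fin d)}
    (hφm : Measurable (Function.uncurry φ)) (hφ : ∀ x a, ‖φ x a‖ ≤ 1) {η : ℝ} (hη : 0 < η)
    (θ : EuclideanSpace ℝ (Fin d)) (x : X) : |logPartition π₀ η φ θ x| ≤ ‖θ‖ / η := by
  have hint := integrable_exp_linReward hφm hφ hη θ x (π₀ x)
  have hb : ∀ a, -(‖θ‖ / η) ≤ linReward φ θ x a / η ∧ linReward φ θ x a / η ≤ ‖θ‖ / η := by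
    intro a
    have := abs_le.1 (abs_linReward_le hφ θ x a)
    rw [← neg_div]
    exact ⟨by gcongr; exact this.1, by gcongr; exact this.2⟩
  have h1 : Real.exp (-(‖θ‖ / η)) ≤ ∫ a, Real.exp (linReward φ θ x a / η) ∂(π₀ x) := by
    calc Real.exp (-(‖θ‖ / η)) = ∫ _, Real.exp (-(‖θ‖ / η)) ∂(π₀ x) := by simp
      _ ≤ _ := integral_mono (integrable_const _) hint fun a => Real.exp_le_exp.2 (hb a).1
  have h2 : ∫ a, Real.exp (linReward φ θ x a / η) ∂(π₀ x) ≤ Real.exp (‖θ‖ / η) := by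
    calc _ ≤ ∫ _, Real.exp (‖θ‖ / η) ∂(π₀ x) :=
          integral_mono hint (integrable_const _) fun a => Real.exp_le_exp.2 (hb a).2
      _ = _ := by simp
  have hpos := (Real.exp_pos _).trans_le h1
  rw [abs_le, logPartition]
  exact ⟨(Real.le_log_iff_exp_le hpos).2 h1, (Real.log_le_iff_le_exp hpos).2 h2⟩

theorem measurable_feature {φ : X → A → EuclideanSpace ℝ (Fin d)}
    (hφm : Measurable (Function.uncurry φ)) (π : Kernel X A) [IsMarkovKernel π] :
    Measurable (feature φ π) :=
  (hφm.stronglyMeasurable.integral_kernel_prod_right (κ := π)).measurable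

theorem norm_feature_le {φ : X → A → EuclideanSpace ℝ (Fin d)} (hφ : ∀ x a, ‖φ x a‖ ≤ 1)
    (π : Kernel X A) [IsMarkovKernel π] (x : X) : ‖feature φ π x‖ ≤ 1 := by
  refine (norm_integral_le_of_norm_le_const (ae_of_all _ fun a => hφ x a)).trans ?_
  simp

theorem integrable_feature {φ : X → A → EuclideanSpace ℝ (Fin d)}
    (hφm : Measurable (Function.uncurry φ)) (hφ : ∀ x a, ‖φ x a‖ ≤ 1)
    (π : Kernel X A) [IsMarkovKernel π] (d₀ : Measure X) [IsFiniteMeasure d₀] :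
    Integrable (feature φ π) d₀ :=
  Integrable.of_bound (measurable_feature hφm π).aestronglyMeasurable 1
    (ae_of_all _ fun x => norm_feature_le hφ π x)

theorem integrable_logPartition {φ : X → A → EuclideanSpace ℝ (Fin d)}
    (hφm : Measurable (Function.uncurry φ)) (hφ : ∀ x a, ‖φ x a‖ ≤ 1) {η : ℝ} (hη : 0 < η)
    (θ : EuclideanSpace ℝ (Fin d)) (d₀ : Measure X) [IsFiniteMeasure d₀] :
    Integrable (logPartition π₀ η φ θ) d₀ :=
  Integrable.of_bound (measurable_logPartition π₀ hφm η θ).aestronglyMeasurable (‖θ‖ / η)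
    (ae_of_all _ fun x => abs_logPartition_le π₀ hφm hφ hη θ x)

/-- The log-density of one tilting against the other is `f - g` plus a constant. Finiteness is
recorded because `klReal` sends `⊤` to `0`: without it a vanishing `klReal` would not force equality
of the measures. -/
theorem klDiv_tilted_tilted {α : Type*} [MeasurableSpace α] (μ : Measure α)
    [IsProbabilityMeasure μ] {f g : α → ℝ}
    (hf : AEMeasurable f μ)
    (hfe : Integrable (fun a => Real.exp (f a)) μ) (hge : Integrable (fun a => Real.exp (g a)) μ)
    (hfi : Integrable f (μ.tilted f)) (hgi : Integrable g (μ.tilted f)) :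
    InformationTheory.klDiv (μ.tilted f) (μ.tilted g) ≠ ⊤ ∧
    klReal (μ.tilted f) (μ.tilted g) =
      ∫ a, f a ∂(μ.tilted f) - ∫ a, g a ∂(μ.tilted f) - Real.log (∫ a, Real.exp (f a) ∂μ)
        + Real.log (∫ a, Real.exp (g a) ∂μ) := by
  have hpf := isProbabilityMeasure_tilted hfe
  have hpg := isProbabilityMeasure_tilted hge
  have hac : μ.tilted f ≪ μ := tilted_absolutelyContinuous μ f
  have hac' : μ.tilted f ≪ μ.tilted g := hac.trans (absolutelyContinuous_tilted hge)
  have hllr : llr (μ.tilted f) μ =ᵐ[μ.tilted f] fun a => f a - Real.log (∫ z, Real.exp (f z) ∂μ) := by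
    refine hac.ae_le ?_
    filter_upwards [llr_tilted_left (Measure.AbsolutelyContinuous.refl μ) hfe hf, llr_self μ]
      with a h1 h2
    rw [h1, h2]; simp
  have hllri : Integrable (llr (μ.tilted f) μ) (μ.tilted f) :=
    (integrable_congr hllr).2 (hfi.sub (integrable_const _))
  have hi := integrable_llr_tilted_right hac hgi hllri hge
  refine ⟨InformationTheory.klDiv_ne_top hac' hi, ?_⟩
  rw [klReal, InformationTheory.toReal_klDiv_of_measure_eq hac' (by simp),
    integral_llr_tilted_right hac hgi hge hllri, integral_congr_ae hllr,
    integral_sub hfi (integrable_const _)]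
  simp
  ring

theorem klDiv_gibbsPolicy {φ : X → A → EuclideanSpace ℝ (Fin d)}
    (hφm : Measurable (Function.uncurry φ)) (hφ : ∀ x a, ‖φ x a‖ ≤ 1) {η : ℝ} (hη : 0 < η)
    (θ θ' : EuclideanSpace ℝ (Fin d)) (x : X) :
    InformationTheory.klDiv (gibbsPolicy π₀ η (linReward φ θ) x)
      (gibbsPolicy π₀ η (linReward φ θ') x) ≠ ⊤ ∧
    klReal (gibbsPolicy π₀ η (linReward φ θ) x) (gibbsPolicy π₀ η (linReward φ θ') x) =
      inner ℝ (θ - θ') (feature φ (gibbsPolicy π₀ η (linReward φ θ)) x) / η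
        - logPartition π₀ η φ θ x + logPartition π₀ η φ θ' x := by
  have := isMarkovKernel_gibbsPolicy π₀ hφm hφ hη θ
  have hG := gibbsPolicy_apply π₀ η (measurable_linReward hφm θ) x
  have hG' := gibbsPolicy_apply π₀ η (measurable_linReward hφm θ') x
  have hp : IsProbabilityMeasure ((π₀ x).tilted fun a => linReward φ θ x a / η) :=
    hG ▸ this.isProbabilityMeasure x
  have h := klDiv_tilted_tilted (π₀ x) (f := fun a => linReward φ θ x a / η)
    (g := fun a => linReward φ θ' x a / η)
    ((integrable_linReward hφm hφ θ x _).div_const η).aemeasurable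
    (integrable_exp_linReward hφm hφ hη θ x _) (integrable_exp_linReward hφm hφ hη θ' x _)
    ((integrable_linReward hφm hφ θ x _).div_const η)
    ((integrable_linReward hφm hφ θ' x _).div_const η)
  rw [← hG, ← hG'] at h
  refine ⟨h.1, h.2.trans ?_⟩
  rw [integral_div, integral_div, integral_linReward hφm hφ, integral_linReward hφm hφ,
    inner_sub_left, logPartition, logPartition]
  ring

/-- The initial policy is itself the Gibbs policy with parameter zero, so the penalty in the value
is an instance of the divergence formula. -/
theorem gibbsPolicy_zero {φ : X → A → EuclideanSpace ℝ (Fin d)}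
    (hφm : Measurable (Function.uncurry φ)) (η : ℝ) (x : X) :
    gibbsPolicy π₀ η (linReward φ 0) x = π₀ x := by
  rw [gibbsPolicy_apply π₀ η (measurable_linReward hφm 0)]
  simp [linReward]

theorem klReal_nonneg (μ ν : Measure A) : 0 ≤ klReal μ ν := ENNReal.toReal_nonneg

theorem integrable_klReal_gibbsPolicy {φ : X → A → EuclideanSpace ℝ (Fin d)}
    (hφm : Measurable (Function.uncurry φ)) (hφ : ∀ x a, ‖φ x a‖ ≤ 1) {η : ℝ} (hη : 0 < η)
    (θ θ' : EuclideanSpace ℝ (Fin d)) (d₀ : Measure X) [IsFiniteMeasure d₀] :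
    Integrable (fun x => klReal (gibbsPolicy π₀ η (linReward φ θ) x)
      (gibbsPolicy π₀ η (linReward φ θ') x)) d₀ := by
  have := isMarkovKernel_gibbsPolicy π₀ hφm hφ hη θ
  simp_rw [fun x => (klDiv_gibbsPolicy π₀ hφm hφ hη θ θ' x).2]
  exact ((((integrable_feature hφm hφ _ d₀).const_inner (θ - θ')).div_const η).sub
    (integrable_logPartition π₀ hφm hφ hη θ d₀)).add (integrable_logPartition π₀ hφm hφ hη θ' d₀)

/-- The KL-regularized value of a Gibbs policy, in terms of its divergence to the optimum. -/
theorem value_gibbsPolicy {φ : X → A → EuclideanSpace ℝ (Fin d)}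
    (hφm : Measurable (Function.uncurry φ)) (hφ : ∀ x a, ‖φ x a‖ ≤ 1) {η : ℝ} (hη : 0 < η)
    (θ θ' : EuclideanSpace ℝ (Fin d)) (d₀ : Measure X) [IsFiniteMeasure d₀] :
    value d₀ π₀ η (linReward φ θ') (gibbsPolicy π₀ η (linReward φ θ)) =
      η * ∫ x, logPartition π₀ η φ θ' x ∂d₀ -
        η * ∫ x, klReal (gibbsPolicy π₀ η (linReward φ θ) x)
          (gibbsPolicy π₀ η (linReward φ θ') x) ∂d₀ := by
  have := isMarkovKernel_gibbsPolicy π₀ hφm hφ hη θ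
  rw [← integral_const_mul, ← integral_const_mul, ← integral_sub
    ((integrable_logPartition π₀ hφm hφ hη θ' d₀).const_mul η)
    ((integrable_klReal_gibbsPolicy π₀ hφm hφ hη θ θ' d₀).const_mul η), value]
  refine integral_congr_ae (ae_of_all _ fun x => ?_)
  have h0 := (klDiv_gibbsPolicy π₀ hφm hφ hη θ 0 x).2
  rw [gibbsPolicy_zero π₀ hφm] at h0
  simp only [h0, (klDiv_gibbsPolicy π₀ hφm hφ hη θ θ' x).2, integral_linReward hφm hφ]
  have hz : logPartition π₀ η φ 0 x = 0 := by simp [logPartition, linReward]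
  rw [hz, sub_zero, inner_sub_left]
  field_simp
  ring

variable {π₀}

theorem IsOptimal.isMarkovKernel {φ : X → A → EuclideanSpace ℝ (Fin d)}
    (hφm : Measurable (Function.uncurry φ)) (hφ : ∀ x a, ‖φ x a‖ ≤ 1) {η B : ℝ} (hη : 0 < η)
    {d₀ : Measure X} {r : X → A → ℝ} {π : Kernel X A}
    (h : IsOptimal d₀ π₀ η B φ r π) : IsMarkovKernel π := by
  obtain ⟨⟨θ, -, rfl⟩, -⟩ := h
  exact isMarkovKernel_gibbsPolicy π₀ hφm hφ hη θ

/-- An optimal policy for a linear reward of the class is almost everywhere its Gibbs policy. -/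
theorem IsOptimal.ae_eq_gibbsPolicy {φ : X → A → EuclideanSpace ℝ (Fin d)}
    (hφm : Measurable (Function.uncurry φ)) (hφ : ∀ x a, ‖φ x a‖ ≤ 1) {η B : ℝ} (hη : 0 < η)
    {d₀ : Measure X} [IsFiniteMeasure d₀] {θ : EuclideanSpace ℝ (Fin d)} (hθ : ‖θ‖ ≤ B)
    {π : Kernel X A} (h : IsOptimal d₀ π₀ η B φ (linReward φ θ) π) :
    ∀ᵐ x ∂d₀, π x = gibbsPolicy π₀ η (linReward φ θ) x := by
  obtain ⟨⟨θ', -, rfl⟩, hmax⟩ := h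
  have hle := hmax _ ⟨θ, hθ, rfl⟩
  rw [value_gibbsPolicy π₀ hφm hφ hη, value_gibbsPolicy π₀ hφm hφ hη] at hle
  have hself : ∀ x, klReal (gibbsPolicy π₀ η (linReward φ θ) x)
      (gibbsPolicy π₀ η (linReward φ θ) x) = 0 := fun x => by
    rw [(klDiv_gibbsPolicy π₀ hφm hφ hη θ θ x).2]; simp
  simp only [hself, integral_zero, mul_zero, sub_zero] at hle
  have hnn : 0 ≤ ∫ x, klReal (gibbsPolicy π₀ η (linReward φ θ') x)
      (gibbsPolicy π₀ η (linReward φ θ) x) ∂d₀ := integral_nonneg fun x => klReal_nonneg _ _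
  -- The Gibbs policy of `θ` belongs to the class and has divergence zero, so a maximizer cannot
  -- have positive expected divergence.
  have hzero : ∫ x, klReal (gibbsPolicy π₀ η (linReward φ θ') x)
      (gibbsPolicy π₀ η (linReward φ θ) x) ∂d₀ = 0 := by
    refine le_antisymm ?_ hnn
    by_contra hcon
    push Not at hcon
    have := mul_pos hη hcon
    linarith
  rw [integral_eq_zero_iff_of_nonneg (fun x => klReal_nonneg _ _)
    (integrable_klReal_gibbsPolicy π₀ hφm hφ hη θ' θ d₀)] at hzero
  filter_upwards [hzero] with x hx
  have := isMarkovKernel_gibbsPolicy π₀ hφm hφ hη θ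
  have := isMarkovKernel_gibbsPolicy π₀ hφm hφ hη θ'
  have hk := (ENNReal.toReal_eq_zero_iff _).1 hx
  exact InformationTheory.klDiv_eq_zero_iff.1
    (hk.resolve_right (klDiv_gibbsPolicy π₀ hφm hφ hη θ' θ x).1)

/-- The regret of an optimal policy for an estimated reward, together with its divergence to the
optimal policy, is at most twice the estimation error along the difference of features. -/
theorem regret_add_kl_le {φ : X → A → EuclideanSpace ℝ (Fin d)}
    (hφm : Measurable (Function.uncurry φ)) (hφ : ∀ x a, ‖φ x a‖ ≤ 1) {η B : ℝ} (hη : 0 < η)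
    {d₀ : Measure X} [IsFiniteMeasure d₀] {θ θstar : EuclideanSpace ℝ (Fin d)} (hθ : ‖θ‖ ≤ B)
    (hstar : ‖θstar‖ ≤ B) {π πstar : Kernel X A}
    (h : IsOptimal d₀ π₀ η B φ (linReward φ θ) π)
    (hs : IsOptimal d₀ π₀ η B φ (linReward φ θstar) πstar) :
    value d₀ π₀ η (linReward φ θstar) πstar - value d₀ π₀ η (linReward φ θstar) π +
        η * ∫ x, klReal (π x) (πstar x) ∂d₀ ≤
      2 * inner ℝ (θ - θstar) (∫ x, (feature φ π x - feature φ πstar x) ∂d₀) := by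
  have h1 := h.ae_eq_gibbsPolicy hφm hφ hη hθ
  have h2 := hs.ae_eq_gibbsPolicy hφm hφ hη hstar
  have := isMarkovKernel_gibbsPolicy π₀ hφm hφ hη θ
  have := isMarkovKernel_gibbsPolicy π₀ hφm hφ hη θstar
  have hkl : ∫ x, klReal (π x) (πstar x) ∂d₀ =
      ∫ x, klReal (gibbsPolicy π₀ η (linReward φ θ) x)
        (gibbsPolicy π₀ η (linReward φ θstar) x) ∂d₀ :=
    integral_congr_ae (by filter_upwards [h1, h2] with x hx hx'; rw [hx, hx'])
  have hfeat : ∫ x, (feature φ π x - feature φ πstar x) ∂d₀ =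
      ∫ x, (feature φ (gibbsPolicy π₀ η (linReward φ θ)) x -
        feature φ (gibbsPolicy π₀ η (linReward φ θstar)) x) ∂d₀ :=
    integral_congr_ae (by filter_upwards [h1, h2] with x hx hx'; simp only [feature, hx, hx'])
  rw [value_congr h1, value_congr h2, hkl, hfeat, value_gibbsPolicy π₀ hφm hφ hη,
    value_gibbsPolicy π₀ hφm hφ hη]
  have hself : ∀ x, klReal (gibbsPolicy π₀ η (linReward φ θstar) x)
      (gibbsPolicy π₀ η (linReward φ θstar) x) = 0 := fun x => by
    rw [(klDiv_gibbsPolicy π₀ hφm hφ hη θstar θstar x).2]; simp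
  simp only [hself, integral_zero, mul_zero, sub_zero]
  have hi1 := integrable_feature hφm hφ (gibbsPolicy π₀ η (linReward φ θ)) d₀
  have hi2 := integrable_feature hφm hφ (gibbsPolicy π₀ η (linReward φ θstar)) d₀
  have hpt : η * ∫ x, klReal (gibbsPolicy π₀ η (linReward φ θ) x)
        (gibbsPolicy π₀ η (linReward φ θstar) x) ∂d₀ ≤
      inner ℝ (θ - θstar) (∫ x, (feature φ (gibbsPolicy π₀ η (linReward φ θ)) x -
        feature φ (gibbsPolicy π₀ η (linReward φ θstar)) x) ∂d₀) := by
    rw [← integral_inner (f := fun x => feature φ (gibbsPolicy π₀ η (linReward φ θ)) x -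
      feature φ (gibbsPolicy π₀ η (linReward φ θstar)) x) (hi1.sub hi2), ← integral_const_mul]
    refine integral_mono ((integrable_klReal_gibbsPolicy π₀ hφm hφ hη θ θstar d₀).const_mul η)
      ((hi1.sub hi2).const_inner _) fun x => ?_
    -- The two divergences have opposite log-partition terms; their sum is the inner product with
    -- the feature gap, and the reverse one is nonnegative.
    have hk := klReal_nonneg (gibbsPolicy π₀ η (linReward φ θstar) x)
      (gibbsPolicy π₀ η (linReward φ θ) x)
    simp only [(klDiv_gibbsPolicy π₀ hφm hφ hη θ θstar x).2]
    rw [(klDiv_gibbsPolicy π₀ hφm hφ hη θstar θ x).2] at hk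
    have hk' := mul_nonneg hη.le hk
    simp only [inner_sub_right, inner_sub_left] at hk' ⊢
    field_simp at hk' ⊢
    linarith
  linarith

end Gibbs

end RLHF

/-! ### Conditional laws and exponential supermartingales. -/

namespace RLHF

open Matrix Filter
open scoped ENNReal Topology

section Conditional

variable {Ω : Type*} {m mΩ : MeasurableSpace Ω} {P : Measure Ω}

/-- Integrating a nonnegative function against an `m`-measurable weight only depends on its
conditional expectation given `m`. -/
theorem lintegral_ofReal_mul_eq_condExp [IsFiniteMeasure P] (hm : m ≤ mΩ) {Y : Ω → ℝ}
    (hY : Integrable Y P) (hY0 : 0 ≤ᵐ[P] Y) {g : Ω → ℝ≥0∞} (hg : Measurable[m] g) :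
    ∫⁻ ω, ENNReal.ofReal (Y ω) * g ω ∂P = ∫⁻ ω, ENNReal.ofReal ((P[Y|m]) ω) * g ω ∂P := by
  have hC0 : 0 ≤ᵐ[P] P[Y|m] := condExp_nonneg hY0
  have key : (P.withDensity fun ω => ENNReal.ofReal (Y ω)).trim hm =
      (P.withDensity fun ω => ENNReal.ofReal ((P[Y|m]) ω)).trim hm := by
    refine @Measure.ext _ m _ _ fun s hs => ?_
    rw [trim_measurableSet_eq hm hs, trim_measurableSet_eq hm hs, withDensity_apply _ (hm s hs),
      withDensity_apply _ (hm s hs), ← ofReal_integral_eq_lintegral_ofReal hY.integrableOn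
      (ae_restrict_of_ae hY0), ← ofReal_integral_eq_lintegral_ofReal
      integrable_condExp.integrableOn (ae_restrict_of_ae hC0), setIntegral_condExp hm hY hs]
  have h1 := lintegral_trim (μ := P.withDensity fun ω => ENNReal.ofReal (Y ω)) hm hg
  have h2 := lintegral_trim (μ := P.withDensity fun ω => ENNReal.ofReal ((P[Y|m]) ω)) hm hg
  rw [key, h2] at h1
  rw [lintegral_withDensity_eq_lintegral_mul₀ integrable_condExp.aemeasurable.ennreal_ofReal
    (hg.mono hm le_rfl).aemeasurable, lintegral_withDensity_eq_lintegral_mul₀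
    hY.aemeasurable.ennreal_ofReal (hg.mono hm le_rfl).aemeasurable] at h1
  exact h1.symm

/-- Integrating out a finite label whose conditional law given `m` is known. -/
theorem lintegral_label_eq [IsFiniteMeasure P] (hm : m ≤ mΩ) {β : Type*} [Fintype β]
    {lab : Ω → β} (hlab : ∀ b, MeasurableSet {ω | lab ω = b}) {w : β → Ω → ℝ}
    (hw : ∀ b, P⟦{ω | lab ω = b}|m⟧ =ᵐ[P] w b)
    {F : β → Ω → ℝ≥0∞} (hF : ∀ b, Measurable[m] (F b)) :
    ∫⁻ ω, F (lab ω) ω ∂P = ∫⁻ ω, ∑ b, ENNReal.ofReal (w b ω) * F b ω ∂P := by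
  classical
  have h1 : ∀ ω, F (lab ω) ω =
      ∑ b, ENNReal.ofReal (Set.indicator {ω | lab ω = b} (fun _ => (1 : ℝ)) ω) * F b ω := by
    intro ω
    rw [Finset.sum_eq_single (lab ω)]
    · simp
    · intro b _ hb
      simp [Set.indicator, hb.symm]
    · simp
  have hi : ∀ b, Integrable (Set.indicator {ω | lab ω = b} (fun _ => (1 : ℝ))) P := fun b =>
    (integrable_const 1).indicator (hlab b)
  simp_rw [h1]
  have hm1 : ∀ b, AEMeasurable (fun ω => ENNReal.ofReal
      (Set.indicator {ω | lab ω = b} (fun _ => (1 : ℝ)) ω) * F b ω) P := fun b =>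
    ((hi b).aemeasurable.ennreal_ofReal).mul ((hF b).mono hm le_rfl).aemeasurable
  have hm2 : ∀ b, AEMeasurable (fun ω => ENNReal.ofReal (w b ω) * F b ω) P := fun b =>
    (((integrable_condExp (m := m)).aemeasurable.congr (hw b)).ennreal_ofReal).mul
      ((hF b).mono hm le_rfl).aemeasurable
  rw [lintegral_finsetSum' _ fun b _ => hm1 b, lintegral_finsetSum' _ fun b _ => hm2 b]
  refine Finset.sum_congr rfl fun b _ => ?_
  rw [lintegral_ofReal_mul_eq_condExp hm (hi b)
    (ae_of_all _ fun ω => Set.indicator_nonneg (fun _ _ => zero_le_one) ω) (hF b)]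
  exact lintegral_congr_ae ((hw b).mono fun ω h => by simp only [h])

/-- If the conditional law of `q` given `m` is `ν`, conditional expectations of bounded functions
of `q` are integrals against `ν`. -/
theorem condExp_comp_ae_eq_integral [IsFiniteMeasure P] (hm : m ≤ mΩ) {Q : Type*}
    [MeasurableSpace Q] {q : Ω → Q} (hq : Measurable q) {ν : Ω → Measure Q}
    [∀ ω, IsProbabilityMeasure (ν ω)]
    (hν : ∀ S, MeasurableSet S → P⟦q ⁻¹' S|m⟧ =ᵐ[P] fun ω => (ν ω).real S)
    {f : Q → ℝ} (hf : Measurable f) {C : ℝ} (hC : ∀ x, |f x| ≤ C) :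
    P[fun ω => f (q ω)|m] =ᵐ[P] fun ω => ∫ x, f x ∂(ν ω) := by
  have hsimple : ∀ s : SimpleFunc Q ℝ, P[fun ω => s (q ω)|m] =ᵐ[P] fun ω => ∫ x, s x ∂(ν ω) := by
    intro s
    induction s using SimpleFunc.induction with
    | const c hs =>
      rename_i S
      have h1 : (fun ω => (SimpleFunc.piecewise S hs (SimpleFunc.const Q c)
          (SimpleFunc.const Q 0)) (q ω)) = c • (q ⁻¹' S).indicator fun _ => (1 : ℝ) := by
        ext ω
        by_cases h : q ω ∈ S <;> simp [h]
      rw [h1]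
      refine (condExp_smul c _ m).trans ?_
      filter_upwards [hν S hs] with ω h
      rw [Pi.smul_apply, h]
      simp only [SimpleFunc.coe_piecewise, SimpleFunc.coe_const, Function.const_zero,
        Set.piecewise_eq_indicator]
      rw [integral_indicator hs]
      simp [mul_comm]
    | add hd hf hg =>
      rename_i f g
      have hi : ∀ s : SimpleFunc Q ℝ, Integrable (fun ω => s (q ω)) P := fun s => by
        obtain ⟨C, hC⟩ := s.exists_forall_norm_le
        exact Integrable.of_bound (s.measurable.comp hq).aestronglyMeasurable C
          (ae_of_all _ fun ω => hC _)
      refine (condExp_add (hi f) (hi g) m).trans ?_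
      filter_upwards [hf, hg] with ω h1 h2
      rw [Pi.add_apply, h1, h2]
      simp only [SimpleFunc.coe_add, Pi.add_apply]
      rw [integral_add (SimpleFunc.integrable_of_isFiniteMeasure _)
        (SimpleFunc.integrable_of_isFiniteMeasure _)]
  -- The bound forces `0 ≤ C` only if `Q` has a point, which is obtained from `Ω`; the empty case is
  -- separate.
  have hC0 : ∀ ω : Ω, 0 ≤ C := fun ω => (abs_nonneg _).trans (hC (q ω))
  rcases isEmpty_or_nonempty Ω with hΩ | ⟨⟨ω₀⟩⟩
  · exact Filter.Eventually.of_forall fun ω => hΩ.elim ω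
  have hC0 := hC0 ω₀
  set s := hf.stronglyMeasurable.approxBounded C with hs
  have hsb : ∀ n x, ‖s n x‖ ≤ C := fun n x => hf.stronglyMeasurable.norm_approxBounded_le hC0 n x
  have hst : ∀ x, Tendsto (fun n => s n x) atTop (𝓝 (f x)) := fun x =>
    hf.stronglyMeasurable.tendsto_approxBounded_of_norm_le (hC x)
  have hlim : ∀ ω, Tendsto (fun n => ∫ x, s n x ∂(ν ω)) atTop (𝓝 (∫ x, f x ∂(ν ω))) := fun ω =>
    tendsto_integral_of_dominated_convergence (fun _ => C)
      (fun n => (s n).measurable.aestronglyMeasurable) (integrable_const _)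
      (fun n => ae_of_all _ (hsb n)) (ae_of_all _ hst)
  have hmeas : ∀ n, AEStronglyMeasurable[m] (fun ω => ∫ x, s n x ∂(ν ω)) P := fun n =>
    stronglyMeasurable_condExp.aestronglyMeasurable.congr (hsimple (s n))
  -- The family `ν` is not assumed measurable in `ω`. An `m`-measurable version of its integrals is
  -- the limsup of the conditional expectations along simple approximations.
  have hmeasl : AEStronglyMeasurable[m] (fun ω => ∫ x, f x ∂(ν ω)) P :=
    ⟨fun ω => limsup (fun n => (P[fun ω => s n (q ω)|m]) ω) atTop,
      (Measurable.limsup fun n =>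
        (stronglyMeasurable_condExp (f := fun ω => s n (q ω))).measurable).stronglyMeasurable, by
      filter_upwards [ae_all_iff.2 fun n => hsimple (s n)] with ω h
      simp only [h]
      exact (hlim ω).limsup_eq.symm⟩
  have hbd : ∀ (g : Q → ℝ), (∀ x, ‖g x‖ ≤ C) → ∀ ω, ‖∫ x, g x ∂(ν ω)‖ ≤ C := fun g hg ω => by
    simpa using norm_integral_le_of_norm_le_const (μ := ν ω) (ae_of_all _ hg)
  have hint : ∀ n, Integrable (fun ω => ∫ x, s n x ∂(ν ω)) P := fun n =>
    Integrable.of_bound ((hmeas n).mono hm) C (ae_of_all _ (hbd _ (hsb n)))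
  have hintl : Integrable (fun ω => ∫ x, f x ∂(ν ω)) P :=
    Integrable.of_bound (hmeasl.mono hm) C (ae_of_all _ (hbd _ hC))
  refine EventuallyEq.trans ?_ (condExp_of_aestronglyMeasurable' hm hmeasl hintl)
  refine tendsto_condExp_unique (fun n ω => s n (q ω)) (fun n ω => ∫ x, s n x ∂(ν ω)) _ _
    (fun n => Integrable.of_bound ((s n).measurable.comp hq).aestronglyMeasurable C
      (ae_of_all _ fun ω => hsb n _)) hint (ae_of_all _ fun ω => hst _) (ae_of_all _ hlim)
    (fun _ => C) (integrable_const _) (fun _ => C) (integrable_const _)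
    (fun n => ae_of_all _ fun ω => hsb n _) (fun n => ae_of_all _ (hbd _ (hsb n))) fun n => ?_
  exact (hsimple (s n)).trans (condExp_of_aestronglyMeasurable' hm (hmeas n) (hint n)).symm

end Conditional

/-- Convexity puts `exp` below its chord on `[-1, 0]`, and `exp (-1) ≤ 1/2`. With `1 - v / 2 ≤ exp
(-v / 2)` after conditioning, this gives the factor one half in the compensator bound. -/
theorem exp_neg_le_one_sub_half {x : ℝ} (h0 : 0 ≤ x) (h1 : x ≤ 1) :
    Real.exp (-x) ≤ 1 - x / 2 := by
  have hb := Real.abs_exp_sub_one_sub_id_le (x := -x) (by rw [abs_neg, abs_of_nonneg h0]; exact h1)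
  have := (abs_le.1 hb).2
  have h2 := convexOn_exp.2 (Set.mem_univ (-1 : ℝ)) (Set.mem_univ 0) h0 (sub_nonneg.2 h1)
    (by ring)
  simp only [smul_eq_mul, mul_neg, mul_one, mul_zero, add_zero, Real.exp_zero] at h2
  have h3 : Real.exp (-1) ≤ 1 / 2 := by
    rw [Real.exp_neg, one_div]
    exact inv_anti₀ (by norm_num) (by linarith [Real.add_one_le_exp (1 : ℝ)])
  nlinarith

/-- The compensated sums of a bounded adapted sequence have an exponential moment at most one. -/
theorem lintegral_exp_compensator_le {Ω : Type*} {mΩ : MeasurableSpace Ω} {P : Measure Ω}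
    [IsProbabilityMeasure P] (ℱ : Filtration ℕ mΩ) {T : ℕ} {X : ℕ → Ω → ℝ}
    (hX : ∀ t < T, Measurable[ℱ (t + 1)] (X t)) (h0 : ∀ t ω, 0 ≤ X t ω) (h1 : ∀ t ω, X t ω ≤ 1)
    {t : ℕ} (ht : t ≤ T) :
    ∫⁻ ω, ENNReal.ofReal (Real.exp (∑ s ∈ Finset.range t, ((P[X s|ℱ s]) ω / 2 - X s ω))) ∂P
      ≤ 1 := by
  induction t with
  | zero => simp
  | succ t ih =>
    have htT : t < T := ht
    have hi : Integrable (X t) P := Integrable.of_bound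
      ((hX t htT).mono (ℱ.le _) le_rfl).aestronglyMeasurable 1 (ae_of_all _ fun ω => by
        rw [Real.norm_eq_abs, abs_of_nonneg (h0 t ω)]; exact h1 t ω)
    set v := P[X t|ℱ t] with hv
    set G : Ω → ℝ := fun ω => ∑ s ∈ Finset.range t, ((P[X s|ℱ s]) ω / 2 - X s ω) with hG
    have hGm : Measurable[ℱ t] G := by
      refine Finset.measurable_sum _ fun s hs => ?_
      have hst : s < t := Finset.mem_range.1 hs
      exact ((stronglyMeasurable_condExp.measurable.mono (ℱ.mono hst.le) le_rfl).div_const 2).sub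
        ((hX s (hst.trans htT)).mono (ℱ.mono hst) le_rfl)
    have hvm : Measurable[ℱ t] v := stronglyMeasurable_condExp.measurable
    have hgm : Measurable[ℱ t] fun ω => ENNReal.ofReal (Real.exp (G ω + v ω / 2)) :=
      (Real.measurable_exp.comp (hGm.add (hvm.div_const 2))).ennreal_ofReal
    have hce : P[fun ω => 1 - X t ω / 2|ℱ t] =ᵐ[P] fun ω => 1 - v ω / 2 := by
      have e1 : (fun ω => 1 - X t ω / 2) = (fun _ => (1 : ℝ)) - (1 / 2 : ℝ) • X t := by
        ext ω; simp; ring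
      rw [e1]
      refine (condExp_sub (integrable_const 1) (hi.smul (1 / 2 : ℝ)) (ℱ t)).trans ?_
      filter_upwards [condExp_smul (1 / 2 : ℝ) (X t) (ℱ t) (μ := P)] with ω h
      rw [Pi.sub_apply, h, condExp_const (ℱ.le t)]
      simp [hv]; ring
    calc ∫⁻ ω, ENNReal.ofReal (Real.exp
          (∑ s ∈ Finset.range (t + 1), ((P[X s|ℱ s]) ω / 2 - X s ω))) ∂P
        = ∫⁻ ω, ENNReal.ofReal (Real.exp (-X t ω)) *
            ENNReal.ofReal (Real.exp (G ω + v ω / 2)) ∂P := by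
          refine lintegral_congr fun ω => ?_
          rw [← ENNReal.ofReal_mul (Real.exp_pos _).le, ← Real.exp_add, Finset.sum_range_succ]
          congr 2; simp only [hG]; ring
      _ ≤ ∫⁻ ω, ENNReal.ofReal (1 - X t ω / 2) *
            ENNReal.ofReal (Real.exp (G ω + v ω / 2)) ∂P := by
          refine lintegral_mono fun ω => ?_
          gcongr
          exact exp_neg_le_one_sub_half (h0 t ω) (h1 t ω)
      _ = ∫⁻ ω, ENNReal.ofReal ((P[fun ω => 1 - X t ω / 2|ℱ t]) ω) *
            ENNReal.ofReal (Real.exp (G ω + v ω / 2)) ∂P :=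
          lintegral_ofReal_mul_eq_condExp (ℱ.le t) ((integrable_const 1).sub (hi.div_const 2))
            (ae_of_all _ fun ω => by
              change 0 ≤ 1 - X t ω / 2
              linarith [h1 t ω]) hgm
      _ = ∫⁻ ω, ENNReal.ofReal (1 - v ω / 2) *
            ENNReal.ofReal (Real.exp (G ω + v ω / 2)) ∂P :=
          lintegral_congr_ae (hce.mono fun ω h => by simp only [h])
      _ ≤ ∫⁻ ω, ENNReal.ofReal (Real.exp (G ω)) ∂P := by
          refine lintegral_mono fun ω => ?_
          rw [add_comm, Real.exp_add, ENNReal.ofReal_mul (Real.exp_pos _).le, ← mul_assoc]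
          refine mul_le_of_le_one_left zero_le ?_
          rw [← ENNReal.ofReal_mul' (Real.exp_pos _).le]
          rw [ENNReal.ofReal_le_one]
          have := Real.add_one_le_exp (-(v ω / 2))
          calc (1 - v ω / 2) * Real.exp (v ω / 2)
              ≤ Real.exp (-(v ω / 2)) * Real.exp (v ω / 2) := by gcongr; linarith
            _ = 1 := by rw [← Real.exp_add]; simp
      _ ≤ 1 := ih htT.le

/-- With probability at least `1 - δ`, the compensator of a bounded adapted sequence is controlled
by the sum of the sequence. -/
theorem measure_compensator_gt_le {Ω : Type*} {mΩ : MeasurableSpace Ω} {P : Measure Ω}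
    [IsProbabilityMeasure P] (ℱ : Filtration ℕ mΩ) {T : ℕ} {X : ℕ → Ω → ℝ}
    (hX : ∀ t < T, Measurable[ℱ (t + 1)] (X t)) (h0 : ∀ t ω, 0 ≤ X t ω) (h1 : ∀ t ω, X t ω ≤ 1)
    {δ : ℝ} (hδ : 0 < δ) :
    P {ω | Real.log (1 / δ) < ∑ s ∈ Finset.range T, ((P[X s|ℱ s]) ω / 2 - X s ω)}
      ≤ ENNReal.ofReal δ := by
  have h := lintegral_exp_compensator_le (P := P) ℱ hX h0 h1 le_rfl
  have hmeas : Measurable fun ω => ENNReal.ofReal (Real.exp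
      (∑ s ∈ Finset.range T, ((P[X s|ℱ s]) ω / 2 - X s ω))) := by
    refine (Real.measurable_exp.comp (Finset.measurable_sum _ fun s hs => ?_)).ennreal_ofReal
    exact ((stronglyMeasurable_condExp.measurable.mono (ℱ.le s) le_rfl).div_const 2).sub
      ((hX s (Finset.mem_range.1 hs)).mono (ℱ.le _) le_rfl)
  have hmk := mul_meas_ge_le_lintegral (μ := P) hmeas (ENNReal.ofReal (1 / δ))
  have hsub : {ω | Real.log (1 / δ) < ∑ s ∈ Finset.range T, ((P[X s|ℱ s]) ω / 2 - X s ω)} ⊆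
      {ω | ENNReal.ofReal (1 / δ) ≤ ENNReal.ofReal (Real.exp
        (∑ s ∈ Finset.range T, ((P[X s|ℱ s]) ω / 2 - X s ω)))} := fun ω hω =>
    ENNReal.ofReal_le_ofReal ((Real.log_le_iff_le_exp (by positivity)).1 (le_of_lt hω))
  refine (measure_mono hsub).trans ?_
  have hle := hmk.trans h
  rw [one_div, ENNReal.ofReal_inv_of_pos hδ] at hle ⊢
  rwa [mul_comm, ← div_eq_mul_inv, ENNReal.div_le_iff (by simpa using hδ) (by simp), one_mul] at hle

end RLHF

/-! ### Covariance matrices, histories and the elliptical potential. -/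

namespace RLHF

open Matrix

section Design

variable {X A ι : Type*} {d : ℕ}

theorem prefProb_nonneg (φ : X → A → EuclideanSpace ℝ (Fin d)) (θ : EuclideanSpace ℝ (Fin d))
    (q : X × A × A) : 0 ≤ prefProb φ θ q := Real.sigmoid_nonneg _

theorem prefProb_le_one (φ : X → A → EuclideanSpace ℝ (Fin d)) (θ : EuclideanSpace ℝ (Fin d))
    (q : X × A × A) : prefProb φ θ q ≤ 1 := Real.sigmoid_le_one _

theorem diffFeature_apply_abs_le {φ : X → A → EuclideanSpace ℝ (Fin d)}
    (hφ : ∀ x a, ‖φ x a‖ ≤ 1) (q : X × A × A)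
    (k : Fin d) :
    |diffFeature φ q k| ≤ 2 := by
  have h2 : ‖φ q.1 q.2.1 - φ q.1 q.2.2‖ ≤ 2 :=
    (norm_sub_le _ _).trans (by linarith [hφ q.1 q.2.1, hφ q.1 q.2.2])
  exact (PiLp.norm_apply_le (φ q.1 q.2.1 - φ q.1 q.2.2) k).trans h2

theorem diffFeature_dotProduct_self_le {φ : X → A → EuclideanSpace ℝ (Fin d)}
    (hφ : ∀ x a, ‖φ x a‖ ≤ 1) (q : X × A × A) : diffFeature φ q ⬝ᵥ diffFeature φ q ≤ 4 := by
  have h1 : diffFeature φ q ⬝ᵥ diffFeature φ q = ‖φ q.1 q.2.1 - φ q.1 q.2.2‖ ^ 2 := by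
    rw [← real_inner_self_eq_norm_sq, EuclideanSpace.inner_eq_star_dotProduct, star_trivial]; rfl
  have h2 : ‖φ q.1 q.2.1 - φ q.1 q.2.2‖ ≤ 2 :=
    (norm_sub_le _ _).trans (by linarith [hφ q.1 q.2.1, hφ q.1 q.2.2])
  rw [h1]
  nlinarith [norm_nonneg (φ q.1 q.2.1 - φ q.1 q.2.2)]

variable [Fintype ι]

/-- The Gram matrix of the feature differences of a family of queries. -/
noncomputable def gramMatrix (φ : X → A → EuclideanSpace ℝ (Fin d)) (q : ι → X × A × A) :
    Matrix (Fin d) (Fin d) ℝ :=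
  ∑ i, vecMulVec (diffFeature φ (q i)) (diffFeature φ (q i))

/-- The sum of the feature differences weighted by the centred labels. -/
noncomputable def noiseVec (φ : X → A → EuclideanSpace ℝ (Fin d))
    (θ : EuclideanSpace ℝ (Fin d)) (q : ι → X × A × A) (b : ι → Bool) : Fin d → ℝ :=
  ∑ i, labelNoise (prefProb φ θ (q i)) (b i) • diffFeature φ (q i)

theorem covMatrix_eq (φ : X → A → EuclideanSpace ℝ (Fin d)) (lam : ℝ) (D : ι → Comparison X A) :
    covMatrix φ lam D = lam • 1 + gramMatrix φ fun i => (D i).query := rfl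

theorem posSemidef_gramMatrix (φ : X → A → EuclideanSpace ℝ (Fin d)) (q : ι → X × A × A) :
    (gramMatrix φ q).PosSemidef :=
  posSemidef_sum _ fun _ _ => posSemidef_vecMulVec_self _

theorem posDef_covMatrix (φ : X → A → EuclideanSpace ℝ (Fin d)) {lam : ℝ} (hlam : 0 < lam)
    (D : ι → Comparison X A) : (covMatrix φ lam D).PosDef :=
  (PosDef.one.smul hlam).add_posSemidef (posSemidef_gramMatrix φ _)

theorem dotProduct_gramMatrix_mulVec (φ : X → A → EuclideanSpace ℝ (Fin d)) (q : ι → X × A × A)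
    (u : Fin d → ℝ) : u ⬝ᵥ gramMatrix φ q *ᵥ u = ∑ i, (u ⬝ᵥ diffFeature φ (q i)) ^ 2 := by
  rw [gramMatrix, sum_mulVec, dotProduct_sum]
  refine Finset.sum_congr rfl fun i _ => ?_
  rw [vecMulVec_mulVec, dotProduct_comm (diffFeature φ (q i)) u, dotProduct_smul, sq]
  rfl

theorem dotProduct_covMatrix_mulVec (φ : X → A → EuclideanSpace ℝ (Fin d)) (lam : ℝ)
    (D : ι → Comparison X A) (u : Fin d → ℝ) :
    u ⬝ᵥ covMatrix φ lam D *ᵥ u =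
      lam * (u ⬝ᵥ u) + ∑ i, (u ⬝ᵥ diffFeature φ (D i).query) ^ 2 := by
  rw [covMatrix_eq, add_mulVec, dotProduct_add, dotProduct_gramMatrix_mulVec, smul_mulVec,
    one_mulVec, dotProduct_smul, smul_eq_mul]

theorem le_dotProduct_covMatrix_mulVec (φ : X → A → EuclideanSpace ℝ (Fin d)) (lam : ℝ)
    (D : ι → Comparison X A) (u : Fin d → ℝ) :
    lam * (u ⬝ᵥ u) ≤ u ⬝ᵥ covMatrix φ lam D *ᵥ u := by
  rw [dotProduct_covMatrix_mulVec]
  have : 0 ≤ ∑ i, (u ⬝ᵥ diffFeature φ (D i).query) ^ 2 := Finset.sum_nonneg fun _ _ => sq_nonneg _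
  linarith

theorem diffFeature_inv_covMatrix_nonneg (φ : X → A → EuclideanSpace ℝ (Fin d))
    {lam : ℝ} (hlam : 0 < lam) (D : ι → Comparison X A) (q : X × A × A) :
    0 ≤ diffFeature φ q ⬝ᵥ (covMatrix φ lam D)⁻¹ *ᵥ diffFeature φ q := by
  simpa using (posDef_covMatrix φ hlam D).inv.posSemidef.dotProduct_mulVec_nonneg (diffFeature φ q)

theorem diffFeature_inv_covMatrix_le {φ : X → A → EuclideanSpace ℝ (Fin d)}
    (hφ : ∀ x a, ‖φ x a‖ ≤ 1) {lam : ℝ} (hlam : 0 < lam) (D : ι → Comparison X A)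
    (q : X × A × A) :
    diffFeature φ q ⬝ᵥ (covMatrix φ lam D)⁻¹ *ᵥ diffFeature φ q ≤ 4 / lam :=
  ((posDef_covMatrix φ hlam D).dotProduct_inv_mulVec_le hlam
    (le_dotProduct_covMatrix_mulVec φ lam D) _).trans
    (by gcongr; exact diffFeature_dotProduct_self_le hφ q)

/-- Diagonal entries are quadratic forms bounded by `1 / λ`, and Cauchy-Schwarz passes to the
others. The bound lets these random entries be pulled out of conditional expectations. -/
theorem abs_inv_covMatrix_apply_le (φ : X → A → EuclideanSpace ℝ (Fin d))
    {lam : ℝ} (hlam : 0 < lam) (D : ι → Comparison X A) (k l : Fin d) :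
    |(covMatrix φ lam D)⁻¹ k l| ≤ 1 / lam := by
  have hC := posDef_covMatrix φ hlam D
  have h1 : ∀ i, (Pi.single i 1 : Fin d → ℝ) ⬝ᵥ (covMatrix φ lam D)⁻¹ *ᵥ Pi.single i 1 ≤ 1 / lam :=
    fun i => by
      simpa using hC.dotProduct_inv_mulVec_le hlam
        (le_dotProduct_covMatrix_mulVec φ lam D) (Pi.single i 1)
  have h0 : ∀ i, 0 ≤ (Pi.single i 1 : Fin d → ℝ) ⬝ᵥ (covMatrix φ lam D)⁻¹ *ᵥ Pi.single i 1 :=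
    fun i => by simpa using hC.inv.posSemidef.diag_nonneg
  have h2 := hC.inv.posSemidef.sq_dotProduct_mulVec_le (Pi.single k 1) (Pi.single l 1)
  have h3 : (Pi.single k 1 : Fin d → ℝ) ⬝ᵥ (covMatrix φ lam D)⁻¹ *ᵥ Pi.single l 1 =
      (covMatrix φ lam D)⁻¹ k l := by simp
  rw [h3] at h2
  refine abs_le_of_sq_le_sq (h2.trans ?_) (by positivity)
  rw [sq]
  exact mul_le_mul (h1 k) (h1 l) (h0 l) (by positivity)

theorem trace_mul_vecMulVec_self (C : Matrix (Fin d) (Fin d) ℝ) (z : Fin d → ℝ) :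
    (C * vecMulVec z z).trace = z ⬝ᵥ C *ᵥ z := by
  rw [mul_vecMulVec, trace_vecMulVec, dotProduct_comm]

theorem trace_inv_covMatrix_mul_gramMatrix_le {κ : Type*} [Fintype κ]
    {φ : X → A → EuclideanSpace ℝ (Fin d)}
    (hφ : ∀ x a, ‖φ x a‖ ≤ 1) {lam : ℝ} (hlam : 0 < lam) (D : ι → Comparison X A)
    (q : κ → X × A × A) :
    ((covMatrix φ lam D)⁻¹ * gramMatrix φ q).trace ≤ Fintype.card κ * (4 / lam) := by
  rw [gramMatrix, Matrix.mul_sum, trace_sum]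
  refine (Finset.sum_le_card_nsmul Finset.univ _ (4 / lam) fun i _ => ?_).trans (by simp)
  rw [trace_mul_vecMulVec_self]
  exact diffFeature_inv_covMatrix_le hφ hlam D _

theorem trace_inv_covMatrix_mul_self (φ : X → A → EuclideanSpace ℝ (Fin d)) {lam : ℝ}
    (hlam : 0 < lam) (D : ι → Comparison X A) :
    ((covMatrix φ lam D)⁻¹ * covMatrix φ lam D).trace = d := by
  rw [nonsing_inv_mul _ ((isUnit_iff_isUnit_det _).1 (posDef_covMatrix φ hlam D).isUnit)]
  simp

/-- The Gram matrix is the covariance minus `λ I`, and the inverse has nonnegative trace. Counting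
the offline data twice thus costs at most `d`, however many samples there are. -/
theorem trace_inv_covMatrix_mul_gramMatrix_self_le (φ : X → A → EuclideanSpace ℝ (Fin d)) {lam : ℝ}
    (hlam : 0 < lam) (D : ι → Comparison X A) :
    ((covMatrix φ lam D)⁻¹ * gramMatrix φ fun i => (D i).query).trace ≤ d := by
  have h : gramMatrix φ (fun i => (D i).query) = covMatrix φ lam D - lam • 1 := by
    rw [covMatrix_eq]; abel
  rw [h, Matrix.mul_sub, trace_sub, trace_inv_covMatrix_mul_self φ hlam, Matrix.mul_smul,
    Matrix.mul_one, trace_smul, smul_eq_mul]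
  have := (posDef_covMatrix φ hlam D).inv.posSemidef.trace_nonneg
  nlinarith

section History

variable {n : ℕ}

theorem gramMatrix_history (φ : X → A → EuclideanSpace ℝ (Fin d)) (D : Fin n → Comparison X A)
    (D' : ℕ → Comparison X A) (t : ℕ) :
    gramMatrix φ (fun i => (history D D' t i).query) =
      gramMatrix φ (fun i => (D i).query) + gramMatrix φ (fun s : Fin t => (D' s).query) := by
  simp [gramMatrix, Fintype.sum_sum_type, history]

theorem gramMatrix_history_succ (φ : X → A → EuclideanSpace ℝ (Fin d)) (D : Fin n → Comparison X A)
    (D' : ℕ → Comparison X A) (t : ℕ) :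
    gramMatrix φ (fun i => (history D D' (t + 1) i).query) =
      gramMatrix φ (fun i => (history D D' t i).query) +
        vecMulVec (diffFeature φ (D' t).query) (diffFeature φ (D' t).query) := by
  rw [gramMatrix_history, gramMatrix_history, add_assoc]
  congr 1
  simp [gramMatrix, Fin.sum_univ_castSucc]

theorem covMatrix_history (φ : X → A → EuclideanSpace ℝ (Fin d)) (lam : ℝ)
    (D : Fin n → Comparison X A) (D' : ℕ → Comparison X A) (t : ℕ) :
    covMatrix φ lam (history D D' t) =
      covMatrix φ lam D + gramMatrix φ (fun s : Fin t => (D' s).query) := by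
  rw [covMatrix_eq, covMatrix_eq, gramMatrix_history, add_assoc]

theorem covMatrix_history_succ (φ : X → A → EuclideanSpace ℝ (Fin d)) (lam : ℝ)
    (D : Fin n → Comparison X A) (D' : ℕ → Comparison X A) (t : ℕ) :
    covMatrix φ lam (history D D' (t + 1)) = covMatrix φ lam (history D D' t) +
        vecMulVec (diffFeature φ (D' t).query) (diffFeature φ (D' t).query) := by
  rw [covMatrix_eq, covMatrix_eq, gramMatrix_history_succ, add_assoc]

theorem noiseVec_history_succ (φ : X → A → EuclideanSpace ℝ (Fin d))
    (θ : EuclideanSpace ℝ (Fin d)) (D : Fin n → Comparison X A)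
    (D' : ℕ → Comparison X A) (t : ℕ) :
    noiseVec φ θ (fun i => (history D D' (t + 1) i).query)
        (fun i => (history D D' (t + 1) i).label) =
      noiseVec φ θ (fun i => (history D D' t i).query) (fun i => (history D D' t i).label) +
        labelNoise (prefProb φ θ (D' t).query) (D' t).label • diffFeature φ (D' t).query := by
  simp [noiseVec, Fintype.sum_sum_type, history, Fin.sum_univ_castSucc, add_assoc]

/-- The elliptical potential lemma. -/
theorem sum_elliptical_potential_le {φ : X → A → EuclideanSpace ℝ (Fin d)}
    (hφ : ∀ x a, ‖φ x a‖ ≤ 1) (hd : 0 < d) {lam : ℝ} (hlam : 4 ≤ lam)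
    (D : Fin n → Comparison X A) (D' : ℕ → Comparison X A) (T : ℕ) :
    ∑ t ∈ Finset.range T, diffFeature φ (D' t).query ⬝ᵥ
        (covMatrix φ lam (history D D' t))⁻¹ *ᵥ diffFeature φ (D' t).query
      ≤ 8 * d * Real.log (1 + T / (d * lam)) := by
  have hlam0 : 0 < lam := by linarith
  have hd' : (0 : ℝ) < d := by exact_mod_cast hd
  set x := fun t => diffFeature φ (D' t).query ⬝ᵥ
    (covMatrix φ lam (history D D' t))⁻¹ *ᵥ diffFeature φ (D' t).query with hx
  have hx0 : ∀ t, 0 ≤ x t := fun t => diffFeature_inv_covMatrix_nonneg φ hlam0 _ _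
  have hx1 : ∀ t, x t ≤ 1 := fun t => (diffFeature_inv_covMatrix_le hφ hlam0 _ _).trans
    (by rw [div_le_one hlam0]; exact hlam)
  have hpd := fun t => posDef_covMatrix φ hlam0 (history D D' t)
  have hlog : ∀ t, ∑ s ∈ Finset.range t, Real.log (1 + x s) =
      Real.log (covMatrix φ lam (history D D' t)).det -
        Real.log (covMatrix φ lam (history D D' 0)).det := by
    intro t
    induction t with
    | zero => simp
    | succ t ih =>
      rw [Finset.sum_range_succ, ih, covMatrix_history_succ, det_add_vecMulVec_self
        ((isUnit_iff_isUnit_det _).1 (hpd t).isUnit),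
        Real.log_mul (hpd t).det_pos.ne' (by have := hx0 t; simp only [hx] at this; positivity)]
      ring
  -- Since `λ ≥ 4` and the features differ by at most `2` in norm, `x t ≤ 1`, so `x / (1 + x) ≥ x /
  -- 2`.
  have hhalf : ∀ t, x t ≤ 2 * Real.log (1 + x t) := by
    intro t
    have h1 := Real.one_sub_inv_le_log_of_pos (show 0 < 1 + x t by linarith [hx0 t])
    have h2 : x t / 2 ≤ 1 - (1 + x t)⁻¹ := by
      have h3 : 1 - (1 + x t)⁻¹ = x t / (1 + x t) := by
        have : 1 + x t ≠ 0 := by linarith [hx0 t]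
        field_simp; ring
      rw [h3]
      exact div_le_div_of_nonneg_left (hx0 t) (by linarith [hx0 t]) (by linarith [hx1 t])
    linarith
  have hnonempty : Nonempty (Fin d) := ⟨⟨0, hd⟩⟩
  have hC0 : covMatrix φ lam (history D D' 0) = covMatrix φ lam D := by
    rw [covMatrix_history]; simp [gramMatrix]
  have hdet : (covMatrix φ lam (history D D' T)).det ≤
      (covMatrix φ lam D).det * (1 + 4 * (T / (d * lam))) ^ d := by
    refine ((posDef_covMatrix φ hlam0 D).det_le_mul_trace_pow (hpd T).posSemidef).trans ?_
    rw [Fintype.card_fin]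
    refine mul_le_mul_of_nonneg_left (pow_le_pow_left₀ ?_ ?_ d)
      (posDef_covMatrix φ hlam0 D).det_pos.le
    · rw [covMatrix_history, Matrix.mul_add, trace_add, trace_inv_covMatrix_mul_self φ hlam0,
        gramMatrix, Matrix.mul_sum, trace_sum]
      have : 0 ≤ ∑ s : Fin T, ((covMatrix φ lam D)⁻¹ *
          vecMulVec (diffFeature φ (D' s).query) (diffFeature φ (D' s).query)).trace :=
        Finset.sum_nonneg fun s _ => by
          rw [trace_mul_vecMulVec_self]
          exact diffFeature_inv_covMatrix_nonneg φ hlam0 _ _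
      positivity
    · rw [covMatrix_history, Matrix.mul_add, trace_add, trace_inv_covMatrix_mul_self φ hlam0]
      have := trace_inv_covMatrix_mul_gramMatrix_le hφ hlam0 D fun s : Fin T => (D' s).query
      rw [Fintype.card_fin] at this
      rw [div_le_iff₀ hd']
      refine (add_le_add_right this _).trans (le_of_eq ?_)
      field_simp
  have hy : (0 : ℝ) ≤ T / (d * lam) := by positivity
  calc ∑ t ∈ Finset.range T, x t ≤ ∑ t ∈ Finset.range T, 2 * Real.log (1 + x t) :=
        Finset.sum_le_sum fun t _ => hhalf t
    _ = 2 * (Real.log (covMatrix φ lam (history D D' T)).det -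
          Real.log (covMatrix φ lam D).det) := by rw [← Finset.mul_sum, hlog, hC0]
    _ ≤ 2 * (Real.log ((covMatrix φ lam D).det * (1 + 4 * (T / (d * lam))) ^ d) -
          Real.log (covMatrix φ lam D).det) := by
        gcongr
        exact (hpd T).det_pos
    _ = 2 * (d * Real.log (1 + 4 * (T / (d * lam)))) := by
        rw [Real.log_mul (posDef_covMatrix φ hlam0 D).det_pos.ne' (by positivity), Real.log_pow]
        ring
    _ ≤ 2 * (d * Real.log ((1 + T / (d * lam)) ^ 4)) := by
        -- Bernoulli's inequality trades the factor `4` inside the logarithm for one outside.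
        have hb := one_add_mul_le_pow (a := (T : ℝ) / (d * lam)) (by linarith) 4
        gcongr
        exact_mod_cast hb
    _ = 8 * d * Real.log (1 + T / (d * lam)) := by
        rw [Real.log_pow]; push_cast; ring

/-- A bound on the mixture potential bounds the self-normalized noise. -/
theorem selfNormalized_le_of_mixturePotential_lt {φ : X → A → EuclideanSpace ℝ (Fin d)}
    (hφ : ∀ x a, ‖φ x a‖ ≤ 1) (hd : 0 < d) {lam R : ℝ} (hlam : 4 ≤ lam) {T t : ℕ} (ht : t ≤ T)
    (hT : 0 < T) (hR : 2 * (T : ℝ) ≤ R)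
    (D : Fin n → Comparison X A) (D' : ℕ → Comparison X A) (S : Fin d → ℝ)
    (h : Real.sqrt (covMatrix φ lam D).det * mixturePotential
      (covMatrix φ lam (history D D' t) + gramMatrix φ fun i => (D i).query) S < R) :
    S ⬝ᵥ (covMatrix φ lam (history D D' t) + gramMatrix φ fun i => (D i).query)⁻¹ *ᵥ S ≤
      4 * (d * Real.log R) := by
  have hlam0 : 0 < lam := by linarith
  have hd' : (1 : ℝ) ≤ d := by exact_mod_cast hd
  have hT' : (1 : ℝ) ≤ T := by exact_mod_cast hT
  have hR0 : 0 < R := by linarith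
  have hL : 0 ≤ Real.log R := Real.log_nonneg (by linarith)
  have hnonempty : Nonempty (Fin d) := ⟨⟨0, hd⟩⟩
  set V := covMatrix φ lam (history D D' t) + gramMatrix φ fun i => (D i).query with hV
  have hVpd : V.PosDef :=
    (posDef_covMatrix φ hlam0 (history D D' t)).add_posSemidef (posSemidef_gramMatrix φ _)
  have hC := posDef_covMatrix φ hlam0 D
  have hdet : V.det ≤ (covMatrix φ lam D).det * (R ^ 2) ^ d := by
    refine (hC.det_le_mul_trace_pow hVpd.posSemidef).trans ?_
    rw [Fintype.card_fin]
    -- The trace is `d` from `Σ_off`, at most `T` from the online queries and at most `d` from the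
    -- repeated offline Gram matrix; `R ≥ 2 T ≥ 2` absorbs the sum into `d R²`.
    have htr : ((covMatrix φ lam D)⁻¹ * V).trace ≤ d * R ^ 2 := by
      rw [hV, covMatrix_history, Matrix.mul_add, Matrix.mul_add, trace_add, trace_add,
        trace_inv_covMatrix_mul_self φ hlam0]
      have h1 := trace_inv_covMatrix_mul_gramMatrix_le hφ hlam0 D fun s : Fin t => (D' s).query
      have h2 := trace_inv_covMatrix_mul_gramMatrix_self_le φ hlam0 D
      rw [Fintype.card_fin] at h1
      have h3 : (t : ℝ) * (4 / lam) ≤ T := by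
        have : (t : ℝ) ≤ T := by exact_mod_cast ht
        have h4 : 4 / lam ≤ 1 := by rw [div_le_one hlam0]; exact hlam
        calc (t : ℝ) * (4 / lam) ≤ T * 1 := by gcongr
          _ = T := mul_one _
      have h5 : (T : ℝ) + 2 ≤ R ^ 2 := by nlinarith
      nlinarith
    have htr0 : 0 ≤ ((covMatrix φ lam D)⁻¹ * V).trace := by
      have h0 : 0 ≤ ((covMatrix φ lam D)⁻¹ * V).trace := by
        rw [hV, covMatrix_history, Matrix.mul_add, Matrix.mul_add, trace_add, trace_add,
          trace_inv_covMatrix_mul_self φ hlam0]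
        have hg : ∀ {κ : Type} [Fintype κ] (q : κ → X × A × A),
            0 ≤ ((covMatrix φ lam D)⁻¹ * gramMatrix φ q).trace := fun q => by
          rw [gramMatrix, Matrix.mul_sum, trace_sum]
          exact Finset.sum_nonneg fun s _ => by
            rw [trace_mul_vecMulVec_self]
            exact diffFeature_inv_covMatrix_nonneg φ hlam0 _ _
        have := hg fun s : Fin t => (D' s).query
        have := hg fun i => (D i).query
        positivity
      exact h0
    refine mul_le_mul_of_nonneg_left (pow_le_pow_left₀ (by positivity) ?_ d) hC.det_pos.le
    rw [div_le_iff₀ (by linarith), mul_comm]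
    exact htr
  set Z := S ⬝ᵥ V⁻¹ *ᵥ S with hZ
  have hs0 : 0 < Real.sqrt (covMatrix φ lam D).det := Real.sqrt_pos.2 hC.det_pos
  have hexp : Real.exp (Z / 2) ≤ R ^ (1 + d) := by
    unfold mixturePotential at h
    rw [← hZ, ← mul_div_assoc, div_lt_iff₀ (Real.sqrt_pos.2 hVpd.det_pos)] at h
    have h1 : Real.sqrt V.det ≤ Real.sqrt (covMatrix φ lam D).det * R ^ d := by
      refine (Real.sqrt_le_sqrt hdet).trans (le_of_eq ?_)
      rw [Real.sqrt_mul hC.det_pos.le, ← pow_mul, mul_comm 2 d, pow_mul,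
        Real.sqrt_sq (by positivity)]
    have h2 : Real.sqrt (covMatrix φ lam D).det * Real.exp (Z / 2) ≤
        Real.sqrt (covMatrix φ lam D).det * R ^ (1 + d) := by
      refine h.le.trans ((mul_le_mul_of_nonneg_left h1 hR0.le).trans (le_of_eq ?_))
      ring
    exact le_of_mul_le_mul_left h2 hs0
  -- This yields `Z ≤ 2 (1 + d) log R`, and `1 + d ≤ 2 d`.
  have hlog := Real.log_le_log (Real.exp_pos _) hexp
  rw [Real.log_exp, Real.log_pow] at hlog
  push_cast at hlog
  nlinarith

end History

end Design

/-! ### Measurability of the data-dependent vectors and matrices. -/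

section Measurability

variable {Ω X A ι : Type*} {m : MeasurableSpace Ω} [MeasurableSpace X] [MeasurableSpace A]
  [Fintype ι] {d : ℕ}

theorem measurable_query : Measurable (Comparison.query : Comparison X A → X × A × A) := by
  unfold Comparison.query; fun_prop

theorem measurable_label : Measurable (Comparison.label : Comparison X A → Bool) := by
  unfold Comparison.label; fun_prop

theorem measurable_diffFeature {φ : X → A → EuclideanSpace ℝ (Fin d)}
    (hφm : Measurable (Function.uncurry φ)) : Measurable (diffFeature φ) := by
  have h1 : Measurable fun q : X × A × A => φ q.1 q.2.1 :=
    hφm.comp (measurable_fst.prodMk measurable_snd.fst)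
  have h2 : Measurable fun q : X × A × A => φ q.1 q.2.2 :=
    hφm.comp (measurable_fst.prodMk measurable_snd.snd)
  exact (WithLp.measurable_ofLp 2 (Fin d → ℝ)).comp (h1.sub h2)

theorem measurable_diffFeature_apply {φ : X → A → EuclideanSpace ℝ (Fin d)}
    (hφm : Measurable (Function.uncurry φ)) {q : Ω → X × A × A} (hq : Measurable q) (i : Fin d) :
    Measurable fun ω => diffFeature φ (q ω) i :=
  (measurable_pi_apply i).comp ((measurable_diffFeature hφm).comp hq)

theorem measurable_prefProb {φ : X → A → EuclideanSpace ℝ (Fin d)}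
    (hφm : Measurable (Function.uncurry φ)) (θ : EuclideanSpace ℝ (Fin d)) {q : Ω → X × A × A}
    (hq : Measurable q) : Measurable fun ω => prefProb φ θ (q ω) := by
  refine continuous_sigmoid.measurable.comp (Finset.measurable_sum _ fun i _ => ?_)
  exact (measurable_diffFeature_apply hφm hq i).const_mul _

theorem measurable_gramMatrix {φ : X → A → EuclideanSpace ℝ (Fin d)}
    (hφm : Measurable (Function.uncurry φ)) {q : Ω → ι → X × A × A}
    (hq : ∀ i, Measurable fun ω => q ω i) (k l : Fin d) :
    Measurable fun ω => gramMatrix φ (q ω) k l := by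
  simp only [gramMatrix, Matrix.sum_apply, vecMulVec_apply]
  exact Finset.measurable_sum _ fun i _ => (measurable_diffFeature_apply hφm (hq i) k).mul
    (measurable_diffFeature_apply hφm (hq i) l)

theorem measurable_covMatrix {φ : X → A → EuclideanSpace ℝ (Fin d)}
    (hφm : Measurable (Function.uncurry φ)) (lam : ℝ) {D : Ω → ι → Comparison X A}
    (hD : ∀ i, Measurable fun ω => (D ω i).query) (k l : Fin d) :
    Measurable fun ω => covMatrix φ lam (D ω) k l := by
  simp only [covMatrix_eq, Matrix.add_apply]
  exact (measurable_gramMatrix hφm hD k l).const_add _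

theorem measurable_labelNoise {p : Ω → ℝ} (hp : Measurable p) {b : Ω → Bool} (hb : Measurable b) :
    Measurable fun ω => labelNoise (p ω) (b ω) :=
  (Measurable.ite (hb (measurableSet_singleton true)) measurable_const measurable_const).sub hp

theorem measurable_noiseVec {φ : X → A → EuclideanSpace ℝ (Fin d)}
    (hφm : Measurable (Function.uncurry φ)) (θ : EuclideanSpace ℝ (Fin d))
    {q : Ω → ι → X × A × A} (hq : ∀ i, Measurable fun ω => q ω i)
    {b : Ω → ι → Bool} (hb : ∀ i, Measurable fun ω => b ω i) (k : Fin d) :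
    Measurable fun ω => noiseVec φ θ (q ω) (b ω) k := by
  simp only [noiseVec, Finset.sum_apply, Pi.smul_apply, smul_eq_mul]
  exact Finset.measurable_sum _ fun i _ =>
    (measurable_labelNoise (measurable_prefProb hφm θ (hq i)) (hb i)).mul
      (measurable_diffFeature_apply hφm (hq i) k)

theorem measurable_det {M : Ω → Matrix (Fin d) (Fin d) ℝ}
    (hM : ∀ k l, Measurable fun ω => M ω k l) : Measurable fun ω => (M ω).det := by
  simp only [det_apply]
  exact Finset.measurable_sum _ fun σ _ =>
    (Finset.measurable_prod _ fun i _ => hM (σ i) i).const_smul _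

theorem measurable_inv_apply {M : Ω → Matrix (Fin d) (Fin d) ℝ}
    (hM : ∀ k l, Measurable fun ω => M ω k l) (k l : Fin d) :
    Measurable fun ω => (M ω)⁻¹ k l := by
  simp only [inv_def, Matrix.smul_apply, adjugate_apply, Ring.inverse_eq_inv', smul_eq_mul]
  refine (measurable_det hM).inv.mul (measurable_det fun i j => ?_)
  simp only [updateRow_apply]
  by_cases h : i = l
  · simp [h]
  · simpa [h] using hM i j

theorem measurable_dotProduct_mulVec {M : Ω → Matrix (Fin d) (Fin d) ℝ}
    (hM : ∀ k l, Measurable fun ω => M ω k l) {u : Ω → Fin d → ℝ}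
    (hu : ∀ k, Measurable fun ω => u ω k) : Measurable fun ω => u ω ⬝ᵥ M ω *ᵥ u ω := by
  simp only [dotProduct, mulVec]
  exact Finset.measurable_sum _ fun i _ => (hu i).mul
    (Finset.measurable_sum _ fun j _ => (hM i j).mul (hu j))

theorem measurable_mixturePotential {M : Ω → Matrix (Fin d) (Fin d) ℝ}
    (hM : ∀ k l, Measurable fun ω => M ω k l) {u : Ω → Fin d → ℝ}
    (hu : ∀ k, Measurable fun ω => u ω k) :
    Measurable fun ω => mixturePotential (M ω) (u ω) := by
  unfold mixturePotential
  exact (Real.measurable_exp.comp ((measurable_dotProduct_mulVec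
    (measurable_inv_apply hM) hu).div_const 2)).div (measurable_det hM).sqrt

end Measurability

end RLHF

/-! ### The noise potential and conditional query widths along a run. -/

namespace RLHF

open Matrix Filter
open scoped ENNReal Topology

section Run

variable {X A Ω : Type*} [MeasurableSpace X] [MeasurableSpace A] {mΩ : MeasurableSpace Ω}
  {P : Measure Ω} {d n : ℕ} {φ : X → A → EuclideanSpace ℝ (Fin d)}

/-- The normalized mixture potential of the noise accumulated from the offline data and the first
`t` online comparisons. -/
noncomputable def noisePotential (φ : X → A → EuclideanSpace ℝ (Fin d))
    (θ : EuclideanSpace ℝ (Fin d)) (lam : ℝ) (Doff : Ω → Fin n → Comparison X A)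
    (Don : ℕ → Ω → Comparison X A) (t : ℕ) (ω : Ω) : ℝ :=
  Real.sqrt (covMatrix φ lam (Doff ω)).det * mixturePotential
    (covMatrix φ lam (history (Doff ω) (fun s => Don s ω) t) +
      gramMatrix φ fun i => (Doff ω i).query)
    (noiseVec φ θ (fun i => (history (Doff ω) (fun s => Don s ω) t i).query)
      fun i => (history (Doff ω) (fun s => Don s ω) t i).label)

theorem measurable_history {m : MeasurableSpace Ω} {Doff : Ω → Fin n → Comparison X A}
    {Don : ℕ → Ω → Comparison X A} {t : ℕ} (hoff : Measurable Doff)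
    (hon : ∀ s < t, Measurable (Don s)) (i : Fin n ⊕ Fin t) :
    Measurable fun ω => history (Doff ω) (fun s => Don s ω) t i := by
  rcases i with i | s
  · exact (measurable_pi_apply i).comp hoff
  · exact hon s s.2

theorem measurable_noisePotential {m : MeasurableSpace Ω}
    (hφm : Measurable (Function.uncurry φ)) (θ : EuclideanSpace ℝ (Fin d)) (lam : ℝ)
    {Doff : Ω → Fin n → Comparison X A} {Don : ℕ → Ω → Comparison X A} {t : ℕ}
    (hoff : Measurable Doff) (hon : ∀ s < t, Measurable (Don s)) :
    Measurable (noisePotential φ θ lam Doff Don t) := by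
  have hq : ∀ i, Measurable fun ω => (Doff ω i).query := fun i =>
    measurable_query.comp ((measurable_pi_apply i).comp hoff)
  have hh : ∀ i, Measurable fun ω => (history (Doff ω) (fun s => Don s ω) t i).query := fun i =>
    measurable_query.comp (measurable_history hoff hon i)
  have hl : ∀ i, Measurable fun ω => (history (Doff ω) (fun s => Don s ω) t i).label := fun i =>
    measurable_label.comp (measurable_history hoff hon i)
  refine (measurable_det (measurable_covMatrix hφm lam hq)).sqrt.mul
    (measurable_mixturePotential (fun k l => ?_) (measurable_noiseVec hφm θ hh hl))
  exact (measurable_covMatrix hφm lam hh k l).add (measurable_gramMatrix hφm hq k l)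

/-- The offline part of the noise potential has expectation at most one. -/
theorem lintegral_noisePotential_zero_le [IsProbabilityMeasure P]
    (hφm : Measurable (Function.uncurry φ)) {θ : EuclideanSpace ℝ (Fin d)} {lam : ℝ}
    (hlam : 0 < lam) {Doff : Ω → Fin n → Comparison X A} (Don : ℕ → Ω → Comparison X A)
    (hlm : Measurable fun ω i => (Doff ω i).label) {m : MeasurableSpace Ω} (hm : m ≤ mΩ)
    (hq : ∀ i, Measurable[m] fun ω => (Doff ω i).query)
    (hlabels : ∀ b : Fin n → Bool, P⟦{ω | ∀ i, (Doff ω i).label = b i} | m⟧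
      =ᵐ[P] fun ω => ∏ i, btProb (linReward φ θ) (Doff ω i).query (b i)) :
    ∫⁻ ω, ENNReal.ofReal (noisePotential φ θ lam Doff Don 0 ω) ∂P ≤ 1 := by
  set F : (Fin n → Bool) → Ω → ℝ := fun b ω => Real.sqrt (covMatrix φ lam (Doff ω)).det *
    mixturePotential (covMatrix φ lam (Doff ω) + gramMatrix φ fun i => (Doff ω i).query)
      (noiseVec φ θ (fun i => (Doff ω i).query) b) with hF
  have hFm : ∀ b, Measurable[m] fun ω => ENNReal.ofReal (F b ω) := fun b => by
    have hu := measurable_noiseVec hφm θ hq (b := fun _ => b) fun i => measurable_const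
    have hV : ∀ k l, Measurable[m] fun ω =>
        (covMatrix φ lam (Doff ω) + gramMatrix φ fun i => (Doff ω i).query) k l := fun k l =>
      (measurable_covMatrix hφm lam hq k l).add (measurable_gramMatrix hφm hq k l)
    exact ((measurable_det (measurable_covMatrix hφm lam hq)).sqrt.mul
      (measurable_mixturePotential hV hu)).ennreal_ofReal
  have h0 : ∀ ω, noisePotential φ θ lam Doff Don 0 ω = F (fun i => (Doff ω i).label) ω := by
    intro ω
    have h1 : covMatrix φ lam (history (Doff ω) (fun s => Don s ω) 0) =
        covMatrix φ lam (Doff ω) := by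
      rw [covMatrix_history]; simp [gramMatrix]
    simp only [noisePotential, hF, h1]
    congr 2
    simp [noiseVec, Fintype.sum_sum_type, history]
  have hset : ∀ b : Fin n → Bool, {ω | (fun i => (Doff ω i).label) = b} =
      {ω | ∀ i, (Doff ω i).label = b i} := fun b => by ext ω; simp [funext_iff]
  have key := lintegral_label_eq (P := P) hm (lab := fun ω i => (Doff ω i).label)
    (fun b => hlm (measurableSet_singleton b))
    (w := fun b ω => ∏ i, btProb (linReward φ θ) (Doff ω i).query (b i))
    (fun b => by rw [hset]; exact hlabels b) (F := fun b ω => ENNReal.ofReal (F b ω)) hFm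
  simp_rw [h0]
  rw [key]
  calc _ ≤ ∫⁻ _, 1 ∂P := by
        refine lintegral_mono fun ω => ?_
        have hC := posDef_covMatrix φ hlam (Doff ω)
        have hw0 : ∀ b : Fin n → Bool,
            0 ≤ ∏ i, btProb (linReward φ θ) (Doff ω i).query (b i) := fun b =>
          Finset.prod_nonneg fun i _ => by
            rw [btProb_linReward]
            exact labelWeight_nonneg (prefProb_nonneg _ _ _) (prefProb_le_one _ _ _) _
        simp_rw [← ENNReal.ofReal_mul (hw0 _)]
        rw [← ENNReal.ofReal_sum_of_nonneg fun b _ => mul_nonneg (hw0 b)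
          (mul_nonneg (Real.sqrt_nonneg _) (mixturePotential_nonneg _ _)), ENNReal.ofReal_le_one]
        -- The potential is started at `Σ_off` with zero noise, where it equals `1 / √(det Σ_off)`;
        -- the prefactor of `noisePotential` normalizes this to one.
        have h := sum_prod_labelWeight_mul_mixturePotential_le
          (fun i => diffFeature φ (Doff ω i).query) (fun i => prefProb φ θ (Doff ω i).query)
          (fun i => prefProb_nonneg _ _ _) (fun i => prefProb_le_one _ _ _) hC 0
        have hs := Real.sqrt_pos.2 hC.det_pos
        have hm0 : mixturePotential (covMatrix φ lam (Doff ω)) 0 =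
            (Real.sqrt (covMatrix φ lam (Doff ω)).det)⁻¹ := by simp [mixturePotential]
        rw [hm0] at h
        have h2 := mul_le_mul_of_nonneg_left h hs.le
        rw [mul_inv_cancel₀ hs.ne'] at h2
        refine le_trans (le_of_eq ?_) h2
        rw [Finset.mul_sum]
        refine Finset.sum_congr rfl fun b _ => ?_
        simp only [btProb_linReward, zero_add, gramMatrix, noiseVec]
        ring
    _ = 1 := by simp

/-- The noise potential is a supermartingale along the online rounds. -/
theorem lintegral_noisePotential_succ_le [IsProbabilityMeasure P]
    (hφm : Measurable (Function.uncurry φ)) {θ : EuclideanSpace ℝ (Fin d)} {lam : ℝ}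
    (hlam : 0 < lam) {Doff : Ω → Fin n → Comparison X A} {Don : ℕ → Ω → Comparison X A}
    {m : MeasurableSpace Ω} (hm : m ≤ mΩ) {t : ℕ} (hoff : Measurable[m] Doff)
    (hon : ∀ s < t, Measurable[m] (Don s)) (hont : Measurable[mΩ] (Don t))
    (hlabel : P⟦{ω | (Don t ω).label = true} |
        m ⊔ MeasurableSpace.comap (fun ω => (Don t ω).query) inferInstance⟧
      =ᵐ[P] fun ω => btProb (linReward φ θ) (Don t ω).query true) :
    ∫⁻ ω, ENNReal.ofReal (noisePotential φ θ lam Doff Don (t + 1) ω) ∂P ≤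
      ∫⁻ ω, ENNReal.ofReal (noisePotential φ θ lam Doff Don t ω) ∂P := by
  -- Once the current query is added to the past, only the label is random, and its feature
  -- difference and probability are known.
  set m' := m ⊔ MeasurableSpace.comap (fun ω => (Don t ω).query) inferInstance with hm'
  have hqm : Measurable[mΩ] fun ω => (Don t ω).query := measurable_query.comp hont
  have hlm : Measurable[mΩ] fun ω => (Don t ω).label := measurable_label.comp hont
  have hm'le : m' ≤ mΩ := sup_le hm hqm.comap_le
  have hmm' : m ≤ m' := le_sup_left
  have hqt : Measurable[m'] fun ω => (Don t ω).query :=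
    (comap_measurable fun ω => (Don t ω).query).mono le_sup_right le_rfl
  have hoff' : Measurable[m'] Doff := hoff.mono hmm' le_rfl
  have hon' : ∀ s < t, Measurable[m'] (Don s) := fun s hs => (hon s hs).mono hmm' le_rfl
  have hq : ∀ i, Measurable[m'] fun ω => (Doff ω i).query := fun i =>
    measurable_query.comp ((measurable_pi_apply i).comp hoff')
  have hh : ∀ i, Measurable[m'] fun ω => (history (Doff ω) (fun s => Don s ω) t i).query :=
    fun i => measurable_query.comp (measurable_history hoff' hon' i)
  have hl : ∀ i, Measurable[m'] fun ω => (history (Doff ω) (fun s => Don s ω) t i).label :=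
    fun i => measurable_label.comp (measurable_history hoff' hon' i)
  set V : Ω → Matrix (Fin d) (Fin d) ℝ := fun ω =>
    covMatrix φ lam (history (Doff ω) (fun s => Don s ω) t) +
      gramMatrix φ fun i => (Doff ω i).query with hV
  set S : Ω → Fin d → ℝ := fun ω =>
    noiseVec φ θ (fun i => (history (Doff ω) (fun s => Don s ω) t i).query)
      fun i => (history (Doff ω) (fun s => Don s ω) t i).label with hS
  set z : Ω → Fin d → ℝ := fun ω => diffFeature φ (Don t ω).query with hz
  set p : Ω → ℝ := fun ω => prefProb φ θ (Don t ω).query with hp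
  have hVpd : ∀ ω, (V ω).PosDef := fun ω =>
    (posDef_covMatrix φ hlam _).add_posSemidef (posSemidef_gramMatrix φ _)
  set F : Bool → Ω → ℝ := fun y ω => Real.sqrt (covMatrix φ lam (Doff ω)).det *
    mixturePotential (V ω + vecMulVec (z ω) (z ω)) (S ω + labelNoise (p ω) y • z ω) with hF
  have hzm : ∀ k, Measurable[m'] fun ω => z ω k := measurable_diffFeature_apply hφm hqt
  have hFm : ∀ y, Measurable[m'] fun ω => ENNReal.ofReal (F y ω) := fun y => by
    refine ((measurable_det (measurable_covMatrix hφm lam hq)).sqrt.mul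
      (measurable_mixturePotential (fun k l => ?_) fun k => ?_)).ennreal_ofReal
    · exact ((measurable_covMatrix hφm lam hh k l).add (measurable_gramMatrix hφm hq k l)).add
        ((hzm k).mul (hzm l))
    · exact (measurable_noiseVec hφm θ hh hl k).add
        ((measurable_labelNoise (measurable_prefProb hφm θ hqt) measurable_const).mul (hzm k))
  have h0 : ∀ ω, noisePotential φ θ lam Doff Don (t + 1) ω = F (Don t ω).label ω := by
    intro ω
    simp only [noisePotential, hF, noiseVec_history_succ, covMatrix_history_succ, hV, hS, hz, hp]
    rw [add_right_comm]
  have hEt : MeasurableSet[mΩ] {ω | (Don t ω).label = true} := hlm (measurableSet_singleton true)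
  have hw : ∀ y, P⟦{ω | (Don t ω).label = y}|m'⟧ =ᵐ[P] fun ω => labelWeight (p ω) y := by
    intro y
    cases y
    · have hc : {ω | (Don t ω).label = false} = {ω | (Don t ω).label = true}ᶜ := by
        ext ω; simp
      have hind : ({ω | (Don t ω).label = true}ᶜ).indicator (fun _ => (1 : ℝ)) =
          (fun _ => (1 : ℝ)) - {ω | (Don t ω).label = true}.indicator fun _ => (1 : ℝ) := by
        rw [Set.indicator_compl]
      rw [hc, hind]
      refine (condExp_sub (integrable_const (1 : ℝ)) ((integrable_const (1 : ℝ)).indicator hEt) m').trans ?_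
      filter_upwards [hlabel] with ω h
      rw [Pi.sub_apply, h, condExp_const hm'le, btProb_linReward]
      simp [labelWeight, hp]
    · filter_upwards [hlabel] with ω h
      rw [h, btProb_linReward]
  have key := lintegral_label_eq (P := P) hm'le (lab := fun ω => (Don t ω).label)
    (fun y => hlm (measurableSet_singleton y)) hw (F := fun y ω => ENNReal.ofReal (F y ω)) hFm
  simp_rw [h0]
  rw [key]
  refine lintegral_mono fun ω => ?_
  have hw0 : ∀ y, 0 ≤ labelWeight (p ω) y := fun y =>
    labelWeight_nonneg (prefProb_nonneg _ _ _) (prefProb_le_one _ _ _) y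
  simp_rw [← ENNReal.ofReal_mul (hw0 _)]
  rw [← ENNReal.ofReal_sum_of_nonneg fun b _ => mul_nonneg (hw0 b)
    (mul_nonneg (Real.sqrt_nonneg _) (mixturePotential_nonneg _ _))]
  refine ENNReal.ofReal_le_ofReal ?_
  have h := sum_labelWeight_mul_mixturePotential_le (hVpd ω) (S ω) (z ω)
    (prefProb_nonneg φ θ (Don t ω).query) (prefProb_le_one φ θ (Don t ω).query)
  refine le_trans (le_of_eq ?_) (mul_le_mul_of_nonneg_left h (Real.sqrt_nonneg
    (covMatrix φ lam (Doff ω)).det))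
  rw [Finset.mul_sum]
  refine Finset.sum_congr rfl fun y _ => ?_
  simp only [hp]
  ring

variable {d₀ : Measure X} {π₀ πref : Kernel X A} [IsMarkovKernel π₀] {B η : ℝ}
  {θstar : EuclideanSpace ℝ (Fin d)} {Doff : Ω → Fin n → Comparison X A} {T : ℕ}
  {ℱ : Filtration ℕ mΩ} {Don : ℕ → Ω → Comparison X A} {θhat : ℕ → Ω → EuclideanSpace ℝ (Fin d)}
  {πmain : ℕ → Ω → Kernel X A}

theorem lintegral_noisePotential_le [IsProbabilityMeasure P]
    (hφm : Measurable (Function.uncurry φ)) {lam : ℝ}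
    (hlam : 0 < lam) (hoff : IsOfflineData P (linReward φ θstar) Doff)
    (hrun : IsHybridRun P φ B η d₀ π₀ πref (linReward φ θstar) Doff T ℱ Don θhat πmain)
    {t : ℕ} (ht : t ≤ T) :
    ∫⁻ ω, ENNReal.ofReal (noisePotential φ θstar lam Doff Don t ω) ∂P ≤ 1 := by
  induction t with
  | zero =>
    have hqm : Measurable fun ω i => (Doff ω i).query := measurable_pi_lambda _ fun i =>
      measurable_query.comp ((measurable_pi_apply i).comp hoff.measurable)
    exact lintegral_noisePotential_zero_le hφm hlam Don
      (measurable_pi_lambda _ fun i =>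
        measurable_label.comp ((measurable_pi_apply i).comp hoff.measurable)) hqm.comap_le
      (fun i => (measurable_pi_apply i).comp (comap_measurable fun ω i => (Doff ω i).query))
      hoff.labels
  | succ t ih =>
    have htT : t < T := ht
    refine (lintegral_noisePotential_succ_le hφm hlam (ℱ.le t)
      (hrun.measurable_offline.mono (ℱ.mono (Nat.zero_le t)) le_rfl) (fun s hs => ?_)
      ((hrun.measurable_online t htT).mono (ℱ.le _) le_rfl) (hrun.label_law t htT)).trans
      (ih htT.le)
    exact (hrun.measurable_online s (hs.trans htT)).mono (ℱ.mono hs) le_rfl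

/-- With probability at least `1 - δ`, all noise potentials are below `T / δ`. -/
theorem measure_exists_noisePotential_ge_le [IsProbabilityMeasure P]
    (hφm : Measurable (Function.uncurry φ)) {lam : ℝ}
    (hlam : 0 < lam) (hoff : IsOfflineData P (linReward φ θstar) Doff)
    (hrun : IsHybridRun P φ B η d₀ π₀ πref (linReward φ θstar) Doff T ℱ Don θhat πmain)
    (hT : 0 < T) {δ : ℝ} (hδ : 0 < δ) :
    P {ω | ∃ t < T, T / δ ≤ noisePotential φ θstar lam Doff Don t ω} ≤ ENNReal.ofReal δ := by
  have hT' : (0 : ℝ) < T := by exact_mod_cast hT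
  -- Markov at level `T / δ` for each round and a union bound over the rounds suffice, at the price
  -- of a `log T` already present in `β`.
  have hone : ∀ t < T, P {ω | T / δ ≤ noisePotential φ θstar lam Doff Don t ω} ≤
      ENNReal.ofReal (δ / T) := by
    intro t ht
    have hmeas : Measurable fun ω =>
        ENNReal.ofReal (noisePotential φ θstar lam Doff Don t ω) :=
      (measurable_noisePotential hφm θstar lam
        (hrun.measurable_offline.mono (ℱ.le 0) le_rfl) fun s hs =>
        (hrun.measurable_online s (hs.trans ht)).mono (ℱ.le _) le_rfl).ennreal_ofReal
    have hmk := (mul_meas_ge_le_lintegral (μ := P) hmeas (ENNReal.ofReal (T / δ))).trans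
      (lintegral_noisePotential_le hφm hlam hoff hrun ht.le)
    have hsub : {ω | T / δ ≤ noisePotential φ θstar lam Doff Don t ω} ⊆
        {ω | ENNReal.ofReal (T / δ) ≤ ENNReal.ofReal (noisePotential φ θstar lam Doff Don t ω)} :=
      fun ω hω => ENNReal.ofReal_le_ofReal hω
    refine (measure_mono hsub).trans ?_
    have hpos : 0 < δ / T := by positivity
    rw [← inv_div, ENNReal.ofReal_inv_of_pos hpos] at hmk ⊢
    rwa [mul_comm, ← div_eq_mul_inv, ENNReal.div_le_iff (by simpa using hpos) (by simp),
      one_mul] at hmk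
  have hset : {ω | ∃ t < T, T / δ ≤ noisePotential φ θstar lam Doff Don t ω} =
      ⋃ t ∈ Finset.range T, {ω | T / δ ≤ noisePotential φ θstar lam Doff Don t ω} := by
    ext ω; simp
  rw [hset]
  refine (measure_biUnion_finset_le _ _).trans ((Finset.sum_le_sum fun t ht =>
    hone t (Finset.mem_range.1 ht)).trans (le_of_eq ?_))
  rw [Finset.sum_const, Finset.card_range, nsmul_eq_mul, ← ENNReal.ofReal_natCast,
    ← ENNReal.ofReal_mul hT'.le]
  congr 1
  field_simp

/-- The squared norm `‖φ(x, a¹) - φ(x, a²)‖²_{Σ⁻¹}` of a query, for the covariance matrix of the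
history of round `t`. -/
noncomputable def queryWidth (φ : X → A → EuclideanSpace ℝ (Fin d)) (lam : ℝ)
    (Doff : Ω → Fin n → Comparison X A) (Don : ℕ → Ω → Comparison X A) (t : ℕ) (ω : Ω)
    (q : X × A × A) : ℝ :=
  diffFeature φ q ⬝ᵥ (covMatrix φ lam (history (Doff ω) (fun s => Don s ω) t))⁻¹ *ᵥ diffFeature φ q

/-- The width depends on the past through a matrix and on the current query. Expanding the quadratic
form in coordinates separates them into bounded `ℱ t`-measurable entries times fixed functions of
the query, to which the query law applies. -/
theorem condExp_queryWidth [IsProbabilityMeasure P] [IsProbabilityMeasure d₀] [IsMarkovKernel πref]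
    (hφm : Measurable (Function.uncurry φ)) (hφ : ∀ x a, ‖φ x a‖ ≤ 1) {lam : ℝ}
    (hlam : 0 < lam) (hη : 0 < η)
    (hrun : IsHybridRun P φ B η d₀ π₀ πref (linReward φ θstar) Doff T ℱ Don θhat πmain)
    {t : ℕ} (ht : t < T) :
    P[fun ω => queryWidth φ lam Doff Don t ω (Don t ω).query|ℱ t] =ᵐ[P]
      fun ω => ∫ q, queryWidth φ lam Doff Don t ω q ∂(d₀ ⊗ₘ (πmain t ω ×ₖ πref)) := by
  have hk : ∀ ω, IsMarkovKernel (πmain t ω) := fun ω =>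
    (hrun.main_agent t ht ω).isMarkovKernel hφm hφ hη
  have hont := (hrun.measurable_online t ht).mono (ℱ.le _) le_rfl
  have hqm : Measurable fun ω => (Don t ω).query := measurable_query.comp hont
  have hh : ∀ i, Measurable[ℱ t] fun ω => (history (Doff ω) (fun s => Don s ω) t i).query :=
    fun i => measurable_query.comp (measurable_history
      (hrun.measurable_offline.mono (ℱ.mono (Nat.zero_le t)) le_rfl)
      (fun s hs => (hrun.measurable_online s (hs.trans ht)).mono (ℱ.mono hs) le_rfl) i)
  set W : Fin d → Fin d → Ω → ℝ := fun k l ω =>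
    (covMatrix φ lam (history (Doff ω) (fun s => Don s ω) t))⁻¹ k l with hW
  have hWm : ∀ k l, Measurable[ℱ t] (W k l) :=
    measurable_inv_apply (measurable_covMatrix hφm lam hh)
  have hWb : ∀ k l ω, |W k l ω| ≤ 1 / lam := fun k l ω => abs_inv_covMatrix_apply_le φ hlam _ k l
  set f : Fin d → Fin d → X × A × A → ℝ := fun k l q => diffFeature φ q k * diffFeature φ q l
    with hf
  have hfm : ∀ k l, Measurable (f k l) := fun k l =>
    (measurable_diffFeature_apply hφm measurable_id k).mul
      (measurable_diffFeature_apply hφm measurable_id l)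
  have hfb : ∀ k l q, |f k l q| ≤ 4 := fun k l q => by
    rw [hf, abs_mul]
    nlinarith [diffFeature_apply_abs_le hφ q k, diffFeature_apply_abs_le hφ q l,
      abs_nonneg (diffFeature φ q k), abs_nonneg (diffFeature φ q l)]
  have hexpand : ∀ ω q, queryWidth φ lam Doff Don t ω q = ∑ k, ∑ l, W k l ω * f k l q := by
    intro ω q
    simp only [queryWidth, dotProduct, mulVec, Finset.mul_sum, hW, hf]
    exact Finset.sum_congr rfl fun k _ => Finset.sum_congr rfl fun l _ => by ring
  have hfi : ∀ k l, Integrable (fun ω => f k l (Don t ω).query) P := fun k l =>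
    Integrable.of_bound ((hfm k l).comp hqm).aestronglyMeasurable 4 (ae_of_all _ fun ω => hfb k l _)
  have hWfi : ∀ k l, Integrable (fun ω => W k l ω * f k l (Don t ω).query) P := fun k l =>
    (hfi k l).bdd_mul ((hWm k l).mono (ℱ.le t) le_rfl).aestronglyMeasurable
      (ae_of_all _ fun ω => hWb k l ω)
  have hterm : ∀ k l, P[fun ω => W k l ω * f k l (Don t ω).query|ℱ t] =ᵐ[P]
      fun ω => W k l ω * ∫ q, f k l q ∂(d₀ ⊗ₘ (πmain t ω ×ₖ πref)) := by
    intro k l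
    have h1 := condExp_stronglyMeasurable_mul_of_bound (μ := P) (ℱ.le t) (hWm k l).stronglyMeasurable
      (hfi k l) (1 / lam) (ae_of_all _ fun ω => hWb k l ω)
    refine h1.trans ?_
    filter_upwards [condExp_comp_ae_eq_integral (P := P) (ℱ.le t) hqm
      (ν := fun ω => d₀ ⊗ₘ (πmain t ω ×ₖ πref)) (hrun.query_law t ht) (hfm k l) (hfb k l)] with ω h
    rw [Pi.mul_apply, h]
  have hsum : (fun ω => queryWidth φ lam Doff Don t ω (Don t ω).query) =
      ∑ k, ∑ l, fun ω => W k l ω * f k l (Don t ω).query := by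
    ext ω; rw [hexpand]; simp
  rw [hsum]
  have e1 := condExp_finsetSum (μ := P) (s := Finset.univ)
    (f := fun k => ∑ l, fun ω => W k l ω * f k l (Don t ω).query)
    (fun k _ => integrable_finsetSum' _ fun l _ => hWfi k l) (ℱ t)
  have e2 : ∀ k, P[∑ l, fun ω => W k l ω * f k l (Don t ω).query|ℱ t] =ᵐ[P]
      ∑ l, P[fun ω => W k l ω * f k l (Don t ω).query|ℱ t] := fun k =>
    condExp_finsetSum (fun l _ => hWfi k l) (ℱ t)
  refine e1.trans ?_
  filter_upwards [ae_all_iff.2 e2, ae_all_iff.2 fun k => ae_all_iff.2 fun l => hterm k l]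
    with ω h2 h3
  simp only [Finset.sum_apply, h2, h3, hexpand]
  have hint : ∀ k l, Integrable (fun q => W k l ω * f k l q) (d₀ ⊗ₘ (πmain t ω ×ₖ πref)) :=
    fun k l => (Integrable.of_bound (hfm k l).aestronglyMeasurable 4
      (ae_of_all _ fun q => hfb k l q)).const_mul _
  rw [integral_finsetSum _ fun k _ => integrable_finsetSum _ fun l _ => hint k l]
  refine Finset.sum_congr rfl fun k _ => ?_
  rw [integral_finsetSum _ fun l _ => hint k l]
  exact Finset.sum_congr rfl fun l _ => (integral_const_mul _ _).symm

end Run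

end RLHF

/-! ### Deterministic regret bounds on the confidence event. -/

namespace RLHF

open Matrix Filter
open scoped ENNReal Topology

theorem inner_eq_dotProduct {d : ℕ} (u v : EuclideanSpace ℝ (Fin d)) :
    inner ℝ u v = u.ofLp ⬝ᵥ v.ofLp := by
  rw [EuclideanSpace.inner_eq_star_dotProduct, star_trivial, dotProduct_comm]

/-- The estimation error along the direction covered by the offline data. -/
theorem neg_inner_le_matNorm {X A : Type*} {d n : ℕ}
    {φ : X → A → EuclideanSpace ℝ (Fin d)} {lam N : ℝ} (hlam : 0 < lam) (D : Fin n → Comparison X A)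
    (u v : EuclideanSpace ℝ (Fin d)) (hN : u.ofLp ⬝ᵥ covMatrix φ lam D *ᵥ u.ofLp ≤ N) :
    -inner ℝ u v ≤ Real.sqrt N * matNorm (covMatrix φ lam D)⁻¹ v := by
  have hC := posDef_covMatrix φ hlam D
  have h := hC.sq_dotProduct_le u.ofLp v.ofLp
  have hv : 0 ≤ v.ofLp ⬝ᵥ (covMatrix φ lam D)⁻¹ *ᵥ v.ofLp := by
    simpa using hC.inv.posSemidef.dotProduct_mulVec_nonneg v.ofLp
  have hN0 : 0 ≤ N := le_trans (by simpa using hC.posSemidef.dotProduct_mulVec_nonneg u.ofLp) hN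
  rw [matNorm, ← Real.sqrt_mul hN0]
  apply Real.le_sqrt_of_sq_le
  rw [neg_sq, inner_eq_dotProduct]
  exact h.trans (mul_le_mul_of_nonneg_right hN hv)

/-- Since `exp B + exp (-B) ≥ 2 + B² / 2`, the curvature decays fast enough to keep `γ B` bounded.
This makes `λ ≥ 8 d log (T / δ)`, hence large enough for the elliptical lemma and for the deviation
term. -/
theorem sq_mul_sq_le_of_eq {B γ : ℝ} (hB : 0 < B)
    (hγ : γ = 1 / (2 + Real.exp (-B) + Real.exp B)) : γ ^ 2 * B ^ 2 ≤ 1 / 8 := by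
  have h1 := Real.quadratic_le_exp_of_nonneg hB.le
  have h2 := Real.add_one_le_exp (-B)
  have h3 : 4 + B ^ 2 / 2 ≤ 2 + Real.exp (-B) + Real.exp B := by linarith
  have h4 : γ ≤ 1 / (4 + B ^ 2 / 2) := by
    rw [hγ]; exact one_div_le_one_div_of_le (by positivity) h3
  have h5 : 0 ≤ γ := by rw [hγ]; positivity
  calc γ ^ 2 * B ^ 2 ≤ (1 / (4 + B ^ 2 / 2)) ^ 2 * B ^ 2 := by gcongr
    _ ≤ 1 / 8 := by
      rw [div_pow, one_pow, one_div_mul_eq_div, div_le_div_iff₀ (by positivity) (by norm_num)]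
      nlinarith [sq_nonneg (B ^ 2 / 2 - 4)]

section Final

variable {X A : Type*} [MeasurableSpace X] [MeasurableSpace A] {d n : ℕ}
  {φ : X → A → EuclideanSpace ℝ (Fin d)}

theorem integral_diffFeature (hφm : Measurable (Function.uncurry φ)) (hφ : ∀ x a, ‖φ x a‖ ≤ 1)
    (d₀ : Measure X) [IsProbabilityMeasure d₀] (π πref : Kernel X A) [IsMarkovKernel π]
    [IsMarkovKernel πref] :
    ∫ q, (φ q.1 q.2.1 - φ q.1 q.2.2) ∂(d₀ ⊗ₘ (π ×ₖ πref)) =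
      ∫ x, (feature φ π x - feature φ πref x) ∂d₀ := by
  have h1 : Measurable fun q : X × A × A => φ q.1 q.2.1 :=
    hφm.comp (measurable_fst.prodMk measurable_snd.fst)
  have h2 : Measurable fun q : X × A × A => φ q.1 q.2.2 :=
    hφm.comp (measurable_fst.prodMk measurable_snd.snd)
  have hi : Integrable (fun q : X × A × A => φ q.1 q.2.1 - φ q.1 q.2.2) (d₀ ⊗ₘ (π ×ₖ πref)) :=
    Integrable.of_bound (h1.sub h2).aestronglyMeasurable 2 (ae_of_all _ fun q =>
      (norm_sub_le _ _).trans (by linarith [hφ q.1 q.2.1, hφ q.1 q.2.2]))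
  rw [Measure.integral_compProd hi]
  refine integral_congr_ae (ae_of_all _ fun x => ?_)
  have hm : Measurable (φ x) := hφm.comp measurable_prodMk_left
  have i1 : Integrable (fun p : A × A => φ x p.1) ((π x).prod (πref x)) :=
    Integrable.of_bound (hm.comp measurable_fst).aestronglyMeasurable 1
      (ae_of_all _ fun p => hφ x p.1)
  have i2 : Integrable (fun p : A × A => φ x p.2) ((π x).prod (πref x)) :=
    Integrable.of_bound (hm.comp measurable_snd).aestronglyMeasurable 1
      (ae_of_all _ fun p => hφ x p.2)
  simp only [Kernel.prod_apply]
  rw [integral_sub i1 i2, integral_fun_fst, integral_fun_snd]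
  simp [feature]

/-- The estimation error along the queries of a round, by the expected width of the queries. -/
theorem inner_integral_feature_le {ι : Type*} [Fintype ι] (hφm : Measurable (Function.uncurry φ))
    (hφ : ∀ x a, ‖φ x a‖ ≤ 1) (d₀ : Measure X) [IsProbabilityMeasure d₀] (π πref : Kernel X A)
    [IsMarkovKernel π] [IsMarkovKernel πref] {lam N c : ℝ} (hlam : 0 < lam) (hc : 0 < c)
    (D : ι → Comparison X A) (u : EuclideanSpace ℝ (Fin d))
    (hN : u.ofLp ⬝ᵥ covMatrix φ lam D *ᵥ u.ofLp ≤ N) :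
    2 * inner ℝ u (∫ x, (feature φ π x - feature φ πref x) ∂d₀) ≤ c * N +
      (∫ q, diffFeature φ q ⬝ᵥ (covMatrix φ lam D)⁻¹ *ᵥ diffFeature φ q
        ∂(d₀ ⊗ₘ (π ×ₖ πref))) / c := by
  have h1 : Measurable fun q : X × A × A => φ q.1 q.2.1 :=
    hφm.comp (measurable_fst.prodMk measurable_snd.fst)
  have h2 : Measurable fun q : X × A × A => φ q.1 q.2.2 :=
    hφm.comp (measurable_fst.prodMk measurable_snd.snd)
  have hi : Integrable (fun q : X × A × A => φ q.1 q.2.1 - φ q.1 q.2.2) (d₀ ⊗ₘ (π ×ₖ πref)) :=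
    Integrable.of_bound (h1.sub h2).aestronglyMeasurable 2 (ae_of_all _ fun q =>
      (norm_sub_le _ _).trans (by linarith [hφ q.1 q.2.1, hφ q.1 q.2.2]))
  have hwi : Integrable (fun q => diffFeature φ q ⬝ᵥ (covMatrix φ lam D)⁻¹ *ᵥ diffFeature φ q)
      (d₀ ⊗ₘ (π ×ₖ πref)) := by
    have hwm : Measurable fun q : X × A × A =>
        diffFeature φ q ⬝ᵥ (covMatrix φ lam D)⁻¹ *ᵥ diffFeature φ q :=
      measurable_dotProduct_mulVec (M := fun _ => (covMatrix φ lam D)⁻¹) (u := diffFeature φ)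
        (fun _ _ => measurable_const) fun k => measurable_diffFeature_apply hφm measurable_id k
    refine Integrable.of_bound hwm.aestronglyMeasurable (4 / lam) (ae_of_all _ fun q => ?_)
    rw [Real.norm_eq_abs, abs_of_nonneg (diffFeature_inv_covMatrix_nonneg φ hlam D q)]
    exact diffFeature_inv_covMatrix_le hφ hlam D q
  have hC := posDef_covMatrix φ hlam D
  have hN0 : 0 ≤ N := le_trans (by simpa using hC.posSemidef.dotProduct_mulVec_nonneg u.ofLp) hN
  rw [← integral_diffFeature hφm hφ, ← integral_inner hi, ← integral_const_mul, ← integral_div]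
  have hconst : c * N = ∫ _, c * N ∂(d₀ ⊗ₘ (π ×ₖ πref)) := by simp
  rw [hconst, ← integral_add (integrable_const _) (hwi.div_const c)]
  refine integral_mono ((hi.const_inner u).const_mul 2)
    ((integrable_const _).add (hwi.div_const c)) fun q => ?_
  change 2 * inner ℝ u (φ q.1 q.2.1 - φ q.1 q.2.2) ≤ c * N +
    (diffFeature φ q ⬝ᵥ (covMatrix φ lam D)⁻¹ *ᵥ diffFeature φ q) / c
  rw [inner_eq_dotProduct]
  change 2 * (u.ofLp ⬝ᵥ diffFeature φ q) ≤ _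
  have hcs := hC.sq_dotProduct_le u.ofLp (diffFeature φ q)
  have hw0 := diffFeature_inv_covMatrix_nonneg φ hlam D q
  set w := diffFeature φ q ⬝ᵥ (covMatrix φ lam D)⁻¹ *ᵥ diffFeature φ q
  have hcs' : (u.ofLp ⬝ᵥ diffFeature φ q) ^ 2 ≤ N * w :=
    hcs.trans (mul_le_mul_of_nonneg_right hN hw0)
  have h0 : 0 ≤ c * N + w / c := by positivity
  refine (abs_le_of_sq_le_sq' ?_ h0).2
  -- Young's inequality with weight `c`: a pointwise square root of the width becomes a term linear
  -- in it, ready to be averaged over queries and summed over rounds.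
  have e : (c * N + w / c) ^ 2 = (c * N - w / c) ^ 2 + 4 * (N * w) := by field_simp; ring
  rw [e]
  nlinarith [sq_nonneg (c * N - w / c)]

variable {d₀ : Measure X} [IsProbabilityMeasure d₀] {π₀ πref πstar : Kernel X A}
  [IsMarkovKernel π₀] [IsMarkovKernel πref] {B η : ℝ} {θstar : EuclideanSpace ℝ (Fin d)} {T : ℕ}
  {θ : ℕ → EuclideanSpace ℝ (Fin d)} {π : ℕ → Kernel X A}

/-- Summing the regret decomposition over the rounds. -/
theorem sum_regret_add_kl_le (hφm : Measurable (Function.uncurry φ)) (hφ : ∀ x a, ‖φ x a‖ ≤ 1)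
    (hη : 0 < η) (hstar : ‖θstar‖ ≤ B)
    (hs : IsOptimal d₀ π₀ η B φ (linReward φ θstar) πstar)
    (hθ : ∀ t < T, ‖θ t‖ ≤ B)
    (hopt : ∀ t < T, IsOptimal d₀ π₀ η B φ (linReward φ (θ t)) (π t)) {R : ℝ}
    (hR : ∑ t ∈ Finset.range T,
      2 * inner ℝ (θ t - θstar) (∫ x, (feature φ (π t) x - feature φ πstar x) ∂d₀) ≤ R) :
    ∑ t ∈ Finset.range T, (value d₀ π₀ η (linReward φ θstar) πstar -
        value d₀ π₀ η (linReward φ θstar) (π t)) ≤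
      R - η * ∑ t ∈ Finset.range T, ∫ x, klReal (π t x) (πstar x) ∂d₀ := by
  rw [le_sub_iff_add_le, Finset.mul_sum, ← Finset.sum_add_distrib]
  refine (Finset.sum_le_sum fun t ht => ?_).trans hR
  have htT := Finset.mem_range.1 ht
  exact regret_add_kl_le hφm hφ hη (hθ t htT) hstar (hopt t htT) hs

/-- Only the radius of the parameter set and the boundedness of features enter; this serves the
regime of few samples. -/
theorem inner_integral_feature_sub_le (hφm : Measurable (Function.uncurry φ))
    (hφ : ∀ x a, ‖φ x a‖ ≤ 1) (hη : 0 < η) (hstar : ‖θstar‖ ≤ B) {ϑ : EuclideanSpace ℝ (Fin d)}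
    {κ : Kernel X A} (hs : IsOptimal d₀ π₀ η B φ (linReward φ θstar) πstar)
    (hϑ : ‖ϑ‖ ≤ B) (hopt : IsOptimal d₀ π₀ η B φ (linReward φ ϑ) κ) :
    2 * inner ℝ (ϑ - θstar) (∫ x, (feature φ κ x - feature φ πstar x) ∂d₀) ≤ 8 * B := by
  have := hs.isMarkovKernel hφm hφ hη
  have := hopt.isMarkovKernel hφm hφ hη
  have h1 : ‖∫ x, (feature φ κ x - feature φ πstar x) ∂d₀‖ ≤ 2 := by
    refine (norm_integral_le_of_norm_le_const (C := 2) (ae_of_all _ fun x =>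
      (norm_sub_le _ _).trans ?_)).trans (by simp)
    linarith [norm_feature_le hφ κ x, norm_feature_le hφ πstar x]
  have h2 : ‖ϑ - θstar‖ ≤ 2 * B := (norm_sub_le _ _).trans (by linarith)
  have h3 := real_inner_le_norm (ϑ - θstar) (∫ x, (feature φ κ x - feature φ πstar x) ∂d₀)
  have h4 := mul_le_mul h2 h1 (norm_nonneg _) ((norm_nonneg _).trans h2)
  linarith

/-- The regret bound on the event where the confidence sets and the compensator bound hold. -/
theorem sum_inner_le_of_confidence (hφm : Measurable (Function.uncurry φ))
    (hφ : ∀ x a, ‖φ x a‖ ≤ 1) (hη : 0 < η)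
    (hs : IsOptimal d₀ π₀ η B φ (linReward φ θstar) πstar)
    (hopt : ∀ t < T, IsOptimal d₀ π₀ η B φ (linReward φ (θ t)) (π t))
    {lam N K α Ccov : ℝ} (hlam : 0 < lam) (hT : 0 < T) (hN0 : 0 < N) (hK : 0 < K)
    (D : Fin n → Comparison X A) (D' : ℕ → Comparison X A)
    (hN : ∀ t < T, (θ t - θstar).ofLp ⬝ᵥ covMatrix φ lam (history D D' t) *ᵥ (θ t - θstar).ofLp ≤ N)
    (hw : ∑ t ∈ Finset.range T, ∫ q, diffFeature φ q ⬝ᵥ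
      (covMatrix φ lam (history D D' t))⁻¹ *ᵥ diffFeature φ q ∂(d₀ ⊗ₘ (π t ×ₖ πref)) ≤ K)
    (hcov : PartialCoverage d₀ φ πstar πref lam T D α Ccov) :
    ∑ t ∈ Finset.range T,
        2 * inner ℝ (θ t - θstar) (∫ x, (feature φ (π t) x - feature φ πstar x) ∂d₀) ≤
      2 * Real.sqrt N * ((T : ℝ) ^ α * Ccov) + 2 * Real.sqrt (K * T * N) := by
  have hT' : (0 : ℝ) < T := by exact_mod_cast hT
  have hks := hs.isMarkovKernel hφm hφ hη
  obtain ⟨-, -, -, hcov⟩ := hcov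
  set v := ∫ x, (feature φ πstar x - feature φ πref x) ∂d₀ with hv
  -- This weight balances the two Young terms: `T c N` and `K / c` both equal `√(K T N)`.
  set c := Real.sqrt (K / (T * N)) with hc
  have hc0 : 0 < c := Real.sqrt_pos.2 (by positivity)
  have hround : ∀ t ∈ Finset.range T,
      2 * inner ℝ (θ t - θstar) (∫ x, (feature φ (π t) x - feature φ πstar x) ∂d₀) ≤
        c * N + (∫ q, diffFeature φ q ⬝ᵥ (covMatrix φ lam (history D D' t))⁻¹ *ᵥ diffFeature φ q
          ∂(d₀ ⊗ₘ (π t ×ₖ πref))) / c +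
        2 * (Real.sqrt N * matNorm (covMatrix φ lam D)⁻¹ v) := by
    intro t ht
    have htT := Finset.mem_range.1 ht
    have hkt := (hopt t htT).isMarkovKernel hφm hφ hη
    have hsplit : ∫ x, (feature φ (π t) x - feature φ πstar x) ∂d₀ =
        ∫ x, (feature φ (π t) x - feature φ πref x) ∂d₀ - v := by
      have i1 := integrable_feature hφm hφ (π t) d₀
      have i2 := integrable_feature hφm hφ πstar d₀
      have i3 := integrable_feature hφm hφ πref d₀
      rw [hv, integral_sub i1 i2, integral_sub i1 i3, integral_sub i2 i3]
      abel
    rw [hsplit, inner_sub_right, mul_sub]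
    have h1 := inner_integral_feature_le hφm hφ d₀ (π t) πref hlam hc0 _ _ (hN t htT)
    -- Online data only enlarge the covariance, so the error is also controlled in the norm of
    -- `Σ_off`, where coverage is stated.
    have hNoff : (θ t - θstar).ofLp ⬝ᵥ covMatrix φ lam D *ᵥ (θ t - θstar).ofLp ≤ N := by
      refine le_trans ?_ (hN t htT)
      rw [covMatrix_history, add_mulVec, dotProduct_add, dotProduct_gramMatrix_mulVec]
      have : 0 ≤ ∑ s : Fin t, ((θ t - θstar).ofLp ⬝ᵥ diffFeature φ (D' s).query) ^ 2 :=
        Finset.sum_nonneg fun _ _ => sq_nonneg _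
      linarith
    have h2 := neg_inner_le_matNorm hlam D (θ t - θstar) v hNoff
    linarith
  refine (Finset.sum_le_sum hround).trans ?_
  rw [Finset.sum_add_distrib, Finset.sum_add_distrib, ← Finset.sum_div]
  simp only [Finset.sum_const, Finset.card_range, nsmul_eq_mul]
  have hcov' : (T : ℝ) * matNorm (covMatrix φ lam D)⁻¹ v ≤ (T : ℝ) ^ α * Ccov := by
    have hpow : (T : ℝ) = (T : ℝ) ^ α * (T : ℝ) ^ (1 - α) := by
      rw [← Real.rpow_add hT']; simp
    calc (T : ℝ) * matNorm (covMatrix φ lam D)⁻¹ v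
        = (T : ℝ) ^ α * ((T : ℝ) ^ (1 - α) * matNorm (covMatrix φ lam D)⁻¹ v) := by
          rw [← mul_assoc, ← hpow]
      _ ≤ _ := mul_le_mul_of_nonneg_left hcov (by positivity)
  have e1 : (T : ℝ) * (c * N) = Real.sqrt (K * T * N) := by
    rw [hc, show K * T * N = K / (T * N) * (T * N) ^ 2 by field_simp,
      Real.sqrt_mul (by positivity), Real.sqrt_sq (by positivity)]
    ring
  have e2 : K / c = Real.sqrt (K * T * N) := by
    rw [div_eq_iff hc0.ne', hc, ← Real.sqrt_mul (by positivity),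
      show K * T * N * (K / (T * N)) = K ^ 2 by field_simp, Real.sqrt_sq hK.le]
  have e3 := div_le_div_of_nonneg_right hw hc0.le
  have e4 := mul_le_mul_of_nonneg_left hcov' (show 0 ≤ 2 * Real.sqrt N by positivity)
  nlinarith

end Final

end RLHF

/-! ### Assembling the high-probability bound. -/

namespace RLHF

open Matrix Filter
open scoped ENNReal Topology

/-- In the regime of few samples, the trivial regret bound suffices. -/
theorem trivial_regret_le {T d : ℕ} {B γ L lam : ℝ} (hd : 0 < d) (hB : 0 < B) (hγ : 0 < γ)
    (hL : 0 < L) (hlam : lam = d * L / (γ ^ 2 * B ^ 2)) (hx : (T : ℝ) / (d * lam) ≤ 1) :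
    T * (8 * B) ≤ 100 * Real.sqrt (d * L / γ ^ 2) *
      Real.sqrt (6 * T * d * Real.log (1 + T / (d * lam))) := by
  have hd' : (0 : ℝ) < d := by exact_mod_cast hd
  have hlam0 : 0 < lam := by rw [hlam]; positivity
  have hx0 : 0 ≤ (T : ℝ) / (d * lam) := by positivity
  have hlog : (T : ℝ) / (d * lam) / 2 ≤ Real.log (1 + T / (d * lam)) := by
    set x := (T : ℝ) / (d * lam)
    have h1 := Real.one_sub_inv_le_log_of_pos (show 0 < 1 + x by linarith)
    have h3 : 1 - (1 + x)⁻¹ = x / (1 + x) := by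
      have : 1 + x ≠ 0 := by linarith
      field_simp; ring
    rw [h3] at h1
    exact (div_le_div_of_nonneg_left hx0 (by linarith) (by linarith)).trans h1
  rw [mul_assoc, ← Real.sqrt_mul (by positivity)]
  -- For `x = T / (dλ) ≤ 1`, `log (1 + x) ≥ x / 2`; the choice of `λ` cancels `d`, `γ` and the
  -- logarithm, leaving `3 (T B)²`.
  have hsq : (T * B) ^ 2 ≤ d * L / γ ^ 2 * (6 * T * d * Real.log (1 + T / (d * lam))) := by
    calc (T * B) ^ 2 ≤ 3 * (T * B) ^ 2 := by nlinarith [sq_nonneg (T * B)]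
      _ = d * L / γ ^ 2 * (6 * T * d * (T / (d * lam) / 2)) := by
          rw [hlam]; field_simp; ring
      _ ≤ _ := by gcongr
  have h := Real.le_sqrt_of_sq_le hsq
  have h0 : (0 : ℝ) ≤ T * B := by positivity
  nlinarith

set_option maxHeartbeats 1000000 in
/-- The high-probability regret bound in the nontrivial range `δ < 1 / 2`. -/
theorem measure_regret_gt_le {X A Ω : Type*} [MeasurableSpace X] [MeasurableSpace A]
    [mΩ : MeasurableSpace Ω] (P : Measure Ω) [IsProbabilityMeasure P] (d : ℕ) (hd : 0 < d)
    (φ : X → A → EuclideanSpace ℝ (Fin d)) (hφm : Measurable (Function.uncurry φ))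
    (hφ : ∀ x a, ‖φ x a‖ ≤ 1)
    (B : ℝ) (hB : 0 < B) (γ : ℝ) (hγ : γ = 1 / (2 + Real.exp (-B) + Real.exp B))
    (θstar : EuclideanSpace ℝ (Fin d)) (hstar : ‖θstar‖ ≤ B)
    (hr : ∀ x a, linReward φ θstar x a ∈ Set.Icc (0 : ℝ) 1)
    (d₀ : Measure X) [IsProbabilityMeasure d₀]
    (π₀ πref : Kernel X A) [IsMarkovKernel π₀] [IsMarkovKernel πref]
    (η : ℝ) (hη : 0 < η) (πstar : Kernel X A)
    (hs : IsOptimal d₀ π₀ η B φ (linReward φ θstar) πstar)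
    (T : ℕ) (hT : 0 < T) (δ : ℝ) (hδ : 0 < δ) (hδ2 : δ < 1 / 2)
    (lam : ℝ) (hlam : lam = d * Real.log (T / δ) / (γ ^ 2 * B ^ 2))
    (n : ℕ) (Doff : Ω → Fin n → Comparison X A)
    (hoff : IsOfflineData P (linReward φ θstar) Doff)
    (α Ccov : (Fin n → Comparison X A) → ℝ)
    (hcov : ∀ᵐ ω ∂P, PartialCoverage d₀ φ πstar πref lam T (Doff ω) (α (Doff ω)) (Ccov (Doff ω)))
    (ℱ : Filtration ℕ mΩ) (Don : ℕ → Ω → Comparison X A)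
    (θhat : ℕ → Ω → EuclideanSpace ℝ (Fin d)) (πmain : ℕ → Ω → Kernel X A)
    (hrun : IsHybridRun P φ B η d₀ π₀ πref (linReward φ θstar) Doff T ℱ Don θhat πmain) :
    P {ω | ¬ (∑ t ∈ Finset.range T, (value d₀ π₀ η (linReward φ θstar) πstar -
            value d₀ π₀ η (linReward φ θstar) (πmain t ω))
        ≤ 100 * Real.sqrt (d * Real.log (T / δ) / γ ^ 2) * (T : ℝ) ^ (α (Doff ω)) * Ccov (Doff ω)
          + 100 * Real.sqrt (d * Real.log (T / δ) / γ ^ 2) *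
            Real.sqrt (6 * T * d * Real.log (1 + T / (d * lam)))
          - η * ∑ t ∈ Finset.range T, ∫ x, klReal (πmain t ω x) (πstar x) ∂d₀)}
      ≤ ENNReal.ofReal (2 * δ) := by
  have hd' : (1 : ℝ) ≤ d := by exact_mod_cast hd
  have hT' : (1 : ℝ) ≤ T := by exact_mod_cast hT
  have hγ0 : 0 < γ := by rw [hγ]; positivity
  -- Here `δ < 1/2` enters: it bounds `log (T / δ)` below by `log 2`, and `T / δ ≥ 2 T` is the lower
  -- bound needed for the determinant estimate.
  have hTδ : 2 * (T : ℝ) ≤ T / δ := by rw [le_div_iff₀ hδ]; nlinarith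
  have hδ1 : 1 / δ ≤ T / δ := by gcongr
  set L := Real.log (T / δ) with hLdef
  have hL1 : Real.log 2 ≤ L := Real.log_le_log (by norm_num) (by linarith)
  have hL2 : Real.log (1 / δ) ≤ L := Real.log_le_log (by positivity) hδ1
  have hL0 : 0 < L := (Real.log_pos (by norm_num)).trans_le hL1
  have hγB := sq_mul_sq_le_of_eq hB hγ
  have hlam8 : 8 * (d * L) ≤ lam := by
    rw [hlam, le_div_iff₀ (by positivity)]
    have : 0 ≤ (d : ℝ) * L := by positivity
    nlinarith
  have hlam4 : 4 ≤ lam := by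
    have := Real.log_two_gt_d9
    nlinarith
  have hlam0 : 0 < lam := by linarith
  set Q := Real.sqrt (d * L / γ ^ 2) with hQ
  have hQ2 : Q ^ 2 = d * L / γ ^ 2 := Real.sq_sqrt (by positivity)
  have hQ0 : 0 < Q := Real.sqrt_pos.2 (by positivity)
  have hmle : ∀ ω, ∀ t < T, ‖θhat t ω‖ ≤ B := fun ω t ht => (hrun.mle t ht ω).1
  set bad : Set Ω := {ω | ∃ t < T, T / δ ≤ noisePotential φ θstar lam Doff Don t ω} with hbad
  -- Squared widths are at most `4 / λ`, so this scaling puts them in `[0, 1]`.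
  set W : ℕ → Ω → ℝ := fun t ω => lam / 4 * queryWidth φ lam Doff Don t ω (Don t ω).query with hW
  set bad' : Set Ω := {ω | Real.log (1 / δ) <
    ∑ t ∈ Finset.range T, ((P[W t|ℱ t]) ω / 2 - W t ω)} with hbad'
  have hPbad : P bad ≤ ENNReal.ofReal δ :=
    measure_exists_noisePotential_ge_le hφm hlam0 hoff hrun hT hδ
  have hPbad' : P bad' ≤ ENNReal.ofReal δ := by
    refine measure_compensator_gt_le ℱ (fun t ht => ?_) (fun t ω => ?_) (fun t ω => ?_) hδ
    · have hoffm : Measurable[ℱ (t + 1)] Doff :=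
        hrun.measurable_offline.mono (ℱ.mono (Nat.zero_le _)) le_rfl
      have honm : ∀ s < t + 1, Measurable[ℱ (t + 1)] (Don s) := fun s hs =>
        (hrun.measurable_online s (by omega)).mono (ℱ.mono hs) le_rfl
      have hh : ∀ i, Measurable[ℱ (t + 1)] fun ω =>
          (history (Doff ω) (fun s => Don s ω) t i).query := fun i =>
        measurable_query.comp (measurable_history hoffm (fun s hs => honm s (by omega)) i)
      have hq : Measurable[ℱ (t + 1)] fun ω => (Don t ω).query :=
        measurable_query.comp (honm t (by omega))
      exact (measurable_dotProduct_mulVec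
        (measurable_inv_apply (measurable_covMatrix hφm lam hh))
        (measurable_diffFeature_apply hφm hq)).const_mul _
    · exact mul_nonneg (by positivity) (diffFeature_inv_covMatrix_nonneg φ hlam0 _ _)
    · have := diffFeature_inv_covMatrix_le hφ hlam0
        (history (Doff ω) (fun s => Don s ω) t) (Don t ω).query
      calc W t ω ≤ lam / 4 * (4 / lam) := mul_le_mul_of_nonneg_left this (by positivity)
        _ = 1 := by field_simp
  have hcond : ∀ᵐ ω ∂P, ∀ t < T, (P[W t|ℱ t]) ω = lam / 4 *
      ∫ q, queryWidth φ lam Doff Don t ω q ∂(d₀ ⊗ₘ (πmain t ω ×ₖ πref)) := by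
    rw [ae_all_iff]
    intro t
    by_cases ht : t < T
    · have h1 := condExp_smul (μ := P) (lam / 4)
        (fun ω => queryWidth φ lam Doff Don t ω (Don t ω).query) (ℱ t)
      filter_upwards [h1, condExp_queryWidth hφm hφ hlam0 hη hrun ht] with ω h1 h2 _
      rw [Pi.smul_apply, h2] at h1
      exact h1
    · exact ae_of_all _ fun ω h => absurd h ht
  have hmain : ∀ᵐ ω ∂P, ω ∉ bad ∪ bad' →
      ∑ t ∈ Finset.range T, (value d₀ π₀ η (linReward φ θstar) πstar -
            value d₀ π₀ η (linReward φ θstar) (πmain t ω))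
        ≤ 100 * Q * (T : ℝ) ^ (α (Doff ω)) * Ccov (Doff ω)
          + 100 * Q * Real.sqrt (6 * T * d * Real.log (1 + T / (d * lam)))
          - η * ∑ t ∈ Finset.range T, ∫ x, klReal (πmain t ω x) (πstar x) ∂d₀ := by
    filter_upwards [hcov, hcond] with ω hcovω hcondω hω
    have hopt : ∀ t < T, IsOptimal d₀ π₀ η B φ (linReward φ (θhat t ω)) (πmain t ω) :=
      fun t ht => hrun.main_agent t ht ω
    refine sum_regret_add_kl_le hφm hφ hη hstar hs (hmle ω) hopt ?_
    have hcc : 0 ≤ (T : ℝ) ^ (α (Doff ω)) * Ccov (Doff ω) := by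
      have := hcovω.2.2.1
      positivity
    rcases le_or_gt ((T : ℝ) / (d * lam)) 1 with hx | hx
    · have h1 := trivial_regret_le hd hB hγ0 hL0 hlam hx
      have h2 : ∑ t ∈ Finset.range T, 2 * inner ℝ (θhat t ω - θstar)
          (∫ x, (feature φ (πmain t ω) x - feature φ πstar x) ∂d₀) ≤ T * (8 * B) := by
        refine (Finset.sum_le_card_nsmul _ _ (8 * B) fun t ht => ?_).trans (by simp)
        have htT := Finset.mem_range.1 ht
        exact inner_integral_feature_sub_le hφm hφ hη hstar hs (hmle ω t htT) (hopt t htT)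
      have h3 := mul_nonneg (show 0 ≤ 100 * Q by positivity) hcc
      rw [← hQ] at h1
      linarith
    · simp only [Set.mem_union, not_or] at hω
      obtain ⟨hω1, hω2⟩ := hω
      simp only [hbad, Set.mem_ofPred_eq, not_exists, not_and, not_le] at hω1
      simp only [hbad', Set.mem_ofPred_eq, not_lt] at hω2
      -- The regularization contributes `8 λ B² = 8 Q²`, the noise `128 · 4 d L / γ² = 512 Q²`.
      have hN : ∀ t < T, (θhat t ω - θstar).ofLp ⬝ᵥ
          covMatrix φ lam (history (Doff ω) (fun s => Don s ω) t) *ᵥ (θhat t ω - θstar).ofLp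
            ≤ 520 * Q ^ 2 := by
        intro t ht
        have hZ := selfNormalized_le_of_mixturePotential_lt hφ hd hlam4 ht.le hT hTδ (Doff ω)
          (fun s => Don s ω) _ (hω1 t ht)
        rw [← hLdef] at hZ
        have hV : (covMatrix φ lam (history (Doff ω) (fun s => Don s ω) t) +
            gramMatrix φ fun i => (Doff ω i).query).PosDef :=
          (posDef_covMatrix φ hlam0 _).add_posSemidef (posSemidef_gramMatrix φ _)
        have h := (hrun.mle t ht ω).sq_error_le hφ hγ hlam0.le hstar hr hV (fun u => ?_) hZ
        · rw [dotProduct_covMatrix_mulVec]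
          refine h.trans (le_of_eq ?_)
          rw [hQ2, hlam]; field_simp; ring
        -- The offline Gram matrix is dominated by the covariance of the history, so counting it
        -- twice at most doubles the form.
        · rw [add_mulVec, dotProduct_add, ← dotProduct_covMatrix_mulVec]
          have h1 : u ⬝ᵥ (gramMatrix φ fun i => (Doff ω i).query) *ᵥ u ≤
              u ⬝ᵥ covMatrix φ lam (history (Doff ω) (fun s => Don s ω) t) *ᵥ u := by
            rw [covMatrix_history, covMatrix_eq, add_mulVec, add_mulVec, dotProduct_add,
              dotProduct_add, smul_mulVec, one_mulVec, dotProduct_smul, smul_eq_mul]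
            have h2 : 0 ≤ u ⬝ᵥ u := by simpa using dotProduct_star_self_nonneg u
            have h3 : 0 ≤ u ⬝ᵥ (gramMatrix φ fun s : Fin t => (Don s ω).query) *ᵥ u := by
              rw [dotProduct_gramMatrix_mulVec]
              exact Finset.sum_nonneg fun _ _ => sq_nonneg _
            nlinarith [mul_nonneg hlam0.le h2]
          linarith
      set ℓ := Real.log (1 + T / (d * lam)) with hℓ
      -- This is where `T > dλ` is used: `ℓ` is bounded below, so additive constants can be absorbed
      -- into `d ℓ`.
      have hℓ2 : 1 / 2 ≤ ℓ := by
        have h1 : Real.log 2 ≤ ℓ := Real.log_le_log (by norm_num) (by linarith)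
        linarith [Real.log_two_gt_d9]
      have hw : ∑ t ∈ Finset.range T, ∫ q, diffFeature φ q ⬝ᵥ
          (covMatrix φ lam (history (Doff ω) (fun s => Don s ω) t))⁻¹ *ᵥ diffFeature φ q
            ∂(d₀ ⊗ₘ (πmain t ω ×ₖ πref)) ≤ 18 * d * ℓ := by
        have h1 := sum_elliptical_potential_le hφ hd hlam4 (Doff ω) (fun s => Don s ω) T
        have h2 : ∑ t ∈ Finset.range T, ((P[W t|ℱ t]) ω / 2 - W t ω) =
            lam / 8 * ∑ t ∈ Finset.range T, ∫ q, diffFeature φ q ⬝ᵥ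
              (covMatrix φ lam (history (Doff ω) (fun s => Don s ω) t))⁻¹ *ᵥ diffFeature φ q
                ∂(d₀ ⊗ₘ (πmain t ω ×ₖ πref)) -
            lam / 4 * ∑ t ∈ Finset.range T, diffFeature φ (Don t ω).query ⬝ᵥ
              (covMatrix φ lam (history (Doff ω) (fun s => Don s ω) t))⁻¹ *ᵥ
                diffFeature φ (Don t ω).query := by
          rw [Finset.mul_sum, Finset.mul_sum, ← Finset.sum_sub_distrib]
          refine Finset.sum_congr rfl fun t ht => ?_
          rw [hcondω t (Finset.mem_range.1 ht)]
          simp only [hW, queryWidth]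
          ring
        rw [h2] at hω2
        set V := ∑ t ∈ Finset.range T, ∫ q, diffFeature φ q ⬝ᵥ
          (covMatrix φ lam (history (Doff ω) (fun s => Don s ω) t))⁻¹ *ᵥ diffFeature φ q
            ∂(d₀ ⊗ₘ (πmain t ω ×ₖ πref))
        have h3 : Real.log (1 / δ) ≤ lam / 8 := by
          have : L ≤ d * L := le_mul_of_one_le_left hL0.le hd'
          linarith
        -- The compensator bound reads `λ V / 8 ≤ (λ / 4) · 8 d ℓ + λ / 8`, so `V ≤ 16 d ℓ + 1 ≤ 18
        -- d ℓ`.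
        have h4 : lam * V ≤ lam * (18 * d * ℓ) := by
          have h5 := mul_le_mul_of_nonneg_left h1 hlam0.le
          have h6 : 1 / 2 ≤ d * ℓ := by nlinarith
          have h7 := mul_le_mul_of_nonneg_left h6 hlam0.le
          linarith
        exact le_of_mul_le_mul_left h4 hlam0
      have hfin := sum_inner_le_of_confidence hφm hφ hη hs hopt hlam0 hT
        (show 0 < 520 * Q ^ 2 by positivity) (show 0 < 18 * d * ℓ by positivity)
        (Doff ω) (fun s => Don s ω) hN hw hcovω
      refine hfin.trans ?_
      have s1 : Real.sqrt (520 * Q ^ 2) ≤ 50 * Q := by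
        rw [Real.sqrt_le_left (by positivity)]
        nlinarith [sq_nonneg Q]
      have s2 : Real.sqrt (18 * d * ℓ * T * (520 * Q ^ 2)) ≤
          50 * Q * Real.sqrt (6 * T * d * ℓ) := by
        rw [Real.sqrt_le_left (by positivity), mul_pow,
          Real.sq_sqrt (show 0 ≤ 6 * T * d * ℓ by positivity)]
        have : 0 ≤ Q ^ 2 * (T * d * ℓ) := by positivity
        nlinarith
      have s3 := mul_le_mul_of_nonneg_right s1 hcc
      linarith
  calc _ ≤ P (bad ∪ bad') := by
        refine measure_mono_ae ?_
        filter_upwards [hmain] with ω h hω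
        by_contra hcon
        exact hω (h hcon)
    _ ≤ P bad + P bad' := measure_union_le _ _
    _ ≤ ENNReal.ofReal δ + ENNReal.ofReal δ := add_le_add hPbad hPbad'
    _ = ENNReal.ofReal (2 * δ) := by rw [← ENNReal.ofReal_add hδ.le hδ.le, two_mul]

end RLHF

theorem mainTheorem5 :
    ∃ C : ℝ, 0 < C ∧
      ∀ (X A Ω : Type*) [MeasurableSpace X] [MeasurableSpace A] [mΩ : MeasurableSpace Ω]
        (P : Measure Ω) [IsProbabilityMeasure P]
        (d : ℕ) (_ : 0 < d)
        (φ : X → A → EuclideanSpace ℝ (Fin d)) (_ : Measurable (Function.uncurry φ))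
        (_ : ∀ x a, ‖φ x a‖ ≤ 1)
        (B : ℝ) (_ : 0 < B) (γ : ℝ) (_ : γ = 1 / (2 + Real.exp (-B) + Real.exp B))
        (θstar : EuclideanSpace ℝ (Fin d)) (_ : ‖θstar‖ ≤ B)
        (_ : ∀ x a, RLHF.linReward φ θstar x a ∈ Set.Icc (0 : ℝ) 1)
        (d₀ : Measure X) [IsProbabilityMeasure d₀]
        (π₀ πref : Kernel X A) [IsMarkovKernel π₀] [IsMarkovKernel πref]
        (η : ℝ) (_ : 0 < η)
        (πstar : Kernel X A)
        (_ : RLHF.IsOptimal d₀ π₀ η B φ (RLHF.linReward φ θstar) πstar)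
        (T : ℕ) (_ : 0 < T) (δ : ℝ) (_ : 0 < δ) (_ : δ < 1)
        (lam : ℝ) (_ : lam = d * Real.log (T / δ) / (γ ^ 2 * B ^ 2))
        (β : ℝ) (_ : β = C * Real.sqrt (d * Real.log (T / δ) / γ ^ 2))
        (n : ℕ) (Doff : Ω → Fin n → RLHF.Comparison X A)
        (_ : RLHF.IsOfflineData P (RLHF.linReward φ θstar) Doff)
        (α Ccov : (Fin n → RLHF.Comparison X A) → ℝ)
        (_ : ∀ᵐ ω ∂P, RLHF.PartialCoverage d₀ φ πstar πref lam T (Doff ω)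
          (α (Doff ω)) (Ccov (Doff ω)))
        (ℱ : Filtration ℕ mΩ) (Don : ℕ → Ω → RLHF.Comparison X A)
        (θhat : ℕ → Ω → EuclideanSpace ℝ (Fin d)) (πmain : ℕ → Ω → Kernel X A)
        (_ : RLHF.IsHybridRun P φ B η d₀ π₀ πref (RLHF.linReward φ θstar) Doff T ℱ
          Don θhat πmain),
        P {ω | ¬ (∑ t ∈ Finset.range T,
              (RLHF.value d₀ π₀ η (RLHF.linReward φ θstar) πstar -
                RLHF.value d₀ π₀ η (RLHF.linReward φ θstar) (πmain t ω))
            ≤ β * (T : ℝ) ^ (α (Doff ω)) * Ccov (Doff ω)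
              + β * Real.sqrt (6 * T * d * Real.log (1 + T / (d * lam)))
              - η * ∑ t ∈ Finset.range T,
                  ∫ x, RLHF.klReal (πmain t ω x) (πstar x) ∂d₀)}
          ≤ ENNReal.ofReal (2 * δ) := by
  refine ⟨100, by norm_num, ?_⟩
  intro X A Ω _ _ mΩ P _ d hd φ hφm hφ B hB γ hγ θstar hstar hr d₀ _ π₀ πref _ _ η hη πstar hs
    T hT δ hδ _ lam hlam β hβ n Doff hoff α Ccov hcov ℱ Don θhat πmain hrun
  -- For `δ ≥ 1/2` the allowed failure probability `2 δ` is at least one.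
  rcases lt_or_ge δ (1 / 2) with h | h
  · rw [hβ]
    exact RLHF.measure_regret_gt_le P d hd φ hφm hφ B hB γ hγ θstar hstar hr d₀ π₀ πref η hη πstar
      hs T hT δ hδ h lam hlam n Doff hoff α Ccov hcov ℱ Don θhat πmain hrun
  · exact prob_le_one.trans (by rw [ENNReal.one_le_ofReal]; linarith)
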